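/- Let $s\ge 4$ be an integer. For an integer $k\ge 0$ let $H^k=H^k(\mathbb{R}^3)$ be the real Sobolev space with norm $\|f\|_k=\big(\sum_{|\alpha|\le k}\|\partial^\alpha f\|_{L^2}^2\big)^{1/2}$, and $\|\cdot\|=\|\cdot\|_0$; for a list of functions, $\|[f_1,\dots,f_m]\|_k^2=\sum_j\|f_j\|_k^2$. For $U=[\rho,u,\Theta,E,B]\in H^s$ ($\rho,\Theta$ scalar, $u,E,B$ with values in $\mathbb{R}^3$) put $$\mathcal{N}_s(U)=\|[\rho,u,\Theta]\|_s^2+\|\nabla[E,B]\|_{s-2}^2+\|E\|^2 .$$ Consider the non-isentropic Euler–Maxwell system on $\mathbb{R}^3$ $$\begin{cases} \partial_t \rho + \nabla\cdot((1+\rho)u)=0,\\ \partial_t u + (u\cdot\nabla)u+\nabla\Theta+\frac{1+\Theta}{1+\rho}\nabla\rho=-(E+u\times B)-u,\\ \partial_t\Theta+u\cdot\nabla\Theta+\frac23(1+\Theta)\nabla\cdot u=\frac13|u|^2-\Theta,\\ \partial_t E-\nabla\times B=(1+\rho)u,\\ \partial_t B+\nabla\times E=0,\\ \nabla\cdot E=-\rho,\qquad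 \nabla\cdot B=0. \end{cases}\qquad (\ast)$$ **Theorem 3.1.** There exist functionals $\mathcal{E}_s,\mathcal{D}_s:H^s\to\mathbb{R}$ and constants $\delta_0>0$, $\kappa\in(0,1)$, $\gamma>0$, $C>0$, all depending only on $s$, such that: 1. $\kappa\|U\|_s^2\le\mathcal{E}_s(U)\le\kappa^{-1}\|U\|_s^2$ for every $U\in H^s$ with $\|U\|_s\le\delta_0$; 2. $\kappa\,\mathcal{N}_s(U)\le\mathcal{D}_s(U)\le\kappa^{-1}\mathcal{N}_s(U)$ for every $U\in H^s$; 3. for every $\delta\le\delta_0$ and $T>0$, if $U=[\rho,u,\Theta,E,B]\in C([0,T);H^s)\cap C^1([0,T);H^{s-1})$ solves $(\ast)$ for $t\in(0,T)$ and $\|U(t)\|_s\le\delta$ for all $t\in[0,T)$, then $t\mapsto\mathcal{E}_s(U(t))$ is differentiable on $[0,T)$ (from the right at $t=0$) and $$\frac{d}{dt}\mathcal{E}_s(U(t))+\gamma\,\mathcal{D}_s(U(t))\le C\big[\mathcal{E}_s(U(t))^{1/2}+\mathcal{E}_s(U(t))\big]\mathcal{D}_s(U(t)),\qquad 0\le t<T.$$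 -/

import Mathlib

open MeasureTheory Set
open scoped ContDiff

noncomputable section

namespace EulerMaxwell

/-! ### Sobolev spaces of integer order on `ℝ³`, through weak derivatives -/

/-- The Euclidean space `ℝ³`, used both for positions and for vector values. -/
abbrev Vec : Type := EuclideanSpace ℝ (Fin 3)

/-- Multi-indices `α = (α₀, α₁, α₂)`. -/
abbrev MultiIndex : Type := Fin 3 → ℕ

/-- The order `|α|`. -/
def MultiIndex.order (α : MultiIndex) : ℕ := ∑ i, α i

/-- The finite set of all multi-indices with `|α| ≤ k`. -/
def multiIndices (k : ℕ) : Finset MultiIndex :=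
  (Fintype.piFinset fun _ : Fin 3 => Finset.range (k + 1)).filter fun α => α.order ≤ k

theorem mem_multiIndices {k : ℕ} {α : MultiIndex} : α ∈ multiIndices k ↔ α.order ≤ k := by
  simp only [multiIndices, Finset.mem_filter, Fintype.mem_piFinset, Finset.mem_range,
    and_iff_right_iff_imp]
  intro h i
  have := Finset.single_le_sum (f := α) (fun j _ => Nat.zero_le _) (Finset.mem_univ i)
  have h' : ∑ i, α i ≤ k := h
  omega

theorem zero_mem_multiIndices (k : ℕ) : (0 : MultiIndex) ∈ multiIndices k := by
  simp [mem_multiIndices, MultiIndex.order]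

theorem multiIndices_mono {l k : ℕ} (h : l ≤ k) {α : MultiIndex} (hα : α ∈ multiIndices l) :
    α ∈ multiIndices k :=
  mem_multiIndices.2 ((mem_multiIndices.1 hα).trans h)

/-- The classical partial derivative `∂ᵢφ`. -/
def partialDeriv (i : Fin 3) (φ : Vec → ℝ) : Vec → ℝ :=
  fun x => fderiv ℝ φ x (EuclideanSpace.single i 1)

/-- The classical derivative `∂^α φ = ∂₀^α₀ ∂₁^α₁ ∂₂^α₂ φ`. -/
def iterPartial (α : MultiIndex) (φ : Vec → ℝ) : Vec → ℝ :=
  (partialDeriv 0)^[α 0] ((partialDeriv 1)^[α 1] ((partialDeriv 2)^[α 2] φ))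

/-- Test functions: real-valued, smooth, with compact support. -/
def IsTest (φ : Vec → ℝ) : Prop := ContDiff ℝ ∞ φ ∧ HasCompactSupport φ

theorem IsTest.partialDeriv {φ : Vec → ℝ} (h : IsTest φ) (i : Fin 3) :
    IsTest (partialDeriv i φ) :=
  ⟨(h.1.fderiv_right (m := ∞) (by simp)).clm_apply contDiff_const, h.2.fderiv_apply ℝ _⟩

theorem IsTest.iterate {φ : Vec → ℝ} (h : IsTest φ) (i : Fin 3) (n : ℕ) :
    IsTest ((EulerMaxwell.partialDeriv i)^[n] φ) := by
  induction n with
  | zero => exact h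
  | succ n ih => rw [Function.iterate_succ_apply']; exact ih.partialDeriv i

theorem IsTest.iterPartial {φ : Vec → ℝ} (h : IsTest φ) (α : MultiIndex) :
    IsTest (iterPartial α φ) :=
  ((h.iterate 2 _).iterate 1 _).iterate 0 _

section Sobolev

variable {V : Type} [NormedAddCommGroup V] [InnerProductSpace ℝ V]

/-- `g` is the weak derivative `∂^α f`. -/
def IsWeakDeriv (α : MultiIndex) (f g : Vec → V) : Prop :=
  ∀ φ : Vec → ℝ, IsTest φ →
    ∫ x, iterPartial α φ x • f x = (-1 : ℝ) ^ α.order • ∫ x, φ x • g x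

theorem IsTest.integrable_smul {φ : Vec → ℝ} (h : IsTest φ) (f : Lp V 2 (volume : Measure Vec)) :
    Integrable (fun x => φ x • f x) :=
  ((Lp.memLp f).locallyIntegrable (by norm_num)).integrable_smul_left_of_hasCompactSupport
    h.1.continuous h.2

theorem integral_smul_add {φ : Vec → ℝ} (h : IsTest φ) (f g : Lp V 2 (volume : Measure Vec)) :
    ∫ x, φ x • (f + g) x = (∫ x, φ x • f x) + ∫ x, φ x • g x := by
  rw [← integral_add (h.integrable_smul f) (h.integrable_smul g)]
  refine integral_congr_ae ?_
  filter_upwards [Lp.coeFn_add f g] with x hx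
  rw [hx, Pi.add_apply, smul_add]

theorem integral_smul_smul {φ : Vec → ℝ} (c : ℝ) (f : Lp V 2 (volume : Measure Vec)) :
    ∫ x, φ x • (c • f) x = c • ∫ x, φ x • f x := by
  rw [← integral_smul]
  refine integral_congr_ae ?_
  filter_upwards [Lp.coeFn_smul c f] with x hx
  rw [hx, Pi.smul_apply, smul_comm]

theorem integral_smul_zero {φ : Vec → ℝ} :
    ∫ x, φ x • (0 : Lp V 2 (volume : Measure Vec)) x = 0 := by
  have h := integral_smul_smul (φ := φ) (0 : ℝ) (0 : Lp V 2 (volume : Measure Vec))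
  rwa [zero_smul, zero_smul] at h

/-- The families `(f_α)_{|α| ≤ k}` of square-integrable functions in which `f_α` is the weak
derivative `∂^α f₀` for every `α`. -/
def sobolevSubmodule (k : ℕ) (V : Type) [NormedAddCommGroup V] [InnerProductSpace ℝ V] :
    Submodule ℝ (PiLp 2 fun _ : multiIndices k => Lp V 2 (volume : Measure Vec)) where
  carrier := {F | ∀ α : multiIndices k, IsWeakDeriv α.1 (F ⟨0, zero_mem_multiIndices k⟩) (F α)}
  add_mem' := by
    intro F G hF hG α φ hφ
    simp only [PiLp.add_apply]
    rw [integral_smul_add (hφ.iterPartial _), integral_smul_add hφ, hF α φ hφ, hG α φ hφ,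
      smul_add]
  zero_mem' := by
    intro α φ hφ
    simp only [PiLp.zero_apply]
    rw [integral_smul_zero, integral_smul_zero, smul_zero]
  smul_mem' := by
    intro c F hF α φ hφ
    simp only [PiLp.smul_apply]
    rw [integral_smul_smul, integral_smul_smul, hF α φ hφ, smul_comm]

/-- The Sobolev space `H^k(ℝ³; V)`: the function `f` is carried together with its weak derivatives
`∂^α f ∈ L²`, `|α| ≤ k`, which are determined by `f`. The norm inherited from the `ℓ²` sum is
`‖f‖_k = (∑_{|α| ≤ k} ‖∂^α f‖²_{L²})^{1/2}`. -/
abbrev Sobolev (k : ℕ) (V : Type) [NormedAddCommGroup V] [InnerProductSpace ℝ V] : Type :=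
  sobolevSubmodule k V

/-- The weak derivative `∂^α f ∈ L²` for `|α| ≤ k` (and the dummy value `0` for `|α| > k`). -/
def Sobolev.D {k : ℕ} (f : Sobolev k V) (α : MultiIndex) : Lp V 2 (volume : Measure Vec) :=
  if h : α ∈ multiIndices k then f.1 ⟨α, h⟩ else 0

/-- The function itself. -/
def Sobolev.fn {k : ℕ} (f : Sobolev k V) : Lp V 2 (volume : Measure Vec) := f.D 0

/-- The weak partial derivative `∂ᵢ f` (meaningful for `k ≥ 1`). -/
def Sobolev.pd {k : ℕ} (f : Sobolev k V) (i : Fin 3) : Lp V 2 (volume : Measure Vec) :=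
  f.D (Pi.single i 1)

/-- The inclusion `H^k ⊆ H^l` for `l ≤ k`. -/
def Sobolev.incl {k l : ℕ} (h : l ≤ k) (f : Sobolev k V) : Sobolev l V :=
  ⟨WithLp.toLp 2 fun α => f.1 ⟨α.1, multiIndices_mono h α.2⟩,
    fun α => f.2 ⟨α.1, multiIndices_mono h α.2⟩⟩

/-- `‖∇f‖_l² = ∑ᵢ ∑_{|β| ≤ l} ‖∂^β ∂ᵢ f‖²` for `f ∈ H^k` (meaningful for `l + 1 ≤ k`). -/
def Sobolev.gradNormSq {k : ℕ} (l : ℕ) (f : Sobolev k V) : ℝ :=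
  ∑ i : Fin 3, ∑ β ∈ multiIndices l, ‖f.D (β + Pi.single i 1)‖ ^ 2

end Sobolev

/-! ### Differential operators of the system -/

/-- `∇f` for a scalar `f`. -/
def grad {k : ℕ} (f : Sobolev k ℝ) (x : Vec) : Vec := WithLp.toLp 2 fun i => f.pd i x

/-- `∇ · F` for a vector field `F`. -/
def div {k : ℕ} (F : Sobolev k Vec) (x : Vec) : ℝ := ∑ i, (F.pd i x) i

/-- `∇ × F` for a vector field `F` (coordinates are numbered `0, 1, 2`). -/
def curl {k : ℕ} (F : Sobolev k Vec) (x : Vec) : Vec :=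
  !₂[(F.pd 1 x) 2 - (F.pd 2 x) 1, (F.pd 2 x) 0 - (F.pd 0 x) 2, (F.pd 0 x) 1 - (F.pd 1 x) 0]

/-- `(a · ∇)F` at `x`, for a vector `a` and a scalar or vector field `F`. -/
def advect {k : ℕ} {V : Type} [NormedAddCommGroup V] [InnerProductSpace ℝ V]
    (a : Vec) (F : Sobolev k V) (x : Vec) : V := ∑ j, a j • F.pd j x

/-- The cross product on `ℝ³`. -/
def cross (a b : Vec) : Vec := WithLp.toLp 2 (crossProduct a.ofLp b.ofLp)

/-- `∇ · F = g` in the sense of distributions. -/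
def HasWeakDiv (F : Vec → Vec) (g : Vec → ℝ) : Prop :=
  ∀ φ : Vec → ℝ, IsTest φ →
    ∫ x, ∑ i, partialDeriv i φ x * F x i = - ∫ x, φ x * g x

/-! ### The system -/

/-- A state `U = [ρ, u, Θ, E, B]` in `H^k(ℝ³)`. -/
structure State (k : ℕ) where
  ρ : Sobolev k ℝ
  u : Sobolev k Vec
  Θ : Sobolev k ℝ
  E : Sobolev k Vec
  B : Sobolev k Vec

/-- `‖U‖_k²`. -/
def State.normSq {k : ℕ} (U : State k) : ℝ :=
  ‖U.ρ‖ ^ 2 + ‖U.u‖ ^ 2 + ‖U.Θ‖ ^ 2 + ‖U.E‖ ^ 2 + ‖U.B‖ ^ 2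

/-- `‖U‖_k`. -/
def State.norm {k : ℕ} (U : State k) : ℝ := √U.normSq

/-- `‖[ρ, u, Θ]‖_s² + ‖∇[E, B]‖_{s-2}² + ‖E‖²`. -/
def State.dissipation {s : ℕ} (U : State s) : ℝ :=
  (‖U.ρ‖ ^ 2 + ‖U.u‖ ^ 2 + ‖U.Θ‖ ^ 2) + (U.E.gradNormSq (s - 2) + U.B.gradNormSq (s - 2))
    + ‖U.E.fn‖ ^ 2

/-- The path `f` belongs to `C([0,T); H^s) ∩ C¹([0,T); H^{s-1})`. -/
def IsRegularPath {s : ℕ} {V : Type} [NormedAddCommGroup V] [InnerProductSpace ℝ V]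
    (T : ℝ) (f : ℝ → Sobolev s V) : Prop :=
  ContinuousOn f (Ico 0 T) ∧
    ContDiffOn ℝ 1 (fun t => (f t).incl (Nat.sub_le s 1)) (Ico 0 T)

/-- The time derivative of a path, taken in `H^{s-1}`. -/
def timeDeriv {s : ℕ} {V : Type} [NormedAddCommGroup V] [InnerProductSpace ℝ V]
    (f : ℝ → Sobolev s V) (t : ℝ) : Lp V 2 (volume : Measure Vec) :=
  (deriv (fun τ => (f τ).incl (Nat.sub_le s 1)) t).fn

/-- `U ∈ C([0,T); H^s) ∩ C¹([0,T); H^{s-1})` solves the system for `t ∈ (0,T)`. The mass equation is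
written with the distributional divergence of `(1+ρ)u`, the other equations hold for almost every
`x`. -/
structure IsSolution {s : ℕ} (T : ℝ) (U : ℝ → State s) : Prop where
  regular_ρ : IsRegularPath T fun t => (U t).ρ
  regular_u : IsRegularPath T fun t => (U t).u
  regular_Θ : IsRegularPath T fun t => (U t).Θ
  regular_E : IsRegularPath T fun t => (U t).E
  regular_B : IsRegularPath T fun t => (U t).B
  mass : ∀ t ∈ Ioo 0 T,
    HasWeakDiv (fun x => (1 + (U t).ρ.fn x) • (U t).u.fn x)
      (fun x => - timeDeriv (fun τ => (U τ).ρ) t x)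
  momentum : ∀ t ∈ Ioo 0 T, ∀ᵐ x : Vec,
    timeDeriv (fun τ => (U τ).u) t x + advect ((U t).u.fn x) (U t).u x + grad (U t).Θ x
        + ((1 + (U t).Θ.fn x) / (1 + (U t).ρ.fn x)) • grad (U t).ρ x
      = -((U t).E.fn x + cross ((U t).u.fn x) ((U t).B.fn x)) - (U t).u.fn x
  temperature : ∀ t ∈ Ioo 0 T, ∀ᵐ x : Vec,
    timeDeriv (fun τ => (U τ).Θ) t x + advect ((U t).u.fn x) (U t).Θ x
        + 2 / 3 * (1 + (U t).Θ.fn x) * div (U t).u x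
      = 1 / 3 * ‖(U t).u.fn x‖ ^ 2 - (U t).Θ.fn x
  ampere : ∀ t ∈ Ioo 0 T, ∀ᵐ x : Vec,
    timeDeriv (fun τ => (U τ).E) t x - curl (U t).B x = (1 + (U t).ρ.fn x) • (U t).u.fn x
  faraday : ∀ t ∈ Ioo 0 T, ∀ᵐ x : Vec,
    timeDeriv (fun τ => (U τ).B) t x + curl (U t).E x = 0
  gauss_E : ∀ t ∈ Ioo 0 T, ∀ᵐ x : Vec, div (U t).E x = - (U t).ρ.fn x
  gauss_B : ∀ t ∈ Ioo 0 T, ∀ᵐ x : Vec, div (U t).B x = 0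

end EulerMaxwell

end

/-! Write `s = m + 1` with `m ≥ 3`. Near the constant state the equations damp only `u` and `Θ`
directly; `ρ`, `E` and `B` acquire dissipation through their coupling to the other unknowns. The
functional is therefore an energy equivalent to `‖U‖_s²`, corrected by small multiples of three
families of interaction terms. Pairing `∂^α u` with `∇∂^α ρ` dissipates `ρ` together with its
gradient, the term without a gradient coming from Gauss's law. Pairing `∂^α u` with `∂^α E`
dissipates `E` up to order `s - 1`. Pairing `-∂^α E` with `∇ × ∂^α B`, for `|α| ≤ s - 2`, dissipates
the curl of `B`, hence `∇B`, since `B` is divergence free. Each gain is paid for with quantities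
dissipated at an earlier level, so the weights `ε`, `ε²`, `ε³` close the hierarchy
(`combine_dissipation`). As functional `𝓓` one can take `𝓝_s` itself.

The errors are cubic. Let `M` bound the whole state in `H^s`, and let `K² = ‖[ρ, u, Θ]‖_s²`. Every
error is at most a constant times `M` times a product of two dissipated quantities, that is, a
constant times `M` times the dissipation; and `M` is at most twice the square root of the energy.
This works although `B` itself and the derivatives of `E` and `B` of order `s` are not dissipated:
wherever these occur in an error, the two remaining factors are fluid variables.

Two difficulties arise at order `s`. The system is quasilinear, so differentiating it `s` times
leaves products with derivatives of order `s + 1`. They disappear after integration by parts if the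
quadratic form carries a symmetrizer. Here the weights are `(1+Θ)²` for `ρ`, `(1+ρ)²(1+Θ)` for `u`
and `3/2 (1+ρ)²` for `Θ`: polynomial multiples of the usual ones, which avoid quotients.
`TopSys.rate` is this cancellation. For the same reason the pressure term `P = (1+Θ)/(1+ρ) ∇ρ` is
treated as an unknown with `(1+ρ)P = (1+Θ)∇ρ`.

Moreover a solution is only `C¹` in time with values in `H^(s-1)`, so `∂_t ∂^α U` with `|α| = s`
need not be square integrable. One derivative is replaced by a difference quotient of step `h`. For
`h ≠ 0` the weighted energy is differentiable by the chain rule. Both this energy and its rate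
extend continuously to `h = 0`, because a difference quotient is an average of the weak derivative
and the commutators gain a derivative (`exists_dq_commutator`). The integrated identity passes to
the limit and is differentiated again (`hasDerivWithinAt_of_continuousOn_prod`). In the interaction
terms the missing time derivative is moved by parts to the other factor
(`hasDerivWithinAt_inner_wd`).

The analysis behind this consists of the embedding `H² ⊆ L^∞` (`ae_abs_le`), the product estimates
it implies (`exists_mul`), and the description of weak derivatives by difference quotients
(`WD.avg_eq`, `WD.of_tendsto_dq`). -/

noncomputable section

namespace EulerMaxwell

open scoped InnerProductSpace Topology
open Filter

/-! ### Weak derivatives of scalar square-integrable functions -/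

/-- Square-integrable scalar functions on `ℝ³`. -/
abbrev L2 : Type := Lp ℝ 2 (volume : Measure Vec)

theorem partialDeriv_comm {φ : Vec → ℝ} (h : IsTest φ) (i j : Fin 3) :
    partialDeriv i (partialDeriv j φ) = partialDeriv j (partialDeriv i φ) := by
  have hd : Differentiable ℝ (fderiv ℝ φ) :=
    (h.1.fderiv_right (m := 1) (by norm_cast)).differentiable one_ne_zero
  have key : ∀ k l : Fin 3, ∀ x, partialDeriv k (partialDeriv l φ) x
      = fderiv ℝ (fderiv ℝ φ) x (EuclideanSpace.single k 1) (EuclideanSpace.single l 1) := by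
    intro k l x
    unfold partialDeriv
    rw [fderiv_clm_apply (hd x) (differentiableAt_const _)]
    simp
  funext x
  rw [key, key]
  have := (h.1.contDiffAt (x := x)).isSymmSndFDerivAt
    (by simp only [minSmoothness_of_isRCLikeNormedField]; norm_cast)
  exact this _ _

theorem iterate_partialDeriv_comm {φ : Vec → ℝ} (h : IsTest φ) (i j : Fin 3) (m n : ℕ) :
    (partialDeriv i)^[m] ((partialDeriv j)^[n] φ) =
      (partialDeriv j)^[n] ((partialDeriv i)^[m] φ) := by
  have one : ∀ m : ℕ, ∀ ψ, IsTest ψ →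
      (partialDeriv i)^[m] (partialDeriv j ψ) = partialDeriv j ((partialDeriv i)^[m] ψ) := by
    intro m
    induction m with
    | zero => intro ψ _; rfl
    | succ m ih =>
      intro ψ hψ
      rw [Function.iterate_succ_apply', ih ψ hψ, Function.iterate_succ_apply',
        partialDeriv_comm (hψ.iterate i m)]
  induction n with
  | zero => rfl
  | succ n ih =>
    rw [Function.iterate_succ_apply', one m _ (h.iterate j n), ih, Function.iterate_succ_apply']

theorem iterPartial_iterPartial {φ : Vec → ℝ} (h : IsTest φ) (α β : MultiIndex) :
    iterPartial α (iterPartial β φ) = iterPartial (α + β) φ := by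
  simp only [iterPartial, Pi.add_apply, Function.iterate_add_apply]
  rw [iterate_partialDeriv_comm ((h.iterate 2 _).iterate 1 _) 2 0,
    iterate_partialDeriv_comm (((h.iterate 2 _).iterate 1 _).iterate 2 _) 1 0,
    iterate_partialDeriv_comm (h.iterate 2 _) 2 1]

theorem order_add (α β : MultiIndex) : (α + β).order = α.order + β.order := by
  simp [MultiIndex.order, Finset.sum_add_distrib]

@[simp] theorem order_zero : (0 : MultiIndex).order = 0 := by simp [MultiIndex.order]

/-- The multi-index of `∂ᵢ`. -/
def unitIndex (i : Fin 3) : MultiIndex := Pi.single i 1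

@[simp] theorem order_unitIndex (i : Fin 3) : (unitIndex i).order = 1 := by
  simp [MultiIndex.order, unitIndex]

@[simp] theorem iterPartial_zero (φ : Vec → ℝ) : iterPartial 0 φ = φ := by
  simp [iterPartial]

@[simp] theorem iterPartial_unitIndex (i : Fin 3) (φ : Vec → ℝ) :
    iterPartial (unitIndex i) φ = partialDeriv i φ := by
  fin_cases i <;> simp [iterPartial, unitIndex]

/-- A test function as an element of `L²`. -/
def IsTest.toL2 {φ : Vec → ℝ} (h : IsTest φ) : L2 :=
  (h.1.continuous.memLp_of_hasCompactSupport h.2).toLp φ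

theorem IsTest.coeFn_toL2 {φ : Vec → ℝ} (h : IsTest φ) : h.toL2 =ᵐ[volume] φ :=
  MemLp.coeFn_toLp _

theorem inner_L2 (f g : L2) : ⟪f, g⟫_ℝ = ∫ x, f x * g x := by
  rw [L2.inner_def]
  simp [mul_comm]

theorem IsTest.inner_toL2 {φ : Vec → ℝ} (h : IsTest φ) (f : L2) :
    ⟪h.toL2, f⟫_ℝ = ∫ x, φ x • f x := by
  rw [inner_L2]
  refine integral_congr_ae ?_
  filter_upwards [h.coeFn_toL2] with x hx
  rw [hx, smul_eq_mul]

theorem L2.eq_zero_of_inner_test {g : L2} (hg : ∀ φ, ∀ h : IsTest φ, ⟪h.toL2, g⟫_ℝ = 0) :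
    g = 0 := by
  have := ae_eq_zero_of_integral_contDiff_smul_eq_zero (μ := (volume : Measure Vec)) (f := g)
    ((Lp.memLp g).locallyIntegrable (by norm_num)) ?_
  · exact (Lp.eq_zero_iff_ae_eq_zero).2 this
  · intro φ h1 h2
    have h : IsTest φ := ⟨h1, h2⟩
    rw [← h.inner_toL2]
    exact hg φ h

theorem L2.eq_of_inner_test {f g : L2}
    (hg : ∀ φ, ∀ h : IsTest φ, ⟪h.toL2, f⟫_ℝ = ⟪h.toL2, g⟫_ℝ) : f = g := by
  rw [← sub_eq_zero]
  refine L2.eq_zero_of_inner_test fun φ h => ?_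
  rw [inner_sub_right, hg φ h, sub_self]

theorem isWeakDeriv_iff {α : MultiIndex} {f g : L2} :
    IsWeakDeriv α f g ↔ ∀ φ, ∀ h : IsTest φ,
      ⟪(h.iterPartial α).toL2, f⟫_ℝ = (-1) ^ α.order * ⟪h.toL2, g⟫_ℝ := by
  refine forall_congr' fun φ => forall_congr' fun h => ?_
  rw [IsTest.inner_toL2, IsTest.inner_toL2, smul_eq_mul]

theorem IsTest.toL2_congr {φ ψ : Vec → ℝ} (h : IsTest φ) (h' : IsTest ψ) (e : φ = ψ) :
    h.toL2 = h'.toL2 := by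
  subst e; rfl

theorem IsWeakDeriv.unique {α : MultiIndex} {f g g' : L2} (h : IsWeakDeriv α f g)
    (h' : IsWeakDeriv α f g') : g = g' := by
  refine L2.eq_of_inner_test fun φ hφ => ?_
  have h1 := isWeakDeriv_iff.1 h φ hφ
  rw [isWeakDeriv_iff.1 h' φ hφ] at h1
  exact (mul_left_cancel₀ (pow_ne_zero _ (by norm_num)) h1).symm

theorem IsWeakDeriv.comp {α β : MultiIndex} {f g k : L2} (h : IsWeakDeriv α f g)
    (h' : IsWeakDeriv β g k) : IsWeakDeriv (β + α) f k := by
  rw [isWeakDeriv_iff] at *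
  intro φ hφ
  have e : iterPartial (β + α) φ = iterPartial α (iterPartial β φ) := by
    rw [iterPartial_iterPartial hφ, add_comm]
  rw [IsTest.toL2_congr (hφ.iterPartial _) ((hφ.iterPartial β).iterPartial α) e,
    h _ (hφ.iterPartial β), h' _ hφ, order_add]
  ring

/-- Test `f` against `∂^α ∂^β φ = ∂^(β+α) φ`: one hypothesis expresses the pairing through `g`, the
other through `k`. No approximation by smooth functions is needed. This is what makes a derivative
of a Sobolev function a Sobolev function. -/
theorem IsWeakDeriv.of_comp {α β : MultiIndex} {f g k : L2} (h : IsWeakDeriv α f g)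
    (h' : IsWeakDeriv (β + α) f k) : IsWeakDeriv β g k := by
  rw [isWeakDeriv_iff] at *
  intro φ hφ
  have e : iterPartial (β + α) φ = iterPartial α (iterPartial β φ) := by
    rw [iterPartial_iterPartial hφ, add_comm]
  have h1 := h' φ hφ
  rw [IsTest.toL2_congr (hφ.iterPartial _) ((hφ.iterPartial β).iterPartial α) e,
    h _ (hφ.iterPartial β), order_add, pow_add] at h1
  have h2 : ((-1 : ℝ) ^ α.order) ≠ 0 := pow_ne_zero _ (by norm_num)
  refine mul_left_cancel₀ h2 ?_
  linear_combination h1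

theorem isWeakDeriv_zero (f : L2) : IsWeakDeriv 0 f f := by
  rw [isWeakDeriv_iff]
  intro φ hφ
  rw [IsTest.toL2_congr (hφ.iterPartial _) hφ (iterPartial_zero φ)]
  simp

/-- `g` is the weak partial derivative `∂ᵢ f`. -/
def WD (i : Fin 3) (f g : L2) : Prop := IsWeakDeriv (unitIndex i) f g

theorem WD_iff {i : Fin 3} {f g : L2} :
    WD i f g ↔ ∀ φ, ∀ h : IsTest φ, ⟪(h.partialDeriv i).toL2, f⟫_ℝ = - ⟪h.toL2, g⟫_ℝ := by
  rw [WD, isWeakDeriv_iff]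
  refine forall_congr' fun φ => forall_congr' fun h => ?_
  rw [IsTest.toL2_congr (h.iterPartial _) (h.partialDeriv i) (iterPartial_unitIndex i φ)]
  simp

/-! ### The scalar Sobolev spaces -/

/-- The scalar Sobolev space `H^k`. -/
abbrev X (k : ℕ) : Type := Sobolev k ℝ

section General
variable {V : Type} [NormedAddCommGroup V] [InnerProductSpace ℝ V] {k : ℕ}

theorem Sobolev.D_of_le (f : Sobolev k V) {α : MultiIndex} (h : α.order ≤ k) :
    f.D α = f.1 ⟨α, mem_multiIndices.2 h⟩ := dif_pos (mem_multiIndices.2 h)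

theorem Sobolev.D_add (f g : Sobolev k V) (α : MultiIndex) : (f + g).D α = f.D α + g.D α := by
  unfold Sobolev.D; split_ifs <;> simp

theorem Sobolev.D_smul (c : ℝ) (f : Sobolev k V) (α : MultiIndex) :
    (c • f).D α = c • f.D α := by
  unfold Sobolev.D; split_ifs <;> simp

theorem Sobolev.norm_sq (f : Sobolev k V) : ‖f‖ ^ 2 = ∑ α ∈ multiIndices k, ‖f.D α‖ ^ 2 := by
  rw [Submodule.coe_norm, PiLp.norm_sq_eq_of_L2, ← Finset.sum_coe_sort (multiIndices k)]
  exact Finset.sum_congr rfl fun α _ => by rw [Sobolev.D, dif_pos α.2]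

theorem Sobolev.norm_D_le (f : Sobolev k V) (α : MultiIndex) : ‖f.D α‖ ≤ ‖f‖ := by
  by_cases h : α ∈ multiIndices k
  · refine abs_le_of_sq_le_sq' ?_ (norm_nonneg _) |>.2
    rw [Sobolev.norm_sq]
    exact Finset.single_le_sum (f := fun α => ‖f.D α‖ ^ 2) (fun _ _ => by positivity) h
  · rw [Sobolev.D, dif_neg h]; simp

/-- `f ↦ ∂^α f` as a continuous linear map into `L²`. -/
def DL (k : ℕ) (V : Type) [NormedAddCommGroup V] [InnerProductSpace ℝ V] (α : MultiIndex) :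
    Sobolev k V →L[ℝ] Lp V 2 (volume : Measure Vec) :=
  LinearMap.mkContinuous
    { toFun := fun f => f.D α
      map_add' := fun f g => f.D_add g α
      map_smul' := fun c f => f.D_smul c α } 1 (fun f => by simpa using f.norm_D_le α)

theorem Sobolev.isWeakDeriv (f : Sobolev k V) {α : MultiIndex} (h : α.order ≤ k) :
    IsWeakDeriv α (f.fn) (f.D α) := by
  have := f.2 ⟨α, mem_multiIndices.2 h⟩
  rw [f.D_of_le h, Sobolev.fn, f.D_of_le (by simp)]
  exact this

theorem Sobolev.ext_D {f g : Sobolev k V} (h : ∀ α : MultiIndex, α.order ≤ k → f.D α = g.D α) :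
    f = g := by
  apply Subtype.ext
  ext1 α
  have := h α.1 (mem_multiIndices.1 α.2)
  rwa [f.D_of_le (mem_multiIndices.1 α.2), g.D_of_le (mem_multiIndices.1 α.2)] at this

/-- An element of the Sobolev space from the family of its derivatives. -/
def Sobolev.mk (F : MultiIndex → Lp V 2 (volume : Measure Vec))
    (hF : ∀ α : MultiIndex, α.order ≤ k → IsWeakDeriv α (F 0) (F α)) : Sobolev k V :=
  ⟨WithLp.toLp 2 fun α => F α.1, fun α => hF α.1 (mem_multiIndices.1 α.2)⟩

theorem Sobolev.mk_D {F : MultiIndex → Lp V 2 (volume : Measure Vec)}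
    {hF : ∀ α : MultiIndex, α.order ≤ k → IsWeakDeriv α (F 0) (F α)} {α : MultiIndex}
    (h : α.order ≤ k) : (Sobolev.mk F hF).D α = F α := by
  rw [Sobolev.D_of_le _ h]; rfl

theorem Sobolev.incl_D {l : ℕ} (h : l ≤ k) (f : Sobolev k V) {α : MultiIndex}
    (hα : α.order ≤ l) : (f.incl h).D α = f.D α := by
  rw [Sobolev.D_of_le _ hα, Sobolev.D_of_le _ (hα.trans h)]; rfl

end General

variable {k l r : ℕ}

theorem Sobolev.ext_fn {f g : X k} (h : f.fn = g.fn) : f = g :=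
  Sobolev.ext_D fun _ hα => (f.isWeakDeriv hα).unique (h ▸ g.isWeakDeriv hα)

theorem Sobolev.isWeakDeriv_D (f : X k) {α β : MultiIndex} (h : (β + α).order ≤ k) :
    IsWeakDeriv β (f.D α) (f.D (β + α)) := by
  have h' : α.order ≤ k := by rw [order_add] at h; omega
  exact (f.isWeakDeriv h').of_comp (f.isWeakDeriv h)

theorem Sobolev.wd_D (f : X k) (i : Fin 3) {α : MultiIndex} (h : α.order + 1 ≤ k) :
    WD i (f.D α) (f.D (unitIndex i + α)) :=
  f.isWeakDeriv_D (by rw [order_add, order_unitIndex]; omega)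

/-- The function `∂^α f` as an element of `H^r`, where `f ∈ H^k` and `r + |α| ≤ k`. -/
def Sobolev.shift (f : X k) (α : MultiIndex) (h : r + α.order ≤ k) : X r :=
  Sobolev.mk (fun β => f.D (β + α)) fun β hβ => by
    rw [zero_add]; exact f.isWeakDeriv_D (by rw [order_add]; omega)

theorem Sobolev.shift_D (f : X k) {α β : MultiIndex} (h : r + α.order ≤ k) (hβ : β.order ≤ r) :
    (f.shift α h).D β = f.D (β + α) := Sobolev.mk_D hβ

theorem Sobolev.norm_shift_le (f : X k) {α : MultiIndex} (h : r + α.order ≤ k) :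
    ‖f.shift α h‖ ≤ ‖f‖ := by
  refine abs_le_of_sq_le_sq' ?_ (norm_nonneg _) |>.2
  rw [Sobolev.norm_sq, Sobolev.norm_sq]
  calc ∑ β ∈ multiIndices r, ‖(f.shift α h).D β‖ ^ 2
      = ∑ β ∈ multiIndices r, ‖f.D (β + α)‖ ^ 2 :=
        Finset.sum_congr rfl fun β hβ => by rw [f.shift_D h (mem_multiIndices.1 hβ)]
    _ = ∑ γ ∈ (multiIndices r).image (· + α), ‖f.D γ‖ ^ 2 := by
        rw [Finset.sum_image fun _ _ _ _ => add_right_cancel]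
    _ ≤ _ := Finset.sum_le_sum_of_subset_of_nonneg (by
        intro γ hγ
        obtain ⟨β, hβ, rfl⟩ := Finset.mem_image.1 hγ
        rw [mem_multiIndices] at *
        rw [order_add]; omega) fun _ _ _ => by positivity

/-- The derivative `∂^α : H^k → H^r` for `r + |α| ≤ k`. -/
def shift (α : MultiIndex) (h : r + α.order ≤ k) : X k →L[ℝ] X r :=
  LinearMap.mkContinuous
    { toFun := fun f => f.shift α h
      map_add' := fun f g => Sobolev.ext_D fun β hβ => by
        rw [Sobolev.D_add, Sobolev.shift_D _ _ hβ, Sobolev.shift_D _ _ hβ, Sobolev.shift_D _ _ hβ,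
          Sobolev.D_add]
      map_smul' := fun c f => Sobolev.ext_D fun β hβ => by
        rw [RingHom.id_apply, Sobolev.D_smul, Sobolev.shift_D _ _ hβ, Sobolev.shift_D _ _ hβ,
          Sobolev.D_smul] }
    1 (fun f => by rw [one_mul]; exact f.norm_shift_le h)

theorem shift_D {α : MultiIndex} (h : r + α.order ≤ k) (f : X k) {β : MultiIndex}
    (hβ : β.order ≤ r) : (shift α h f).D β = f.D (β + α) := f.shift_D h hβ

theorem shift_fn {α : MultiIndex} (h : r + α.order ≤ k) (f : X k) :
    (shift α h f).fn = f.D α := by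
  rw [Sobolev.fn, shift_D _ _ (by simp), zero_add]

theorem norm_shift_le {α : MultiIndex} (h : r + α.order ≤ k) (f : X k) :
    ‖shift α h f‖ ≤ ‖f‖ := f.norm_shift_le h

/-- The inclusion `H^k ⊆ H^l` as a continuous linear map. -/
def inclL (h : l ≤ k) : X k →L[ℝ] X l := shift 0 (by simpa using h)

theorem inclL_D (h : l ≤ k) (f : X k) {α : MultiIndex} (hα : α.order ≤ l) :
    (inclL h f).D α = f.D α := by
  rw [inclL, shift_D _ _ hα, add_zero]

theorem inclL_fn (h : l ≤ k) (f : X k) : (inclL h f).fn = f.fn := inclL_D h f (by simp)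

theorem inclL_eq_incl (h : l ≤ k) (f : X k) : inclL h f = f.incl h :=
  Sobolev.ext_D fun α hα => by rw [inclL_D h f hα, Sobolev.incl_D h f hα]

theorem norm_inclL_le (h : l ≤ k) (f : X k) : ‖inclL h f‖ ≤ ‖f‖ := norm_shift_le _ f

/-- The partial derivative `∂ᵢ : H^k → H^l` for `l + 1 ≤ k`. -/
def pdL (i : Fin 3) (h : l + 1 ≤ k) : X k →L[ℝ] X l := shift (unitIndex i) (by simpa using h)

theorem pdL_D (i : Fin 3) (h : l + 1 ≤ k) (f : X k) {α : MultiIndex} (hα : α.order ≤ l) :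
    (pdL i h f).D α = f.D (α + unitIndex i) := shift_D _ _ hα

theorem pdL_fn (i : Fin 3) (h : l + 1 ≤ k) (f : X k) : (pdL i h f).fn = f.D (unitIndex i) :=
  shift_fn _ _

theorem norm_pdL_le (i : Fin 3) (h : l + 1 ≤ k) (f : X k) : ‖pdL i h f‖ ≤ ‖f‖ :=
  norm_shift_le _ f

theorem WD.unique {i : Fin 3} {f g g' : L2} (h : WD i f g) (h' : WD i f g') : g = g' :=
  IsWeakDeriv.unique h h'

theorem wd_fn (i : Fin 3) (h : l + 1 ≤ k) (f : X k) : WD i f.fn (pdL i h f).fn := by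
  rw [pdL_fn]
  have := f.wd_D i (α := 0) (by simp; omega)
  rwa [add_zero] at this

theorem exists_unitIndex_add {α : MultiIndex} (h : α ≠ 0) :
    ∃ i β, α = β + unitIndex i := by
  obtain ⟨i, hi⟩ := Function.ne_iff.1 h
  refine ⟨i, fun j => if j = i then α i - 1 else α j, ?_⟩
  funext j
  simp only [unitIndex, Pi.add_apply, Pi.single_apply]
  have : α i ≠ 0 := hi
  split_ifs with hj
  · subst hj; omega
  · simp

theorem multiIndex_induction {P : MultiIndex → Prop} (h0 : P 0)
    (hs : ∀ i β, P β → P (β + unitIndex i)) (α : MultiIndex) : P α := by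
  suffices ∀ n, ∀ α : MultiIndex, α.order = n → P α from this _ α rfl
  intro n
  induction n with
  | zero =>
    intro α hα
    have : α = 0 := by
      funext i
      have := Finset.sum_eq_zero_iff.1 hα i (Finset.mem_univ i)
      simpa using this
    exact this ▸ h0
  | succ n ih =>
    intro α hα
    obtain ⟨i, β, rfl⟩ := exists_unitIndex_add (α := α) (by rintro rfl; simp at hα)
    refine hs i β (ih β ?_)
    rw [order_add, order_unitIndex] at hα
    omega

/-- A square-integrable function whose weak partial derivatives lie in `H^k` lies in `H^(k+1)`. -/
theorem exists_of_wd {f : L2} {G : Fin 3 → X k} (hG : ∀ i, WD i f (G i).fn) :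
    ∃ F : X (k + 1), F.fn = f ∧ (∀ i, pdL i le_rfl F = G i) ∧
      ‖F‖ ≤ ‖f‖ + ∑ i, ‖G i‖ := by
  -- A multi-index can be written as `β + unitIndex i` in several ways; uniqueness of weak
  -- derivatives makes `(G i).D β` independent of the choice.
  have step : ∀ α : MultiIndex, α.order ≤ k + 1 → ∃ g : L2, IsWeakDeriv α f g ∧
      ∀ i β, α = β + unitIndex i → g = (G i).D β := by
    intro α hα
    have aux : ∀ i β, α = β + unitIndex i → IsWeakDeriv α f ((G i).D β) := by
      rintro i β rfl
      refine IsWeakDeriv.comp (hG i) ((G i).isWeakDeriv ?_)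
      rw [order_add, order_unitIndex] at hα
      omega
    by_cases h0 : α = 0
    · refine ⟨f, h0 ▸ isWeakDeriv_zero f, fun i β h => ?_⟩
      have := congrArg MultiIndex.order h
      rw [h0, order_add, order_unitIndex, order_zero] at this
      omega
    · obtain ⟨i, β, h⟩ := exists_unitIndex_add h0
      exact ⟨(G i).D β, aux i β h, fun j γ h' => (aux i β h).unique (aux j γ h')⟩
  choose! F hF hF' using step
  have hF0 : F 0 = f := (hF 0 (by simp)).unique (isWeakDeriv_zero f)
  refine ⟨Sobolev.mk F (fun α hα => hF0.symm ▸ hF α hα), ?_, ?_, ?_⟩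
  · rw [Sobolev.fn, Sobolev.mk_D (by simp), hF0]
  · intro i
    refine Sobolev.ext_D fun α hα => ?_
    rw [pdL_D _ _ _ hα, Sobolev.mk_D (by rw [order_add, order_unitIndex]; omega)]
    exact hF' _ (by rw [order_add, order_unitIndex]; omega) i α rfl
  · set S := Sobolev.mk F (fun α hα => hF0.symm ▸ hF α hα) with hS
    have h1 : ‖S‖ ^ 2 ≤ ‖f‖ ^ 2 + ∑ i, ‖G i‖ ^ 2 := by
      have hsub : multiIndices (k + 1) ⊆ insert 0 ((Finset.univ ×ˢ multiIndices k).image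
          fun p : Fin 3 × MultiIndex => p.2 + unitIndex p.1) := by
        intro α hα
        by_cases h0 : α = 0
        · simp [h0]
        · obtain ⟨i, β, rfl⟩ := exists_unitIndex_add h0
          rw [mem_multiIndices, order_add, order_unitIndex] at hα
          exact Finset.mem_insert_of_mem (Finset.mem_image.2 ⟨(i, β), Finset.mem_product.2
            ⟨Finset.mem_univ _, mem_multiIndices.2 (by simpa using hα)⟩, rfl⟩)
      rw [Sobolev.norm_sq]
      refine (Finset.sum_le_sum_of_subset_of_nonneg hsub fun _ _ _ => by positivity).trans ?_
      rw [Finset.sum_insert (by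
        simp only [Finset.mem_image, not_exists, not_and]
        intro p _ h
        have := congrArg MultiIndex.order h
        rw [order_add, order_unitIndex, order_zero] at this
        omega)]
      refine add_le_add (by rw [hS, Sobolev.mk_D (by simp), hF0]) ?_
      refine (Finset.sum_image_le_of_nonneg fun _ _ => by positivity).trans ?_
      rw [Finset.sum_product]
      refine Finset.sum_le_sum fun i _ => ?_
      rw [Sobolev.norm_sq]
      refine Finset.sum_le_sum fun β hβ => ?_
      rw [mem_multiIndices] at hβ
      dsimp only
      rw [hS, Sobolev.mk_D (by rw [order_add, order_unitIndex]; omega),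
        hF' _ (by rw [order_add, order_unitIndex]; omega) i β rfl]
    refine abs_le_of_sq_le_sq' (h1.trans ?_) (by positivity) |>.2
    have h2 : ∑ i, ‖G i‖ ^ 2 ≤ (∑ i, ‖G i‖) ^ 2 :=
      Finset.sum_sq_le_sq_sum_of_nonneg fun _ _ => norm_nonneg _
    have h3 : 0 ≤ ∑ i, ‖G i‖ := by positivity
    nlinarith [norm_nonneg f]

/-! ### Translations and directional averages -/

/-- The translation `f ↦ f(· + v)` of `L²`. -/
def trans (v : Vec) : L2 →ₗᵢ[ℝ] L2 :=
  Lp.compMeasurePreservingₗᵢ ℝ (· + v) (measurePreserving_add_right volume v)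

theorem coeFn_trans (v : Vec) (f : L2) : trans v f =ᵐ[volume] fun x => f (x + v) :=
  Lp.coeFn_compMeasurePreserving f (measurePreserving_add_right volume v)

theorem norm_trans (v : Vec) (f : L2) : ‖trans v f‖ = ‖f‖ := (trans v).norm_map f

/-- Translations are continuous in the shift only strongly, not in operator norm. Joint continuity
in shift and function is the form used in all later limits `h → 0`. -/
theorem continuous_trans : Continuous fun p : Vec × L2 => trans p.1 p.2 := by
  have h : Continuous fun p : Vec × L2 => ContinuousMap.curry
      (⟨fun q : (Vec × L2) × Vec => q.2 + q.1.1, by fun_prop⟩ : C((Vec × L2) × Vec, Vec)) p :=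
    ContinuousMap.continuous _
  exact continuous_snd.compMeasurePreservingLp h
    (fun p => measurePreserving_add_right volume p.1) (by norm_num)

theorem ae_add_right {p : Vec → Prop} (v : Vec) (h : ∀ᵐ x : Vec, p x) : ∀ᵐ x : Vec, p (x + v) :=
  (measurePreserving_add_right volume v).quasiMeasurePreserving.ae h

@[simp] theorem trans_zero (f : L2) : trans 0 f = f := by
  apply Lp.ext
  filter_upwards [coeFn_trans 0 f] with x hx
  rw [hx, add_zero]

theorem trans_trans (v w : Vec) (f : L2) : trans v (trans w f) = trans (v + w) f := by
  apply Lp.ext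
  filter_upwards [coeFn_trans v (trans w f), coeFn_trans (v + w) f,
    ae_add_right v (coeFn_trans w f)] with x h1 h2 h3
  rw [h1, h2, h3, add_assoc]

theorem inner_trans (v : Vec) (f g : L2) : ⟪trans v f, g⟫_ℝ = ⟪f, trans (-v) g⟫_ℝ := by
  rw [← (trans v).inner_map_map f, trans_trans, add_neg_cancel, trans_zero]

theorem IsTest.comp_add {φ : Vec → ℝ} (h : IsTest φ) (v : Vec) : IsTest fun x => φ (x + v) :=
  ⟨h.1.comp (contDiff_id.add contDiff_const), h.2.comp_homeomorph (Homeomorph.addRight v)⟩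

theorem IsTest.trans_toL2 {φ : Vec → ℝ} (h : IsTest φ) (v : Vec) :
    trans v h.toL2 = (h.comp_add v).toL2 := by
  apply Lp.ext
  filter_upwards [coeFn_trans v h.toL2, (h.comp_add v).coeFn_toL2,
    ae_add_right v h.coeFn_toL2] with x h1 h2 h3
  rw [h1, h2, h3]

theorem iterPartial_comp_add (α : MultiIndex) (φ : Vec → ℝ) (v : Vec) :
    iterPartial α (fun x => φ (x + v)) = fun x => iterPartial α φ (x + v) := by
  have key : ∀ i, Function.Semiconj (fun ψ : Vec → ℝ => fun x => ψ (x + v))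
      (partialDeriv i) (partialDeriv i) := by
    intro i ψ
    funext x
    simp only [partialDeriv]
    rw [fderiv_comp_add_right]
  have h := fun i n => ((key i).iterate_right n)
  simp only [iterPartial]
  rw [((h 2 _) φ).symm, ((h 1 _) _).symm, ((h 0 _) _).symm]

theorem IsWeakDeriv.trans {α : MultiIndex} {f g : L2} (h : IsWeakDeriv α f g) (v : Vec) :
    IsWeakDeriv α (trans v f) (EulerMaxwell.trans v g) := by
  rw [isWeakDeriv_iff] at *
  intro φ hφ
  have h1 := h _ (hφ.comp_add (-v))
  rw [IsTest.toL2_congr ((hφ.comp_add (-v)).iterPartial α) ((hφ.iterPartial α).comp_add (-v))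
    (iterPartial_comp_add α φ (-v)), ← IsTest.trans_toL2, ← IsTest.trans_toL2, inner_trans,
    inner_trans, neg_neg] at h1
  exact h1

/-- The unit vector in the direction of `xᵢ`. -/
def unitVec (i : Fin 3) : Vec := EuclideanSpace.single i 1

theorem _root_.Continuous.trans_L2 {Z : Type*} [TopologicalSpace Z] {v : Z → Vec} {f : Z → L2}
    (hv : Continuous v) (hf : Continuous f) : Continuous fun z => trans (v z) (f z) :=
  Continuous.comp (g := fun p : Vec × L2 => trans p.1 p.2) continuous_trans (hv.prodMk hf)

theorem continuous_trans_smul_const (i : Fin 3) (h : ℝ) (g : L2) :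
    Continuous fun θ : ℝ => trans ((θ * h) • unitVec i) g :=
  Continuous.trans_L2 (by fun_prop) continuous_const

/-- The average of `f` over segments of length `h` in the direction `xᵢ`. -/
def avg (i : Fin 3) (h : ℝ) : L2 →L[ℝ] L2 :=
  LinearMap.mkContinuous
    { toFun := fun g => ∫ θ in (0 : ℝ)..1, trans ((θ * h) • unitVec i) g
      map_add' := fun f g => by
        simp only [map_add]
        exact intervalIntegral.integral_add
          ((continuous_trans_smul_const i h f).intervalIntegrable _ _)
          ((continuous_trans_smul_const i h g).intervalIntegrable _ _)
      map_smul' := fun c g => by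
        simp only [map_smul, RingHom.id_apply]
        exact intervalIntegral.integral_smul _ _ } 1
    (fun g => by
      have := intervalIntegral.norm_integral_le_of_norm_le_const (a := (0 : ℝ)) (b := 1)
        (f := fun θ : ℝ => trans ((θ * h) • unitVec i) g) (C := ‖g‖)
        (fun θ _ => (norm_trans _ g).le)
      simpa using this)

theorem norm_avg_le (i : Fin 3) (h : ℝ) : ‖avg i h‖ ≤ 1 :=
  LinearMap.mkContinuous_norm_le _ zero_le_one _

theorem avg_apply (i : Fin 3) (h : ℝ) (g : L2) :
    avg i h g = ∫ θ in (0 : ℝ)..1, trans ((θ * h) • unitVec i) g := rfl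

theorem norm_avg_apply_le (i : Fin 3) (h : ℝ) (g : L2) : ‖avg i h g‖ ≤ ‖g‖ := by
  simpa using (avg i h).le_of_opNorm_le (norm_avg_le i h) g

@[simp] theorem avg_zero (i : Fin 3) (g : L2) : avg i 0 g = g := by
  simp [avg_apply]

attribute [irreducible] trans avg

theorem continuous_avg (i : Fin 3) : Continuous fun p : ℝ × L2 => avg i p.1 p.2 := by
  simp only [avg_apply]
  refine intervalIntegral.continuous_parametric_intervalIntegral_of_continuous' ?_ 0 1
  exact Continuous.trans_L2 (by fun_prop) (by fun_prop)

theorem inner_avg_right (i : Fin 3) (h : ℝ) (f g : L2) :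
    ⟪f, avg i h g⟫_ℝ = ∫ θ in (0 : ℝ)..1, ⟪f, trans ((θ * h) • unitVec i) g⟫_ℝ := by
  have := (innerSL ℝ f).intervalIntegral_comp_comm
    ((continuous_trans_smul_const i h g).intervalIntegrable (μ := volume) 0 1)
  simpa [avg_apply] using this.symm

theorem IsWeakDeriv.avg {α : MultiIndex} {f g : L2} (H : IsWeakDeriv α f g) (i : Fin 3) (h : ℝ) :
    IsWeakDeriv α (avg i h f) (EulerMaxwell.avg i h g) := by
  rw [isWeakDeriv_iff]
  intro φ hφ
  rw [inner_avg_right, inner_avg_right, ← intervalIntegral.integral_const_mul]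
  refine intervalIntegral.integral_congr fun θ _ => ?_
  exact isWeakDeriv_iff.1 (H.trans _) φ hφ

/-! ### Weak derivatives and difference quotients. -/

open scoped Convolution in
theorem IsTest.inner_trans_eq_convolution {φ : Vec → ℝ} (h : IsTest φ) (f : L2) (y : Vec) :
    ⟪h.toL2, trans y f⟫_ℝ
      = (f ⋆[ContinuousLinearMap.mul ℝ ℝ, volume] fun x => φ (-x)) y := by
  rw [← neg_neg y, ← inner_trans, neg_neg, h.trans_toL2, IsTest.inner_toL2, convolution]
  refine integral_congr_ae (.of_forall fun x => ?_)
  simp [mul_comm, sub_eq_add_neg]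

/-- The pairing is the convolution of `f` with the reflected test function, evaluated at the shift.
It is classically differentiable, and the derivative falling on the test function returns to `f` as
its weak derivative. -/
theorem IsTest.hasDerivAt_inner_trans {φ : Vec → ℝ} (h : IsTest φ) {f g : L2} {i : Fin 3}
    (hfg : WD i f g) (r : ℝ) :
    HasDerivAt (fun r : ℝ => ⟪h.toL2, EulerMaxwell.trans (r • unitVec i) f⟫_ℝ)
      ⟪h.toL2, EulerMaxwell.trans (r • unitVec i) g⟫_ℝ r := by
  have hneg : IsTest fun x => φ (-x) :=
    ⟨h.1.comp contDiff_neg, h.2.comp_homeomorph (Homeomorph.neg Vec)⟩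
  have hli : LocallyIntegrable f (volume : Measure Vec) :=
    (Lp.memLp f).locallyIntegrable (by norm_num)
  have h1 := hneg.2.hasFDerivAt_convolution_right (ContinuousLinearMap.mul ℝ ℝ) hli
    (hneg.1.of_le (by norm_cast)) (r • unitVec i)
  have h2 : HasDerivAt (fun r : ℝ => r • unitVec i) (unitVec i) r := by
    simpa using (hasDerivAt_id r).smul_const (unitVec i)
  have h3 := h1.comp_hasDerivAt r h2
  simp only [h.inner_trans_eq_convolution f]
  convert! h3 using 1
  rw [convolution_precompR_apply _ hli (hneg.2.fderiv ℝ)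
    (hneg.1.continuous_fderiv (by simp))]
  have h4 := (WD_iff.1 (hfg.trans (r • unitVec i))) φ h
  have h5 : ∀ x, fderiv ℝ (fun x => φ (-x)) x (unitVec i) = - EulerMaxwell.partialDeriv i φ (-x) := by
    intro x
    have := (h.1.differentiable (by simp) (-x)).hasFDerivAt.comp x (hasFDerivAt_id x).neg
    rw [show (fun x => φ (-x)) = φ ∘ (-fun x => x) from rfl]
    erw [this.fderiv]
    simp [EulerMaxwell.partialDeriv, unitVec]
  simp only [h5]
  rw [← neg_eq_iff_eq_neg.2 h4, (h.partialDeriv i).inner_trans_eq_convolution]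
  simp only [convolution, ContinuousLinearMap.mul_apply', mul_neg, integral_neg]

/-- The fundamental theorem of calculus along segments, tested against smooth functions. The right
side is bounded by `‖g‖` uniformly in `h` and makes sense at `h = 0`, unlike the left side. -/
theorem WD.avg_eq {i : Fin 3} {f g : L2} (H : WD i f g) {h : ℝ} (hh : h ≠ 0) :
    h⁻¹ • (EulerMaxwell.trans (h • unitVec i) f - f) = avg i h g := by
  refine L2.eq_of_inner_test fun φ hφ => ?_
  have hd : ∀ θ : ℝ, HasDerivAt
      (fun θ : ℝ => ⟪hφ.toL2, EulerMaxwell.trans ((θ * h) • unitVec i) f⟫_ℝ)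
      (⟪hφ.toL2, EulerMaxwell.trans ((θ * h) • unitVec i) g⟫_ℝ * h) θ := fun θ =>
    HasDerivAt.comp (h₂ := fun r : ℝ => ⟪hφ.toL2, EulerMaxwell.trans (r • unitVec i) f⟫_ℝ) θ
      (hφ.hasDerivAt_inner_trans H (θ * h)) (hasDerivAt_mul_const h)
  have hc : Continuous fun θ : ℝ => ⟪hφ.toL2, EulerMaxwell.trans ((θ * h) • unitVec i) g⟫_ℝ :=
    continuous_const.inner (continuous_trans_smul_const i h g)
  have := intervalIntegral.integral_eq_sub_of_hasDerivAt (a := (0 : ℝ)) (b := 1)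
    (fun θ _ => hd θ) ((hc.mul continuous_const).intervalIntegrable _ _)
  rw [intervalIntegral.integral_mul_const, ← inner_avg_right] at this
  simp only [one_mul, zero_mul, zero_smul, trans_zero] at this
  rw [inner_smul_right, inner_sub_right, ← this]
  field_simp

/-- The difference quotient in the direction `xᵢ`. -/
def dq (i : Fin 3) (h : ℝ) (f : L2) : L2 := h⁻¹ • (trans (h • unitVec i) f - f)

theorem WD.dq_eq {i : Fin 3} {f g : L2} (H : WD i f g) {h : ℝ} (hh : h ≠ 0) :
    dq i h f = avg i h g := H.avg_eq hh

theorem inner_dq (i : Fin 3) (h : ℝ) (f g : L2) :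
    ⟪dq i h f, g⟫_ℝ = - ⟪f, dq i (-h) g⟫_ℝ := by
  have e : dq i (-h) g = -(h⁻¹ • (trans (-(h • unitVec i)) g - g)) := by
    rw [dq, neg_smul, inv_neg, neg_smul]
  rw [e, inner_neg_right, neg_neg, dq, real_inner_smul_left, inner_sub_left, inner_trans]
  erw [real_inner_smul_right]
  rw [inner_sub_right]

/-- A function that is differentiable in the classical sense, with square-integrable derivative,
has this derivative as weak derivative. -/
theorem wd_of_contDiff {i : Fin 3} {f : Vec → ℝ} (hf : ContDiff ℝ 1 f) (h : MemLp f 2 volume)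
    (h' : MemLp (partialDeriv i f) 2 volume) : WD i (h.toLp f) (h'.toLp _) := by
  rw [WD_iff]
  intro φ hφ
  rw [inner_L2, inner_L2]
  have e1 : ∀ a b : L2, ∀ p q : Vec → ℝ, a =ᵐ[volume] p → b =ᵐ[volume] q →
      ∫ x, a x * b x = ∫ x, p x * q x := fun a b p q ha hb => integral_congr_ae (by
    filter_upwards [ha, hb] with x h1 h2
    rw [h1, h2])
  rw [e1 _ _ _ _ (hφ.partialDeriv i).coeFn_toL2 h.coeFn_toLp,
    e1 _ _ _ _ hφ.coeFn_toL2 h'.coeFn_toLp]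
  have m1 : MemLp φ 2 (volume : Measure Vec) := hφ.1.continuous.memLp_of_hasCompactSupport hφ.2
  have m2 : MemLp (partialDeriv i φ) 2 (volume : Measure Vec) :=
    (hφ.partialDeriv i).1.continuous.memLp_of_hasCompactSupport (hφ.partialDeriv i).2
  have := integral_mul_fderiv_eq_neg_fderiv_mul_of_integrable (μ := (volume : Measure Vec))
    (f := f) (g := φ) (v := EuclideanSpace.single i 1) (h'.integrable_mul m1)
    (h.integrable_mul m2) (h.integrable_mul m1) (fun x _ => hf.differentiable one_ne_zero x)
    (fun x _ => hφ.1.differentiable (by simp) x)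
  rw [← integral_neg]
  simp only [mul_comm (partialDeriv i φ _), mul_comm (φ _)]
  rw [integral_neg]
  exact this

theorem IsTest.wd {φ : Vec → ℝ} (h : IsTest φ) (i : Fin 3) :
    WD i h.toL2 (h.partialDeriv i).toL2 :=
  wd_of_contDiff (h.1.of_le (by norm_cast)) _ _

theorem _root_.Continuous.avg_L2 {Z : Type*} [TopologicalSpace Z] {h : Z → ℝ} {f : Z → L2}
    (i : Fin 3) (hh : Continuous h) (hf : Continuous f) : Continuous fun z => avg i (h z) (f z) :=
  Continuous.comp (g := fun p : ℝ × L2 => avg i p.1 p.2) (continuous_avg i) (hh.prodMk hf)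

theorem continuous_avg_const (i : Fin 3) (g : L2) : Continuous fun h : ℝ => avg i h g :=
  Continuous.avg_L2 i continuous_id continuous_const

theorem WD.tendsto_dq {i : Fin 3} {f g : L2} (H : WD i f g) :
    Tendsto (fun h => dq i h f) (𝓝[≠] 0) (𝓝 g) := by
  have h1 : Tendsto (fun h => avg i h g) (𝓝[≠] 0) (𝓝 g) := by
    have := (continuous_avg_const i g).tendsto 0
    rw [avg_zero] at this
    exact this.mono_left nhdsWithin_le_nhds
  refine h1.congr' ?_
  filter_upwards [self_mem_nhdsWithin] with h hh
  rw [H.dq_eq hh]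

theorem tendsto_neg_nhdsNE_zero : Tendsto (fun h : ℝ => -h) (𝓝[≠] 0) (𝓝[≠] 0) := by
  refine tendsto_nhdsWithin_iff.2 ⟨?_, ?_⟩
  · have : Tendsto (fun h : ℝ => -h) (𝓝 0) (𝓝 (-0)) := continuous_neg.tendsto 0
    rw [neg_zero] at this
    exact this.mono_left nhdsWithin_le_nhds
  · filter_upwards [self_mem_nhdsWithin] with h hh
    simpa using hh

/-- The adjoint of the difference quotient of step `h` is minus that of step `-h`, and difference
quotients of a test function converge in `L²`; so the limit can be read off on the test function. -/
theorem WD.of_tendsto_dq {i : Fin 3} {f g : L2}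
    (H : Tendsto (fun h => dq i h f) (𝓝[≠] 0) (𝓝 g)) : WD i f g := by
  rw [WD_iff]
  intro φ hφ
  have h1 : Tendsto (fun h => ⟪dq i (-h) hφ.toL2, f⟫_ℝ) (𝓝[≠] 0)
      (𝓝 ⟪(hφ.partialDeriv i).toL2, f⟫_ℝ) :=
    (((hφ.wd i).tendsto_dq).comp tendsto_neg_nhdsNE_zero).inner tendsto_const_nhds
  have h2 : Tendsto (fun h => - ⟪hφ.toL2, dq i h f⟫_ℝ) (𝓝[≠] 0) (𝓝 (- ⟪hφ.toL2, g⟫_ℝ)) :=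
    (tendsto_const_nhds.inner H).neg
  refine tendsto_nhds_unique h1 (h2.congr fun h => ?_)
  rw [inner_dq, neg_neg]

/-- Integration by parts in `H¹`. -/
theorem WD.inner_left {i : Fin 3} {f f' g g' : L2} (hf : WD i f f') (hg : WD i g g') :
    ⟪f', g⟫_ℝ = - ⟪f, g'⟫_ℝ := by
  have h1 : Tendsto (fun h => ⟪dq i h f, g⟫_ℝ) (𝓝[≠] 0) (𝓝 ⟪f', g⟫_ℝ) :=
    hf.tendsto_dq.inner tendsto_const_nhds
  have h2 : Tendsto (fun h => - ⟪f, dq i (-h) g⟫_ℝ) (𝓝[≠] 0) (𝓝 (- ⟪f, g'⟫_ℝ)) :=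
    (tendsto_const_nhds.inner (hg.tendsto_dq.comp tendsto_neg_nhdsNE_zero)).neg
  exact tendsto_nhds_unique h1 (h2.congr fun h => (inner_dq i h f g).symm)

/-! ### Translations and averages on the Sobolev spaces -/

variable {k l r : ℕ}

theorem continuous_X_iff {Z : Type*} [TopologicalSpace Z] {f : Z → X k} :
    Continuous f ↔ ∀ α : MultiIndex, α.order ≤ k → Continuous fun z => (f z).D α := by
  constructor
  · intro h α _
    exact (DL k ℝ α).continuous.comp h
  · intro h
    refine Continuous.subtype_mk ((PiLp.continuous_toLp 2 _).comp (continuous_pi fun α => ?_)) _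
    have := h α.1 (mem_multiIndices.1 α.2)
    simpa only [Sobolev.D_of_le _ (mem_multiIndices.1 α.2)] using this

/-- The function on `H^k` induced by an operator on `L²` that commutes with weak derivatives. -/
def Sobolev.map (A : L2 →L[ℝ] L2)
    (hA : ∀ {α} {f g : L2}, IsWeakDeriv α f g → IsWeakDeriv α (A f) (A g)) (f : X k) : X k :=
  Sobolev.mk (fun α => A (f.D α)) fun _ hα => hA (f.isWeakDeriv hα)

theorem Sobolev.map_D {A : L2 →L[ℝ] L2}
    (hA : ∀ {α} {f g : L2}, IsWeakDeriv α f g → IsWeakDeriv α (A f) (A g)) (f : X k)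
    {α : MultiIndex} (hα : α.order ≤ k) : (f.map A hA).D α = A (f.D α) := Sobolev.mk_D hα

theorem Sobolev.norm_map_le {A : L2 →L[ℝ] L2}
    (hA : ∀ {α} {f g : L2}, IsWeakDeriv α f g → IsWeakDeriv α (A f) (A g))
    (hn : ∀ f, ‖A f‖ ≤ ‖f‖) (f : X k) : ‖f.map A hA‖ ≤ ‖f‖ := by
  refine abs_le_of_sq_le_sq' ?_ (norm_nonneg _) |>.2
  rw [Sobolev.norm_sq, Sobolev.norm_sq]
  refine Finset.sum_le_sum fun β hβ => ?_
  rw [Sobolev.map_D _ _ (mem_multiIndices.1 hβ)]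
  exact pow_le_pow_left₀ (norm_nonneg _) (hn _) 2

/-- The operator induced on `H^k` by a contraction of `L²` that commutes with weak derivatives. -/
def mapX (A : L2 →L[ℝ] L2)
    (hA : ∀ {α} {f g : L2}, IsWeakDeriv α f g → IsWeakDeriv α (A f) (A g))
    (hn : ∀ f, ‖A f‖ ≤ ‖f‖) : X k →L[ℝ] X k :=
  LinearMap.mkContinuous
    { toFun := fun f => f.map A hA
      map_add' := fun f g => Sobolev.ext_D fun β hβ => by
        rw [Sobolev.D_add, Sobolev.map_D _ _ hβ, Sobolev.map_D _ _ hβ, Sobolev.map_D _ _ hβ,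
          Sobolev.D_add, map_add]
      map_smul' := fun c f => Sobolev.ext_D fun β hβ => by
        rw [RingHom.id_apply, Sobolev.D_smul, Sobolev.map_D _ _ hβ, Sobolev.map_D _ _ hβ,
          Sobolev.D_smul, map_smul] }
    1 (fun f => by rw [one_mul]; exact f.norm_map_le hA hn)

theorem mapX_D {A : L2 →L[ℝ] L2}
    {hA : ∀ {α} {f g : L2}, IsWeakDeriv α f g → IsWeakDeriv α (A f) (A g)}
    {hn : ∀ f, ‖A f‖ ≤ ‖f‖} (f : X k) {α : MultiIndex} (hα : α.order ≤ k) :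
    (mapX A hA hn f).D α = A (f.D α) := Sobolev.map_D hA f hα

theorem norm_mapX_le {A : L2 →L[ℝ] L2}
    {hA : ∀ {α} {f g : L2}, IsWeakDeriv α f g → IsWeakDeriv α (A f) (A g)}
    {hn : ∀ f, ‖A f‖ ≤ ‖f‖} (f : X k) : ‖mapX A hA hn f‖ ≤ ‖f‖ := f.norm_map_le hA hn

/-- Translation on `H^k`. -/
def transX (v : Vec) : X k →L[ℝ] X k :=
  mapX (trans v).toContinuousLinearMap (fun h => h.trans v) fun f => (norm_trans v f).le

/-- Averaging on `H^k`. -/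
def avgX (i : Fin 3) (h : ℝ) : X k →L[ℝ] X k :=
  mapX (avg i h) (fun H => H.avg i h) fun f => norm_avg_apply_le i h f

theorem transX_D (v : Vec) (f : X k) {α : MultiIndex} (hα : α.order ≤ k) :
    (transX v f).D α = trans v (f.D α) := mapX_D f hα

theorem avgX_D (i : Fin 3) (h : ℝ) (f : X k) {α : MultiIndex} (hα : α.order ≤ k) :
    (avgX i h f).D α = avg i h (f.D α) := mapX_D f hα

theorem norm_avgX_le (i : Fin 3) (h : ℝ) (f : X k) : ‖avgX i h f‖ ≤ ‖f‖ := norm_mapX_le f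

theorem continuous_transX : Continuous fun p : Vec × X k => transX p.1 p.2 := by
  refine continuous_X_iff.2 fun α hα => ?_
  simp only [transX_D _ _ hα]
  exact Continuous.trans_L2 continuous_fst ((DL k ℝ α).continuous.comp continuous_snd)

theorem continuous_avgX (i : Fin 3) : Continuous fun p : ℝ × X k => avgX i p.1 p.2 := by
  refine continuous_X_iff.2 fun α hα => ?_
  simp only [avgX_D _ _ _ hα]
  exact Continuous.avg_L2 i continuous_fst ((DL k ℝ α).continuous.comp continuous_snd)

@[simp] theorem avgX_zero (i : Fin 3) (f : X k) : avgX i 0 f = f :=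
  Sobolev.ext_D fun α hα => by rw [avgX_D _ _ _ hα, avg_zero]

@[simp] theorem transX_zero (f : X k) : transX 0 f = f :=
  Sobolev.ext_D fun α hα => by rw [transX_D _ _ hα, trans_zero]

/-! ### The Sobolev embedding `H² ⊆ L^∞` -/

section Embedding
open SchwartzMap FourierTransform LineDeriv Laplacian
open scoped SchwartzMap

/-- The symbol `(1 + |ξ|²)⁻¹` of the Bessel potential of order two. -/
def besselSymbol (ξ : Vec) : ℝ := (1 + ‖ξ‖ ^ 2) ^ (-1 : ℝ)

theorem besselSymbol_hasTemperateGrowth : besselSymbol.HasTemperateGrowth := by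
  unfold besselSymbol
  fun_prop

/-- The square decays like `|ξ|⁻⁴`, and the dimension is `3 < 4`. -/
theorem besselSymbol_sq_integrable : Integrable (fun ξ => besselSymbol ξ ^ 2) := by
  have h : (Module.finrank ℝ Vec : ℝ) < 4 := by simp; norm_num
  refine (integrable_rpow_neg_one_add_norm_sq (μ := volume) h).congr (.of_forall fun ξ => ?_)
  simp only [besselSymbol]
  rw [← Real.rpow_mul_natCast (by positivity)]
  norm_num

/-- The solution `ψ` of `ψ - (2π)⁻² Δψ = Φ`. -/
def bessel (Φ : 𝓢(Vec, ℂ)) : 𝓢(Vec, ℂ) := fourierMultiplierCLM ℂ besselSymbol Φ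

theorem bessel_eq (Φ : 𝓢(Vec, ℂ)) :
    bessel Φ - ((2 * Real.pi) ^ 2)⁻¹ • ∑ i : Fin 3, ∂_{unitVec i} (∂_{unitVec i} (bessel Φ))
      = Φ := by
  have h1 : Δ (bessel Φ) = ∑ i : Fin 3, ∂_{unitVec i} (∂_{unitVec i} (bessel Φ)) := by
    rw [laplacian_eq_sum (EuclideanSpace.basisFun (Fin 3) ℝ)]
    simp [unitVec]
  have hn : (fun ξ : Vec => ‖ξ‖ ^ 2).HasTemperateGrowth := by fun_prop
  have h2 : fourierMultiplierCLM ℂ (fun ξ : Vec => ‖ξ‖ ^ 2) (bessel Φ)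
      = fourierMultiplierCLM ℂ ((fun ξ : Vec => ‖ξ‖ ^ 2) * besselSymbol) Φ :=
    fourierMultiplierCLM_fourierMultiplierCLM_apply hn besselSymbol_hasTemperateGrowth Φ
  rw [← h1, laplacian_eq_fourierMultiplierCLM, neg_smul, smul_neg, sub_neg_eq_add, smul_smul,
    inv_mul_cancel₀ (by positivity), one_smul]
  have h3 : (‖·‖ ^ 2 : Vec → ℝ) = fun ξ : Vec => ‖ξ‖ ^ 2 := rfl
  rw [h3, h2, bessel, fourierMultiplierCLM_apply, fourierMultiplierCLM_apply,
    ← FourierTransform.fourierInv_add]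
  have h4 : smulLeftCLM ℂ besselSymbol (𝓕 Φ)
      + smulLeftCLM ℂ ((fun ξ : Vec => ‖ξ‖ ^ 2) * besselSymbol) (𝓕 Φ) = 𝓕 Φ := by
    ext ξ
    rw [_root_.add_apply, smulLeftCLM_apply_apply besselSymbol_hasTemperateGrowth,
      smulLeftCLM_apply_apply (hn.mul besselSymbol_hasTemperateGrowth), ← add_smul]
    have : besselSymbol ξ + ((fun ξ : Vec => ‖ξ‖ ^ 2) * besselSymbol) ξ = 1 := by
      simp only [Pi.mul_apply, besselSymbol, Real.rpow_neg_one]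
      field_simp
    rw [this, one_smul]
  rw [h4, FourierTransform.fourierInv_fourier_eq]

/-- Plancherel, together with the bound of the Fourier transform of `Φ` by the `L¹` norm of `Φ`;
what remains is the `L²` norm of the symbol. -/
theorem integral_norm_bessel_sq_le (Φ : 𝓢(Vec, ℂ)) :
    ∫ x, ‖bessel Φ x‖ ^ 2 ≤ (∫ ξ, besselSymbol ξ ^ 2) * (∫ x, ‖Φ x‖) ^ 2 := by
  rw [← integral_norm_sq_fourier, ← integral_mul_const]
  have h1 : 𝓕 (bessel Φ) = smulLeftCLM ℂ besselSymbol (𝓕 Φ) := by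
    rw [bessel, fourierMultiplierCLM_apply, FourierTransform.fourier_fourierInv_eq]
  have h2 : ∀ ξ, ‖𝓕 (bessel Φ) ξ‖ ^ 2 ≤ besselSymbol ξ ^ 2 * (∫ x, ‖Φ x‖) ^ 2 := by
    intro ξ
    rw [h1, smulLeftCLM_apply_apply besselSymbol_hasTemperateGrowth, norm_smul, mul_pow,
      Real.norm_eq_abs, sq_abs]
    have := norm_fourier_apply_le_toLp_one Φ ξ
    rw [norm_toLp_one] at this
    gcongr
  have hi : Integrable fun ξ => besselSymbol ξ ^ 2 * (∫ x, ‖Φ x‖) ^ 2 :=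
    besselSymbol_sq_integrable.mul_const _
  exact integral_mono_of_nonneg (.of_forall fun _ => by positivity) hi (.of_forall h2)

theorem lineDeriv_postcomp_re (Ψ : 𝓢(Vec, ℂ)) (v : Vec) :
    ∂_{v} (Ψ.postcompCLM Complex.reCLM) = (∂_{v} Ψ).postcompCLM Complex.reCLM := by
  ext x
  rw [lineDerivOp_apply_eq_fderiv, postcompCLM_apply, lineDerivOp_apply_eq_fderiv]
  have := Complex.reCLM.hasFDerivAt.comp x (Ψ.differentiableAt (x := x)).hasFDerivAt
  have e : ⇑(Ψ.postcompCLM Complex.reCLM) = Complex.reCLM ∘ Ψ := by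
    ext y; simp [postcompCLM_apply]
  rw [e, this.fderiv]
  rfl

/-- A Schwartz function as an element of `L²`. -/
def schwartzL2 : 𝓢(Vec, ℝ) →L[ℝ] L2 := toLpCLM ℝ ℝ 2 (volume : Measure Vec)

theorem coeFn_schwartzL2 (η : 𝓢(Vec, ℝ)) : schwartzL2 η =ᵐ[volume] η :=
  η.coeFn_toLp 2 volume

theorem wd_schwartz (η : 𝓢(Vec, ℝ)) (i : Fin 3) :
    WD i (schwartzL2 η) (schwartzL2 (∂_{unitVec i} η : 𝓢(Vec, ℝ))) := by
  have e : ∀ x, partialDeriv i η x = (∂_{unitVec i} η : 𝓢(Vec, ℝ)) x := fun x => by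
    rw [lineDerivOp_apply_eq_fderiv]; rfl
  have m : MemLp (partialDeriv i η) 2 volume :=
    ((∂_{unitVec i} η : 𝓢(Vec, ℝ)).memLp 2 volume).ae_eq (.of_forall fun x => (e x).symm)
  have h := wd_of_contDiff (i := i) (η.smooth 1) (η.memLp 2) m
  have e2 : m.toLp _ = schwartzL2 (∂_{unitVec i} η : 𝓢(Vec, ℝ)) :=
    MemLp.toLp_congr _ ((∂_{unitVec i} η : 𝓢(Vec, ℝ)).memLp 2 volume) (.of_forall e)
  rw [e2] at h
  exact h

theorem norm_schwartzL2_re_bessel_le (Φ : 𝓢(Vec, ℂ)) :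
    ‖schwartzL2 ((bessel Φ).postcompCLM Complex.reCLM)‖
      ≤ √(∫ ξ, besselSymbol ξ ^ 2) * ∫ x, ‖Φ x‖ := by
  have h0 : 0 ≤ ∫ x, ‖Φ x‖ := integral_nonneg fun _ => norm_nonneg _
  have h0' : 0 ≤ ∫ ξ, besselSymbol ξ ^ 2 := integral_nonneg fun _ => by positivity
  refine abs_le_of_sq_le_sq' ?_ (by positivity) |>.2
  rw [mul_pow, Real.sq_sqrt h0', ← real_inner_self_eq_norm_sq, inner_L2]
  refine le_trans ?_ (integral_norm_bessel_sq_le Φ)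
  have h3 : Integrable fun x => ‖bessel Φ x‖ ^ 2 := by
    have := ((bessel Φ).memLp 2 (volume : Measure Vec)).integrable_norm_pow (by norm_num)
    simpa using this
  refine integral_mono_of_nonneg (.of_forall fun x => mul_self_nonneg _) h3 ?_
  filter_upwards [coeFn_schwartzL2 ((bessel Φ).postcompCLM Complex.reCLM)] with x hx
  rw [hx, ← sq, ← sq_abs, postcompCLM_apply]
  exact pow_le_pow_left₀ (abs_nonneg _) (Complex.abs_re_le_norm _) 2

/-- The constant of the Sobolev embedding. -/
def embConst : ℝ := (1 + 3 * ((2 * Real.pi) ^ 2)⁻¹) * √(∫ ξ, besselSymbol ξ ^ 2)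

/-- The embedding in dual form. Write `φ = η - (2π)⁻² Δη` with `η` the Bessel potential of `φ`, and
move the two derivatives to `f`. It remains to bound `‖η‖` in `L²` by the `L¹` norm of `φ`. -/
theorem abs_inner_test_le (f : X 2) {φ : Vec → ℝ} (h : IsTest φ) :
    |⟪f.fn, h.toL2⟫_ℝ| ≤ embConst * ‖f‖ * ∫ x, |φ x| := by
  set Φ : 𝓢(Vec, ℂ) := HasCompactSupport.toSchwartzMap (f := fun x => (φ x : ℂ))
    (h.2.comp_left (g := fun r : ℝ => (r : ℂ)) (by simp))
    (Complex.ofRealCLM.contDiff.comp h.1) with hΦ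
  have hΦx : ∀ x, Φ x = (φ x : ℂ) := fun x => rfl
  set η : 𝓢(Vec, ℝ) := (bessel Φ).postcompCLM Complex.reCLM with hη
  set c : ℝ := ((2 * Real.pi) ^ 2)⁻¹ with hc
  have hc0 : 0 ≤ c := by positivity
  have hpt : ∀ x, φ x = η x - c * ∑ i : Fin 3, (∂_{unitVec i} (∂_{unitVec i} η : 𝓢(Vec, ℝ)) : 𝓢(Vec, ℝ)) x := by
    intro x
    have h1 := congrArg (fun Ψ : 𝓢(Vec, ℂ) => (Ψ x).re) (bessel_eq Φ)
    simp only [_root_.sub_apply, _root_.smul_apply, _root_.sum_apply,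
      hΦx, Complex.ofReal_re, Complex.sub_re, Complex.smul_re, Complex.re_sum, smul_eq_mul] at h1
    rw [← h1]
    simp only [hη, lineDeriv_postcomp_re, postcompCLM_apply, Complex.reCLM_apply, hc]
  have hL2 : h.toL2 = schwartzL2 η
      - c • ∑ i : Fin 3, schwartzL2 (∂_{unitVec i} (∂_{unitVec i} η : 𝓢(Vec, ℝ))) := by
    rw [← map_sum, ← map_smul, ← map_sub]
    refine MemLp.toLp_congr _ (SchwartzMap.memLp _ 2 volume) (.of_forall fun x => ?_)
    rw [hpt x]
    simp
  have hw : ∀ i : Fin 3, ⟪f.fn, schwartzL2 (∂_{unitVec i} (∂_{unitVec i} η : 𝓢(Vec, ℝ)))⟫_ℝ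
      = ⟪f.D (unitIndex i + unitIndex i), schwartzL2 η⟫_ℝ := by
    intro i
    have h1 : WD i f.fn (f.D (unitIndex i + 0)) := f.wd_D i (by simp)
    have h2 : WD i (f.D (unitIndex i)) (f.D (unitIndex i + unitIndex i)) := f.wd_D i (by simp)
    rw [add_zero] at h1
    rw [h2.inner_left (wd_schwartz η i), h1.inner_left (wd_schwartz _ i), neg_neg]
  have hnorm : ‖schwartzL2 η‖ ≤ √(∫ ξ, besselSymbol ξ ^ 2) * ∫ x, |φ x| := by
    have h2 : ∫ x, ‖Φ x‖ = ∫ x, |φ x| := by simp [hΦx]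
    rw [← h2]
    exact norm_schwartzL2_re_bessel_le Φ
  rw [hL2, inner_sub_right, real_inner_smul_right, inner_sum]
  simp only [hw]
  have hb : ∀ α : MultiIndex, |⟪f.D α, schwartzL2 η⟫_ℝ| ≤ ‖f‖ * ‖schwartzL2 η‖ := fun α =>
    (abs_real_inner_le_norm _ _).trans (by gcongr; exact f.norm_D_le α)
  have hsum : |∑ i : Fin 3, ⟪f.D (unitIndex i + unitIndex i), schwartzL2 η⟫_ℝ|
      ≤ 3 * (‖f‖ * ‖schwartzL2 η‖) := by
    refine (Finset.abs_sum_le_sum_abs _ _).trans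
      ((Finset.sum_le_sum fun i _ => hb (unitIndex i + unitIndex i)).trans ?_)
    simp
  calc _ ≤ |⟪f.D 0, schwartzL2 η⟫_ℝ|
        + |c * ∑ i : Fin 3, ⟪f.D (unitIndex i + unitIndex i), schwartzL2 η⟫_ℝ| := abs_sub _ _
    _ ≤ ‖f‖ * ‖schwartzL2 η‖ + c * (3 * (‖f‖ * ‖schwartzL2 η‖)) := by
        rw [abs_mul, abs_of_nonneg hc0]
        gcongr
        exact hb 0
    _ = (1 + 3 * c) * ‖f‖ * ‖schwartzL2 η‖ := by ring
    _ ≤ (1 + 3 * c) * ‖f‖ * (√(∫ ξ, besselSymbol ξ ^ 2) * ∫ x, |φ x|) := by gcongr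
    _ = _ := by rw [embConst]; ring

open scoped Convolution in
/-- The Sobolev embedding `H² ⊆ L^∞`. -/
theorem ae_abs_le (f : X 2) : ∀ᵐ x : Vec, |f.fn x| ≤ embConst * ‖f‖ := by
  have hli : LocallyIntegrable f.fn (volume : Measure Vec) :=
    (Lp.memLp f.fn).locallyIntegrable (by norm_num)
  let b : ℕ → ContDiffBump (0 : Vec) := fun n =>
    ⟨((n : ℝ) + 1)⁻¹, 2 * ((n : ℝ) + 1)⁻¹, by positivity, by
      have : 0 < ((n : ℝ) + 1)⁻¹ := by positivity
      linarith⟩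
  have hb : Tendsto (fun n => (b n).rOut) atTop (𝓝 0) := by
    have := (tendsto_one_div_add_atTop_nhds_zero_nat (𝕜 := ℝ)).const_mul 2
    simpa [b] using this
  -- At almost every point `f` is the limit of its mollifications. Each of these is a pairing with a
  -- test function of `L¹` norm one, so the dual bound applies with the same constant.
  filter_upwards [ContDiffBump.ae_convolution_tendsto_right_of_locallyIntegrable (K := 2) hb
    (.of_forall fun n => le_rfl) hli] with x hx
  refine le_of_tendsto hx.abs (.of_forall fun n => ?_)
  have ht : IsTest ((b n).normed volume) :=
    ⟨(b n).contDiff_normed (n := ⊤), (b n).hasCompactSupport_normed⟩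
  have htx : IsTest fun y => (b n).normed volume (y + -x) := ht.comp_add (-x)
  have h1 := abs_inner_test_le f htx
  have h2 : ∫ y, |(b n).normed volume (y + -x)| = 1 := by
    rw [integral_add_right_eq_self (fun y => |(b n).normed volume y|) (-x)]
    simp only [abs_of_nonneg ((b n).nonneg_normed _)]
    exact (b n).integral_normed
  rw [h2, mul_one] at h1
  refine le_trans (le_of_eq ?_) h1
  congr 1
  rw [real_inner_comm, htx.inner_toL2, convolution_eq_swap]
  refine integral_congr_ae (.of_forall fun y => ?_)
  simp only [ContinuousLinearMap.lsmul_apply]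
  congr 1
  rw [← (b n).normed_neg]
  congr 1
  abel

end Embedding

/-! ### Multiplication by functions in `H²` -/

theorem memLp_mul (f : X 2) (g : L2) : MemLp (fun x => f.fn x * g x) 2 volume := by
  refine MemLp.of_le_mul (c := embConst * ‖f‖) (Lp.memLp g)
    ((Lp.aestronglyMeasurable f.fn).mul (Lp.aestronglyMeasurable g)) ?_
  filter_upwards [ae_abs_le f] with x hx
  rw [norm_mul, Real.norm_eq_abs]
  gcongr

theorem norm_mul_toLp_le (f : X 2) (g : L2) :
    ‖(memLp_mul f g).toLp _‖ ≤ embConst * ‖f‖ * ‖g‖ := by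
  refine Lp.norm_le_mul_norm_of_ae_le_mul ?_
  filter_upwards [ae_abs_le f, (memLp_mul f g).coeFn_toLp] with x hx h2
  rw [h2, norm_mul, Real.norm_eq_abs]
  gcongr

/-- Multiplication by a function in `H²`, as a bounded operator on `L²`. -/
def mulOp : X 2 →L[ℝ] L2 →L[ℝ] L2 :=
  LinearMap.mkContinuous₂
    (LinearMap.mk₂ ℝ (fun f g => (memLp_mul f g).toLp _)
      (fun f f' g => by
        apply Lp.ext
        have e : (f + f').fn = f.fn + f'.fn := Sobolev.D_add f f' 0
        filter_upwards [(memLp_mul (f + f') g).coeFn_toLp, (memLp_mul f g).coeFn_toLp,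
          (memLp_mul f' g).coeFn_toLp, Lp.coeFn_add ((memLp_mul f g).toLp _)
          ((memLp_mul f' g).toLp _), Lp.coeFn_add f.fn f'.fn] with x h1 h2 h3 h4 h5
        rw [h4, h1, Pi.add_apply, h2, h3, e, h5, Pi.add_apply, add_mul])
      (fun c f g => by
        apply Lp.ext
        have e : (c • f).fn = c • f.fn := Sobolev.D_smul c f 0
        filter_upwards [(memLp_mul (c • f) g).coeFn_toLp, (memLp_mul f g).coeFn_toLp,
          Lp.coeFn_smul c ((memLp_mul f g).toLp _), Lp.coeFn_smul c f.fn] with x h1 h2 h3 h4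
        rw [h3, h1, Pi.smul_apply, h2, e, h4, Pi.smul_apply, smul_eq_mul, smul_eq_mul, mul_assoc])
      (fun f g g' => by
        apply Lp.ext
        filter_upwards [(memLp_mul f (g + g')).coeFn_toLp, (memLp_mul f g).coeFn_toLp,
          (memLp_mul f g').coeFn_toLp, Lp.coeFn_add ((memLp_mul f g).toLp _)
          ((memLp_mul f g').toLp _), Lp.coeFn_add g g'] with x h1 h2 h3 h4 h5
        rw [h4, h1, Pi.add_apply, h2, h3, h5, Pi.add_apply, mul_add])
      (fun c f g => by
        apply Lp.ext
        filter_upwards [(memLp_mul f (c • g)).coeFn_toLp, (memLp_mul f g).coeFn_toLp,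
          Lp.coeFn_smul c ((memLp_mul f g).toLp _), Lp.coeFn_smul c g] with x h1 h2 h3 h4
        rw [h3, h1, Pi.smul_apply, h2, h4, Pi.smul_apply, smul_eq_mul, smul_eq_mul,
          mul_left_comm])) embConst
    (fun f g => norm_mul_toLp_le f g)

theorem coeFn_mulOp (f : X 2) (g : L2) : mulOp f g =ᵐ[volume] fun x => f.fn x * g x :=
  (memLp_mul f g).coeFn_toLp

attribute [irreducible] mulOp

section
variable {k l r n a b m : ℕ}

/-! ### The scalar Sobolev spaces as sealed Hilbert spaces -/

/-- A copy of `H^k`, opaque to instance search beyond its inner product space structure. -/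
def W (k : ℕ) : Type := X k

instance : NormedAddCommGroup (W k) := inferInstanceAs (NormedAddCommGroup (X k))
instance : InnerProductSpace ℝ (W k) := inferInstanceAs (InnerProductSpace ℝ (X k))

/-- The identification of the two copies of `H^k`. -/
def ofX : X k ≃ₗᵢ[ℝ] W k := LinearIsometryEquiv.refl ℝ (X k)

/-- The identification of the two copies of `H^k`. -/
def toX : W k ≃ₗᵢ[ℝ] X k := LinearIsometryEquiv.refl ℝ (X k)

@[simp] theorem toX_ofX (f : X k) : toX (ofX f) = f := rfl

/-- `f ↦ ∂^α f`. -/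
def dW (α : MultiIndex) : W k →L[ℝ] L2 := DL k ℝ α

/-- `f ↦ f` as a map `H^k → L²`. -/
def fnW : W k →L[ℝ] L2 := dW 0

/-- The derivative `∂^α : H^k → H^r` for `r + |α| ≤ k`. -/
def shiftW (α : MultiIndex) (h : r + α.order ≤ k) : W k →L[ℝ] W r := shift α h

/-- The inclusion `H^k ⊆ H^l`. -/
def inclW (h : l ≤ k) : W k →L[ℝ] W l := inclL h

/-- The partial derivative `∂ᵢ : H^k → H^l` for `l + 1 ≤ k`. -/
def pdW (i : Fin 3) (h : l + 1 ≤ k) : W k →L[ℝ] W l := pdL i h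

/-- Translation on `H^k`. -/
def transW (v : Vec) : W k →L[ℝ] W k := transX v

/-- Averaging on `H^k`. -/
def avgW (i : Fin 3) (h : ℝ) : W k →L[ℝ] W k := avgX i h

theorem dW_zero : (dW 0 : W k →L[ℝ] L2) = fnW := rfl

theorem dW_toX (α : MultiIndex) (f : W k) : dW α f = (toX f).D α := rfl

theorem fnW_toX (f : W k) : fnW f = (toX f).fn := rfl

theorem ext_fnW {f g : W k} (h : fnW f = fnW g) : f = g := Sobolev.ext_fn (k := k) h

theorem norm_dW_le (α : MultiIndex) (f : W k) : ‖dW α f‖ ≤ ‖f‖ := (toX f).norm_D_le α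

theorem norm_fnW_le (f : W k) : ‖fnW f‖ ≤ ‖f‖ := norm_dW_le 0 f

theorem norm_sq_W (f : W k) : ‖f‖ ^ 2 = ∑ α ∈ multiIndices k, ‖dW α f‖ ^ 2 :=
  Sobolev.norm_sq (toX f)

theorem wd_dW (f : W k) (i : Fin 3) {α : MultiIndex} (h : α.order + 1 ≤ k) :
    WD i (dW α f) (dW (unitIndex i + α) f) := (toX f).wd_D i h

theorem dW_shiftW {α β : MultiIndex} (h : r + α.order ≤ k) (hβ : β.order ≤ r) (f : W k) :
    dW β (shiftW α h f) = dW (β + α) f := shift_D h (toX f) hβ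

theorem fnW_shiftW {α : MultiIndex} (h : r + α.order ≤ k) (f : W k) :
    fnW (shiftW α h f) = dW α f := shift_fn h (toX f)

theorem dW_inclW (h : l ≤ k) {α : MultiIndex} (hα : α.order ≤ l) (f : W k) :
    dW α (inclW h f) = dW α f := inclL_D h (toX f) hα

theorem fnW_inclW (h : l ≤ k) (f : W k) : fnW (inclW h f) = fnW f := inclL_fn h (toX f)

theorem norm_inclW_le (h : l ≤ k) (f : W k) : ‖inclW h f‖ ≤ ‖f‖ := norm_inclL_le h (toX f)

theorem dW_pdW (i : Fin 3) (h : l + 1 ≤ k) {α : MultiIndex} (hα : α.order ≤ l) (f : W k) :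
    dW α (pdW i h f) = dW (α + unitIndex i) f := pdL_D i h (toX f) hα

theorem fnW_pdW (i : Fin 3) (h : l + 1 ≤ k) (f : W k) : fnW (pdW i h f) = dW (unitIndex i) f :=
  pdL_fn i h (toX f)

theorem norm_pdW_le (i : Fin 3) (h : l + 1 ≤ k) (f : W k) : ‖pdW i h f‖ ≤ ‖f‖ :=
  norm_pdL_le i h (toX f)

theorem wd_fnW (i : Fin 3) (h : l + 1 ≤ k) (f : W k) : WD i (fnW f) (fnW (pdW i h f)) :=
  wd_fn i h (toX f)

theorem fnW_transW (v : Vec) (f : W k) : fnW (transW v f) = trans v (fnW f) :=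
  transX_D v (toX f) (by simp)

theorem dW_transW (v : Vec) {α : MultiIndex} (hα : α.order ≤ k) (f : W k) :
    dW α (transW v f) = trans v (dW α f) := transX_D v (toX f) hα

theorem fnW_avgW (i : Fin 3) (h : ℝ) (f : W k) : fnW (avgW i h f) = avg i h (fnW f) :=
  avgX_D i h (toX f) (by simp)

theorem norm_avgW_le (i : Fin 3) (h : ℝ) (f : W k) : ‖avgW i h f‖ ≤ ‖f‖ := norm_avgX_le i h _

theorem avgW_zero (i : Fin 3) (f : W k) : avgW i 0 f = f := avgX_zero i (toX f)

theorem transW_zero (f : W k) : transW 0 f = f := transX_zero (toX f)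

theorem exists_of_wdW {f : L2} {G : Fin 3 → W k} (hG : ∀ i, WD i f (fnW (G i))) :
    ∃ F : W (k + 1), fnW F = f ∧ (∀ i, pdW i le_rfl F = G i) ∧ ‖F‖ ≤ ‖f‖ + ∑ i, ‖G i‖ :=
  exists_of_wd (G := fun i => toX (G i)) hG

theorem _root_.Continuous.transW {Z : Type*} [TopologicalSpace Z] {v : Z → Vec} {f : Z → W k}
    (hv : Continuous v) (hf : Continuous f) :
    Continuous fun z => EulerMaxwell.transW (v z) (f z) :=
  Continuous.comp (g := fun p : Vec × X k => transX p.1 p.2) continuous_transX (hv.prodMk hf)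

theorem _root_.Continuous.avgW {Z : Type*} [TopologicalSpace Z] {h : Z → ℝ} {f : Z → W k}
    (i : Fin 3) (hh : Continuous h) (hf : Continuous f) :
    Continuous fun z => EulerMaxwell.avgW i (h z) (f z) :=
  Continuous.comp (g := fun p : ℝ × X k => avgX i p.1 p.2) (continuous_avgX i) (hh.prodMk hf)

theorem ae_abs_fnW_le (f : W 2) : ∀ᵐ x : Vec, |fnW f x| ≤ embConst * ‖f‖ := ae_abs_le (toX f)

/-- Multiplication by a function in `H²`, as a bounded operator on `L²`. -/
def mulW : W 2 →L[ℝ] L2 →L[ℝ] L2 := mulOp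

theorem coeFn_mulW (f : W 2) (g : L2) : mulW f g =ᵐ[volume] fun x => fnW f x * g x :=
  coeFn_mulOp (toX f) g

attribute [irreducible] W ofX toX dW fnW shiftW inclW pdW transW avgW mulW

theorem embConst_nonneg : 0 ≤ embConst := by unfold embConst; positivity

theorem norm_mulW_apply_le (f : W 2) (g : L2) : ‖mulW f g‖ ≤ embConst * ‖f‖ * ‖g‖ := by
  refine Lp.norm_le_mul_norm_of_ae_le_mul ?_
  filter_upwards [ae_abs_fnW_le f, coeFn_mulW f g] with x hx h2
  rw [h2, norm_mul, Real.norm_eq_abs]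
  gcongr

theorem inner_mulW (f : W 2) (g h : L2) : ⟪mulW f g, h⟫_ℝ = ⟪g, mulW f h⟫_ℝ := by
  rw [inner_L2, inner_L2]
  refine integral_congr_ae ?_
  filter_upwards [coeFn_mulW f g, coeFn_mulW f h] with x h1 h2
  rw [h1, h2]
  ring

/-! ### Products -/

/-- The product of two Sobolev functions, one of which lies in `H²`, as an element of `L²`. -/
def prodL (a b : ℕ) : W a →L[ℝ] W b →L[ℝ] L2 :=
  if ha : 2 ≤ a then mulW.bilinearComp (inclW ha) fnW
  else if hb : 2 ≤ b then (mulW.bilinearComp (inclW hb) fnW).flip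
  -- Default value when neither factor is known to be bounded; the index conditions in the later
  -- lemmas exclude this case.
  else 0

theorem coeFn_prodL (h : 2 ≤ a ∨ 2 ≤ b) (f : W a) (g : W b) :
    prodL a b f g =ᵐ[volume] fun x => fnW f x * fnW g x := by
  unfold prodL
  split_ifs with ha hb
  · filter_upwards [coeFn_mulW (inclW ha f) (fnW g)] with x hx
    rw [fnW_inclW] at hx
    exact hx
  · filter_upwards [coeFn_mulW (inclW hb g) (fnW f)] with x hx
    rw [fnW_inclW] at hx
    exact hx.trans (mul_comm _ _)
  · omega

theorem coeFn_dq (i : Fin 3) (h : ℝ) (f : L2) :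
    dq i h f =ᵐ[volume] fun x => h⁻¹ * (f (x + h • unitVec i) - f x) := by
  filter_upwards [Lp.coeFn_smul h⁻¹ (trans (h • unitVec i) f - f),
    Lp.coeFn_sub (trans (h • unitVec i) f) f, coeFn_trans (h • unitVec i) f] with x h1 h2 h3
  rw [dq, h1, Pi.smul_apply, h2, Pi.sub_apply, h3, smul_eq_mul]

theorem fnW_avgW_pdW (i : Fin 3) (hl : l + 1 ≤ k) {h : ℝ} (hh : h ≠ 0) (f : W k) :
    fnW (avgW i h (pdW i hl f)) = dq i h (fnW f) := by
  rw [fnW_avgW, (wd_fnW i hl f).dq_eq hh]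

/-- The product rule for weak derivatives. -/
theorem wd_prodL (hab : 2 ≤ a + b) (i : Fin 3) (f : W (a + 1)) (g : W (b + 1)) :
    WD i (prodL (a + 1) (b + 1) f g)
      (prodL a (b + 1) (pdW i le_rfl f) g + prodL (a + 1) b f (pdW i le_rfl g)) := by
  -- For `h ≠ 0` the difference quotient of `fg` equals `(A_h ∂f) τ_h g + f A_h ∂g`, where `A_h`
  -- averages over segments and `τ_h` translates. This expression is continuous at `h = 0`, so
  -- `WD.of_tendsto_dq` applies.
  have hlim : Tendsto (fun h : ℝ => prodL a (b + 1) (avgW i h (pdW i le_rfl f))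
      (transW (h • unitVec i) g) + prodL (a + 1) b f (avgW i h (pdW i le_rfl g))) (𝓝[≠] 0)
      (𝓝 (prodL a (b + 1) (pdW i le_rfl f) g + prodL (a + 1) b f (pdW i le_rfl g))) := by
    have c1 : Continuous fun h : ℝ => avgW i h (pdW i (le_refl (a + 1)) f) :=
      Continuous.avgW i continuous_id continuous_const
    have c2 : Continuous fun h : ℝ => avgW i h (pdW i (le_refl (b + 1)) g) :=
      Continuous.avgW i continuous_id continuous_const
    have c3 : Continuous fun h : ℝ => transW (h • unitVec i) g :=
      Continuous.transW (continuous_id.smul continuous_const) continuous_const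
    have c : Continuous fun h : ℝ => prodL a (b + 1) (avgW i h (pdW i le_rfl f))
      (transW (h • unitVec i) g) + prodL (a + 1) b f (avgW i h (pdW i le_rfl g)) :=
      (((prodL a (b + 1)).continuous.comp c1).clm_apply c3).add
        ((prodL (a + 1) b f).continuous.comp c2)
    have := c.tendsto 0
    simp only [avgW_zero, zero_smul, transW_zero] at this
    exact this.mono_left nhdsWithin_le_nhds
  refine WD.of_tendsto_dq (hlim.congr' ?_)
  filter_upwards [self_mem_nhdsWithin] with h hh
  have hh : h ≠ 0 := hh
  apply Lp.ext
  have e1 := coeFn_prodL (a := a) (b := b + 1) (by omega) (avgW i h (pdW i le_rfl f))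
      (transW (h • unitVec i) g)
  have e2 := coeFn_prodL (a := a + 1) (b := b) (by omega) f (avgW i h (pdW i le_rfl g))
  have e3 := coeFn_prodL (a := a + 1) (b := b + 1) (by omega) f g
  rw [fnW_avgW_pdW i _ hh, fnW_transW] at e1
  rw [fnW_avgW_pdW i _ hh] at e2
  filter_upwards [e1, e2, e3, ae_add_right (h • unitVec i) e3, coeFn_dq i h (fnW f),
    coeFn_dq i h (fnW g), coeFn_dq i h (prodL (a + 1) (b + 1) f g),
    coeFn_trans (h • unitVec i) (fnW g),
    Lp.coeFn_add (prodL a (b + 1) (avgW i h (pdW i le_rfl f)) (transW (h • unitVec i) g))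
      (prodL (a + 1) b f (avgW i h (pdW i le_rfl g)))] with x h1 h2 h3 h4 h5 h6 h7 h8 h9
  rw [h9, Pi.add_apply, h1, h2, h5, h6, h7, h8, h3, h4]
  ring

theorem exists_ofL2 (p : L2) : ∃ F : W 0, fnW F = p ∧ ‖F‖ ≤ ‖p‖ := by
  have h0 : ∀ α : MultiIndex, α.order ≤ 0 → α = 0 := fun α hα => by
    by_contra h
    obtain ⟨i, β, rfl⟩ := exists_unitIndex_add h
    rw [order_add, order_unitIndex] at hα
    omega
  have hD : ∀ α : MultiIndex, α.order ≤ 0 → IsWeakDeriv α p p :=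
    fun α hα => h0 α hα ▸ isWeakDeriv_zero p
  have hF : fnW (ofX (Sobolev.mk (fun _ => p) hD)) = p := by
    rw [fnW_toX, toX_ofX]
    exact Sobolev.mk_D (by simp)
  have hN : ∀ F : W 0, ‖F‖ ^ 2 = ‖fnW F‖ ^ 2 := fun F => by
    have : multiIndices 0 = {0} := by
      ext α
      rw [mem_multiIndices, Finset.mem_singleton]
      exact ⟨h0 α, fun h => by simp [h]⟩
    rw [norm_sq_W, this, Finset.sum_singleton, dW_zero]
  refine ⟨ofX (Sobolev.mk (fun _ => p) hD), hF, ?_⟩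
  refine abs_le_of_sq_le_sq' ?_ (norm_nonneg _) |>.2
  rw [hN, hF]

/-- Induction on `n` through `∂(fg) = ∂f g + f ∂g`: each summand lowers one of `a`, `b` by one,
which matches lowering `n`. At `n = 0` the condition `a + b ≥ 3` forces one index to be at least
two, and that factor is bounded. -/
theorem exists_mul (n : ℕ) : ∀ a b : ℕ, n ≤ a → n ≤ b → n + 3 ≤ a + b → ∃ C : ℝ, 0 ≤ C ∧
    ∀ (f : W a) (g : W b), ∃ F : W n, fnW F = prodL a b f g ∧ ‖F‖ ≤ C * ‖f‖ * ‖g‖ := by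
  induction n with
  | zero =>
    intro a b _ _ hab
    refine ⟨‖prodL a b‖, (prodL a b).opNorm_nonneg, fun f g => ?_⟩
    obtain ⟨F, hF, hn⟩ := exists_ofL2 (prodL a b f g)
    exact ⟨F, hF, hn.trans ((prodL a b).le_opNorm₂ f g)⟩
  | succ n ih =>
    intro a b ha hb hab
    obtain ⟨a, rfl⟩ : ∃ a', a = a' + 1 := ⟨a - 1, by omega⟩
    obtain ⟨b, rfl⟩ : ∃ b', b = b' + 1 := ⟨b - 1, by omega⟩
    obtain ⟨C₁, h₁, H₁⟩ := ih a (b + 1) (by omega) (by omega) (by omega)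
    obtain ⟨C₂, h₂, H₂⟩ := ih (a + 1) b (by omega) (by omega) (by omega)
    have hp := (prodL (a + 1) (b + 1)).opNorm_nonneg
    refine ⟨‖prodL (a + 1) (b + 1)‖ + 3 * (C₁ + C₂), by positivity, fun f g => ?_⟩
    choose F₁ hF₁ hn₁ using fun i => H₁ (pdW i le_rfl f) g
    choose F₂ hF₂ hn₂ using fun i => H₂ f (pdW i le_rfl g)
    obtain ⟨F, hF, -, hn⟩ := exists_of_wdW (f := prodL (a + 1) (b + 1) f g)
      (G := fun i => F₁ i + F₂ i) (fun i => by
        rw [map_add, hF₁, hF₂]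
        exact wd_prodL (by omega) i f g)
    refine ⟨F, hF, hn.trans ?_⟩
    have e : ∀ i, ‖F₁ i + F₂ i‖ ≤ (C₁ + C₂) * ‖f‖ * ‖g‖ := fun i => by
      refine (norm_add_le _ _).trans ?_
      have e1 : ‖F₁ i‖ ≤ C₁ * ‖f‖ * ‖g‖ := (hn₁ i).trans (by gcongr; exact norm_pdW_le i _ f)
      have e2 : ‖F₂ i‖ ≤ C₂ * ‖f‖ * ‖g‖ := (hn₂ i).trans (by gcongr; exact norm_pdW_le i _ g)
      linarith
    have e0 := (prodL (a + 1) (b + 1)).le_opNorm₂ f g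
    calc _ ≤ ‖prodL (a + 1) (b + 1)‖ * ‖f‖ * ‖g‖ + ∑ _i : Fin 3, (C₁ + C₂) * ‖f‖ * ‖g‖ :=
          add_le_add e0 (Finset.sum_le_sum fun i _ => e i)
      _ = _ := by simp; ring

/-- The conditions under which `H^a · H^b ⊆ H^n` follows by the product rule. -/
structure MulCond (n a b : ℕ) : Prop where
  left : n ≤ a
  right : n ≤ b
  sum : n + 3 ≤ a + b

theorem MulCond.two_le (h : MulCond n a b) : 2 ≤ a ∨ 2 ≤ b := by
  have := h.sum; omega

/-- The product of two Sobolev functions. -/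
def mulFun (h : MulCond n a b) (f : W a) (g : W b) : W n :=
  (((exists_mul n a b h.left h.right h.sum).choose_spec.2 f g)).choose

theorem mulFun_fn (h : MulCond n a b) (f : W a) (g : W b) :
    fnW (mulFun h f g) = prodL a b f g :=
  (((exists_mul n a b h.left h.right h.sum).choose_spec.2 f g)).choose_spec.1

theorem norm_mulFun_le (h : MulCond n a b) (f : W a) (g : W b) :
    ‖mulFun h f g‖ ≤ (exists_mul n a b h.left h.right h.sum).choose * ‖f‖ * ‖g‖ :=
  (((exists_mul n a b h.left h.right h.sum).choose_spec.2 f g)).choose_spec.2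

/-- The product of Sobolev functions as a bounded bilinear map. -/
def mulX (h : MulCond n a b) : W a →L[ℝ] W b →L[ℝ] W n :=
  LinearMap.mkContinuous₂
    (LinearMap.mk₂ ℝ (fun f g => mulFun h f g)
      (fun f f' g => ext_fnW (by
        rw [map_add, mulFun_fn, mulFun_fn, mulFun_fn, map_add]; rfl))
      (fun c f g => ext_fnW (by
        rw [map_smul, mulFun_fn, mulFun_fn, map_smul]; rfl))
      (fun f g g' => ext_fnW (by
        rw [map_add, mulFun_fn, mulFun_fn, mulFun_fn, map_add]))
      (fun c f g => ext_fnW (by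
        rw [map_smul, mulFun_fn, mulFun_fn, map_smul])))
    (exists_mul n a b h.left h.right h.sum).choose (fun f g => norm_mulFun_le h f g)

theorem fnW_mulX (h : MulCond n a b) (f : W a) (g : W b) :
    fnW (mulX h f g) = prodL a b f g := mulFun_fn h f g

attribute [irreducible] mulX

theorem coeFn_mulX (h : MulCond n a b) (f : W a) (g : W b) :
    fnW (mulX h f g) =ᵐ[volume] fun x => fnW f x * fnW g x := by
  rw [fnW_mulX]
  exact coeFn_prodL h.two_le f g

theorem fnW_mulX_eq_mulW (h : MulCond n a b) (ha : 2 ≤ a) (f : W a) (g : W b) :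
    fnW (mulX h f g) = mulW (inclW ha f) (fnW g) := by
  apply Lp.ext
  filter_upwards [coeFn_mulX h f g, coeFn_mulW (inclW ha f) (fnW g)] with x h1 h2
  rw [h1, h2, fnW_inclW]

/-- The product rule for a bounded multiplier and a function in `H¹`. -/
theorem wd_mulW (ha : 3 ≤ a) (ha2 : 2 ≤ a) (i : Fin 3) (f : W a) {g g' : L2} (hg : WD i g g')
    (hg1 : ∃ G : W 1, fnW G = g) :
    WD i (mulW (inclW ha2 f) g) (mulW (pdW i ha f) g + mulW (inclW ha2 f) g') := by
  obtain ⟨G, rfl⟩ := hg1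
  have h := wd_prodL (a := 2) (b := 0) (by omega) i (inclW ha f) G
  have e0 : fnW (pdW i (le_refl (0 + 1)) G) = g' := (wd_fnW i le_rfl G).unique hg
  have e1 : prodL (2 + 1) (0 + 1) (inclW ha f) G = mulW (inclW ha2 f) (fnW G) := by
    apply Lp.ext
    filter_upwards [coeFn_prodL (a := 2 + 1) (b := 0 + 1) (by omega) (inclW ha f) G,
      coeFn_mulW (inclW ha2 f) (fnW G)] with x h1 h2
    rw [h1, h2, fnW_inclW, fnW_inclW]
  have e2 : prodL 2 (0 + 1) (pdW i le_rfl (inclW ha f)) G = mulW (pdW i ha f) (fnW G) := by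
    apply Lp.ext
    filter_upwards [coeFn_prodL (a := 2) (b := 0 + 1) (by omega) (pdW i le_rfl (inclW ha f)) G,
      coeFn_mulW (pdW i ha f) (fnW G)] with x h1 h2
    rw [h1, h2, fnW_pdW, fnW_pdW, dW_inclW _ (by simp)]
  have e3 : prodL (2 + 1) 0 (inclW ha f) (pdW i le_rfl G) = mulW (inclW ha2 f) g' := by
    apply Lp.ext
    filter_upwards [coeFn_prodL (a := 2 + 1) (b := 0) (by omega) (inclW ha f) (pdW i le_rfl G),
      coeFn_mulW (inclW ha2 f) g'] with x h1 h2
    rw [h1, h2, fnW_inclW, fnW_inclW, e0]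
  rwa [e1, e2, e3] at h

end

section
variable {k l r n a b m : ℕ}

/-! ### Commutators -/

/-- In `∂^α(fg) - f ∂^α g` at least one derivative falls on `f`, so at most `|α| - 1` fall on `g`.
The remainder can thus be differentiated `m + 1 - |α|` times, once even when `|α| = m`. The target
index `r` is quantified inside the induction because each step consumes one derivative of the
previous remainder. -/
theorem exists_commutator (hm : 3 ≤ m) (hc : MulCond m (m + 1) m) (h2 : 2 ≤ m + 1)
    (α : MultiIndex) : ∀ r, r + α.order ≤ m + 1 →
    ∃ R : W (m + 1) →L[ℝ] W m →L[ℝ] W r, ∀ (f : W (m + 1)) (g : W m), α.order ≤ m →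
      dW α (mulX hc f g) = mulW (inclW h2 f) (dW α g) + fnW (R f g) := by
  induction α using multiIndex_induction with
  | h0 =>
    intro r _
    refine ⟨0, fun f g _ => ?_⟩
    have : fnW ((0 : W (m + 1) →L[ℝ] W m →L[ℝ] W r) f g) = 0 := map_zero fnW
    rw [this, add_zero, dW_zero]
    exact fnW_mulX_eq_mulW _ h2 f g
  | hs i β ih =>
    intro r hr
    rw [order_add, order_unitIndex] at hr
    obtain ⟨R, hR⟩ := ih (r + 1) (by omega)
    have hβ : r + β.order ≤ m := by omega
    have hc' : MulCond r m r := ⟨by omega, le_rfl, by omega⟩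
    have h3 : 3 ≤ m + 1 := by omega
    -- The new remainder is `∂ᵢf ∂^β g + ∂ᵢ R(f, g)`, where `R` is the remainder for `β` with values
    -- in `H^(r+1)`.
    refine ⟨(mulX hc').bilinearComp (pdW i (le_refl (m + 1)))
      (shiftW β hβ) + (ContinuousLinearMap.compL ℝ (W m) (W (r + 1)) (W r)
        (pdW i le_rfl)).comp R, fun f g hα => ?_⟩
    rw [order_add, order_unitIndex] at hα
    have h1 := wd_dW (mulX hc f g) i (α := β) (by omega)
    rw [hR f g (by omega)] at h1
    have e2 := wd_mulW h3 h2 i f (wd_dW g i (α := β) (by omega))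
      ⟨shiftW β (by omega) g, fnW_shiftW _ _⟩
    have e3 := wd_fnW i (le_refl (r + 1)) (R f g)
    have e4 : WD i (mulW (inclW h2 f) (dW β g) + fnW (R f g))
        (mulW (pdW i h3 f) (dW β g) + mulW (inclW h2 f) (dW (unitIndex i + β) g)
          + fnW (pdW i le_rfl (R f g))) := by
      rw [WD_iff] at e2 e3 ⊢
      intro φ hφ
      rw [inner_add_right, e2 φ hφ, e3 φ hφ, inner_add_right (x := hφ.toL2) (y := _ + _)]
      ring
    rw [add_comm β, h1.unique e4]
    have e5 : fnW (((mulX hc').bilinearComp (pdW i (le_refl (m + 1))) (shiftW β hβ)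
        + (ContinuousLinearMap.compL ℝ (W m) (W (r + 1)) (W r) (pdW i le_rfl)).comp R) f g)
        = mulW (pdW i h3 f) (dW β g) + fnW (pdW i le_rfl (R f g)) := by
      rw [← fnW_shiftW hβ g]
      have : fnW (mulX hc' (pdW i (le_refl (m + 1)) f) (shiftW β hβ g))
          = mulW (pdW i h3 f) (fnW (shiftW β hβ g)) := by
        rw [fnW_mulX_eq_mulW _ (by omega : 2 ≤ m)]
        congr 2
        exact ext_fnW (by rw [fnW_inclW, fnW_pdW, fnW_pdW])
      rw [← this, ← map_add]
      simp only [_root_.add_apply, ContinuousLinearMap.bilinearComp_apply,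
        ContinuousLinearMap.comp_apply, ContinuousLinearMap.compL_apply]
    rw [e5]
    abel

theorem dq_mulW (ha : 3 ≤ a) (ha2 : 2 ≤ a) (i : Fin 3) {h : ℝ} (hh : h ≠ 0) (f : W a) (g : L2) :
    dq i h (mulW (inclW ha2 f) g) = mulW (inclW ha2 f) (dq i h g)
      + mulW (avgW i h (pdW i ha f)) (trans (h • unitVec i) g) := by
  apply Lp.ext
  have e := coeFn_mulW (avgW i h (pdW i ha f)) (trans (h • unitVec i) g)
  rw [fnW_avgW_pdW i _ hh] at e
  have e1 := coeFn_mulW (inclW ha2 f) g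
  have e2 := coeFn_mulW (inclW ha2 f) (dq i h g)
  rw [fnW_inclW] at e1 e2
  filter_upwards [e, e1, e2, ae_add_right (h • unitVec i) e1,
    coeFn_dq i h (fnW f), coeFn_dq i h g, coeFn_dq i h (mulW (inclW ha2 f) g),
    coeFn_trans (h • unitVec i) g,
    Lp.coeFn_add (mulW (inclW ha2 f) (dq i h g))
      (mulW (avgW i h (pdW i ha f)) (trans (h • unitVec i) g))]
    with x h1 h2 h3 h4 h5 h6 h7 h8 h9
  rw [h9, Pi.add_apply, h1, h3, h5, h6, h7, h8, h2, h4]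
  ring

theorem dq_add (i : Fin 3) (h : ℝ) (f g : L2) : dq i h (f + g) = dq i h f + dq i h g := by
  simp only [dq, map_add]
  rw [← smul_add]
  congr 1
  abel

/-- The commutator of multiplication by `f` with a difference quotient of `∂^α`; it is bounded and
extends continuously to `h = 0`. -/
theorem exists_dq_commutator (hm : 3 ≤ m) (hc : MulCond m (m + 1) m) (hm2 : 2 ≤ m + 1)
    (i : Fin 3) (α : MultiIndex) (hα : α.order ≤ m) :
    ∃ Q : ℝ → W (m + 1) → W m → L2, ∃ C : ℝ, 0 ≤ C ∧
      (Continuous fun p : ℝ × W (m + 1) × W m => Q p.1 p.2.1 p.2.2) ∧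
      (∀ h f g, ‖Q h f g‖ ≤ C * ‖f‖ * ‖g‖) ∧
      ∀ h, h ≠ 0 → ∀ f g, dq i h (dW α (mulX hc f g))
        = mulW (inclW hm2 f) (dq i h (dW α g)) + Q h f g := by
  -- Values in `H¹` are needed: the difference quotient of the remainder is then the average of a
  -- derivative in `L²`, bounded uniformly in `h`.
  obtain ⟨R, hR⟩ := exists_commutator hm hc hm2 α 1 (by omega)
  have hm3 : 3 ≤ m + 1 := by omega
  refine ⟨fun h f g => mulW (avgW i h (pdW i hm3 f)) (trans (h • unitVec i) (dW α g))
    + avg i h (dW (unitIndex i) (R f g)), embConst + ‖R‖,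
    add_nonneg embConst_nonneg R.opNorm_nonneg, ?_, ?_, ?_⟩
  · have c1 : Continuous fun p : ℝ × W (m + 1) × W m => avgW i p.1 (pdW i hm3 p.2.1) :=
      Continuous.avgW i continuous_fst ((pdW i _).continuous.comp continuous_snd.fst)
    have c2 : Continuous fun p : ℝ × W (m + 1) × W m =>
        trans (p.1 • unitVec i) (dW α p.2.2) :=
      Continuous.trans_L2 (continuous_fst.smul continuous_const)
        ((dW α).continuous.comp continuous_snd.snd)
    have c3 : Continuous fun p : ℝ × W (m + 1) × W m =>
        avg i p.1 (dW (unitIndex i) (R p.2.1 p.2.2)) :=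
      Continuous.avg_L2 i continuous_fst ((dW (unitIndex i)).continuous.comp
        ((R.continuous.comp continuous_snd.fst).clm_apply continuous_snd.snd))
    exact ((mulW.continuous.comp c1).clm_apply c2).add c3
  · intro h f g
    refine (norm_add_le _ _).trans ?_
    have h1 : ‖mulW (avgW i h (pdW i hm3 f)) (trans (h • unitVec i) (dW α g))‖
        ≤ embConst * ‖f‖ * ‖g‖ := by
      refine (norm_mulW_apply_le _ _).trans ?_
      rw [norm_trans]
      have := embConst_nonneg
      gcongr
      · exact (norm_avgW_le i h _).trans (norm_pdW_le i _ f)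
      · exact norm_dW_le α g
    have h2 : ‖avg i h (dW (unitIndex i) (R f g))‖ ≤ ‖R‖ * ‖f‖ * ‖g‖ :=
      (norm_avg_apply_le i h _).trans ((norm_dW_le _ (R f g)).trans (R.le_opNorm₂ f g))
    linarith
  · intro h hh f g
    rw [hR f g hα, dq_add, dq_mulW hm3 hm2 i hh]
    have h3 : dq i h (fnW (R f g)) = avg i h (dW (unitIndex i) (R f g)) := by
      rw [(wd_fnW i le_rfl (R f g)).dq_eq hh, fnW_pdW]
    rw [h3, add_assoc]

end

/-! ### Differentiation in time -/

/-- If `E h` has derivative `G h` for `h ≠ 0` and both are jointly continuous up to `h = 0`, then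
`E 0` has derivative `G 0`. -/
theorem hasDerivWithinAt_of_continuousOn_prod {E G : ℝ → ℝ → ℝ} {T : ℝ}
    (hE : ContinuousOn (fun p : ℝ × ℝ => E p.1 p.2) (univ ×ˢ Ico 0 T))
    (hG : ContinuousOn (fun p : ℝ × ℝ => G p.1 p.2) (univ ×ˢ Ico 0 T))
    (hd : ∀ h, h ≠ 0 → ∀ t ∈ Ico 0 T, HasDerivWithinAt (E h) (G h t) (Ico 0 T) t)
    {t : ℝ} (ht : t ∈ Ico 0 T) : HasDerivWithinAt (E 0) (G 0 t) (Ico 0 T) t := by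
  obtain ⟨b, htb, hbT⟩ := exists_between ht.2
  have hb0 : 0 ≤ b := ht.1.trans htb.le
  -- Clamping time to `[0, b]`, with `t < b < T`, extends the rate to a jointly continuous function
  -- on the whole plane without changing it near `t` in `[0, T)`.
  set c : ℝ → ℝ := fun τ => max 0 (min τ b) with hc
  have hcc : Continuous c := by fun_prop
  have hcm : ∀ τ, c τ ∈ Ico 0 T := fun τ =>
    ⟨le_max_left _ _, max_lt (hb0.trans_lt hbT) ((min_le_right _ _).trans_lt hbT)⟩
  have hce : ∀ τ ∈ Icc 0 b, c τ = τ := fun τ hτ => by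
    simp only [hc]
    rw [min_eq_left hτ.2, max_eq_right hτ.1]
  have hG' : Continuous fun p : ℝ × ℝ => G p.1 (c p.2) := by
    have := hG.comp_continuous (f := fun p : ℝ × ℝ => (p.1, c p.2)) (by fun_prop)
      (fun p => ⟨mem_univ _, hcm _⟩)
    exact this
  have hEh : ∀ τ ∈ Ico 0 T, Continuous fun h => E h τ := fun τ hτ =>
    hE.comp_continuous (f := fun h : ℝ => (h, τ)) (by fun_prop) (fun h => ⟨mem_univ _, hτ⟩)
  have key : ∀ τ ∈ Icc 0 b, E 0 τ = E 0 0 + ∫ x in (0 : ℝ)..τ, G 0 (c x) := by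
    intro τ hτ
    have hτT : τ ∈ Ico 0 T := ⟨hτ.1, hτ.2.trans_lt hbT⟩
    have h0T : (0 : ℝ) ∈ Ico 0 T := ⟨le_rfl, hb0.trans_lt hbT⟩
    -- For `h ≠ 0` the identity is integrated in time; in this form it survives the limit `h → 0`,
    -- where only continuity is available.
    have hne : ∀ h : ℝ, h ≠ 0 → E h τ - E h 0 = ∫ x in (0 : ℝ)..τ, G h (c x) := by
      intro h hh
      symm
      refine intervalIntegral.integral_eq_sub_of_hasDeriv_right_of_le hτ.1 ?_ ?_ ?_
      · intro x hx
        exact ((hd h hh x ⟨hx.1, hx.2.trans_lt hτT.2⟩).continuousWithinAt).mono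
          (fun y hy => ⟨hy.1, hy.2.trans_lt hτT.2⟩)
      · intro x hx
        rw [hce x ⟨hx.1.le, hx.2.le.trans hτ.2⟩]
        refine ((hd h hh x ⟨hx.1.le, hx.2.trans hτT.2⟩).hasDerivAt ?_).hasDerivWithinAt
        exact Ico_mem_nhds hx.1 (hx.2.trans hτT.2)
      · exact (hG'.comp (by fun_prop : Continuous fun x : ℝ => (h, x))).intervalIntegrable _ _
    have l1 : Tendsto (fun h => E h τ - E h 0) (𝓝[≠] 0) (𝓝 (E 0 τ - E 0 0)) :=
      (((hEh τ hτT).sub (hEh 0 h0T)).tendsto 0).mono_left nhdsWithin_le_nhds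
    have l2 : Tendsto (fun h => ∫ x in (0 : ℝ)..τ, G h (c x)) (𝓝[≠] 0)
        (𝓝 (∫ x in (0 : ℝ)..τ, G 0 (c x))) :=
      ((intervalIntegral.continuous_parametric_intervalIntegral_of_continuous'
        (f := fun h x => G h (c x)) hG' 0 τ).tendsto 0).mono_left nhdsWithin_le_nhds
    have := tendsto_nhds_unique (l1.congr' (by
      filter_upwards [self_mem_nhdsWithin] with h hh
      exact hne h hh)) l2
    linarith
  have hd0 : HasDerivAt (fun τ => E 0 0 + ∫ x in (0 : ℝ)..τ, G 0 (c x)) (G 0 t) t := by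
    have hcont : Continuous fun x => G 0 (c x) :=
      hG'.comp (by fun_prop : Continuous fun x : ℝ => ((0 : ℝ), x))
    have := (hcont.integral_hasStrictDerivAt 0 t).hasDerivAt.const_add (E 0 0)
    rwa [hce t ⟨ht.1, htb.le⟩] at this
  refine hd0.hasDerivWithinAt.congr_of_eventuallyEq ?_ (key t ⟨ht.1, htb.le⟩)
  filter_upwards [self_mem_nhdsWithin, mem_nhdsWithin_of_mem_nhds (Iio_mem_nhds htb)] with τ h1 h2
  exact key τ ⟨h1.1, le_of_lt h2⟩

/-- The derivative of `⟪f, ∂ⱼ g⟫` for paths that are `C¹` in `L²` and continuous in `H¹`. -/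
theorem hasDerivWithinAt_inner_wd {I : Set ℝ} {t : ℝ} (ht : t ∈ I) {j : Fin 3}
    {f g df dg : ℝ → L2} {f' g' : L2} (hf : HasDerivWithinAt f f' I t)
    (hg : HasDerivWithinAt g g' I t) (hdg : ContinuousWithinAt dg I t)
    (wf : ∀ τ ∈ I, WD j (f τ) (df τ)) (wg : ∀ τ ∈ I, WD j (g τ) (dg τ)) :
    HasDerivWithinAt (fun τ => ⟪f τ, dg τ⟫_ℝ) (⟪f', dg t⟫_ℝ - ⟪df t, g'⟫_ℝ) I t := by
  rw [hasDerivWithinAt_iff_tendsto_slope] at hf hg ⊢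
  have l1 : Tendsto (fun τ => ⟪slope f t τ, dg τ⟫_ℝ) (𝓝[I \ {t}] t) (𝓝 ⟪f', dg t⟫_ℝ) :=
    hf.inner (hdg.mono_left (nhdsWithin_mono _ sdiff_subset))
  have l2 : Tendsto (fun τ => ⟪df t, slope g t τ⟫_ℝ) (𝓝[I \ {t}] t) (𝓝 ⟪df t, g'⟫_ℝ) :=
    tendsto_const_nhds.inner hg
  refine (l1.sub l2).congr' ?_
  filter_upwards [self_mem_nhdsWithin] with τ hτ
  -- `⟪f t, ∂ⱼ(g τ - g t)⟫` is rewritten with the derivative on `f t`. Hence the time derivative of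
  -- `g` is needed in `L²` only, while that of `∂ⱼ g` never appears.
  have h1 := (wf t ht).inner_left (wg t ht)
  have h2 := (wf t ht).inner_left (wg τ hτ.1)
  simp only [slope, vsub_eq_sub]
  rw [real_inner_smul_left, real_inner_smul_right, smul_eq_mul, inner_sub_left, inner_sub_right,
    h1, h2]
  ring

variable {m : ℕ} {I : Set ℝ}

/-- The path `f` is continuous in `H^(m+1)` and continuously differentiable in `H^m`. -/
structure RegPath (I : Set ℝ) (f : ℝ → W (m + 1)) (f' : ℝ → W m) : Prop where
  cont : ContinuousOn f I
  deriv : ∀ t ∈ I, HasDerivWithinAt (fun τ => inclW (Nat.le_succ m) (f τ)) (f' t) I t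
  cont' : ContinuousOn f' I

theorem RegPath.dW {f : ℝ → W (m + 1)} {f' : ℝ → W m} (h : RegPath I f f') {α : MultiIndex}
    (hα : α.order ≤ m) {t : ℝ} (ht : t ∈ I) :
    HasDerivWithinAt (fun τ => dW α (f τ)) (EulerMaxwell.dW α (f' t)) I t := by
  have := (EulerMaxwell.dW α : W m →L[ℝ] L2).hasFDerivAt.comp_hasDerivWithinAt t (h.deriv t ht)
  refine this.congr_of_mem (fun τ _ => ?_) ht
  exact (dW_inclW (Nat.le_succ m) hα (f τ)).symm

theorem RegPath.add {f g : ℝ → W (m + 1)} {f' g' : ℝ → W m} (hf : RegPath I f f')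
    (hg : RegPath I g g') : RegPath I (fun t => f t + g t) (fun t => f' t + g' t) where
  cont := hf.cont.add hg.cont
  deriv t ht := by
    simp only [map_add]
    exact (hf.deriv t ht).add (hg.deriv t ht)
  cont' := hf.cont'.add hg.cont'

/-! ### Multiplication operators -/

section Mul
variable [hm : Fact (3 ≤ m)]

/-- The product on `H^(m+1)`. -/
def mulT : W (m + 1) →L[ℝ] W (m + 1) →L[ℝ] W (m + 1) :=
  mulX ⟨le_rfl, le_rfl, by have := hm.out; omega⟩

/-- The product `H^(m+1) × H^m → H^m`. -/
def mulM : W (m + 1) →L[ℝ] W m →L[ℝ] W m :=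
  mulX ⟨Nat.le_succ m, le_rfl, by have := hm.out; omega⟩

/-- The product on `H^m`. -/
def mulMM : W m →L[ℝ] W m →L[ℝ] W m :=
  mulX ⟨le_rfl, le_rfl, by have := hm.out; omega⟩

/-- Multiplication of `L²` functions by an element of `H^m`. -/
def opM : W m →L[ℝ] L2 →L[ℝ] L2 := mulW.comp (inclW (by have := hm.out; omega))

/-- Multiplication of `L²` functions by an element of `H^(m+1)`. -/
def opT : W (m + 1) →L[ℝ] L2 →L[ℝ] L2 := opM.comp (inclW (Nat.le_succ m))

theorem opT_apply (g : W (m + 1)) : opT g = opM (inclW (Nat.le_succ m) g) := rfl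

theorem coeFn_opM (g : W m) (x : L2) : opM g x =ᵐ[volume] fun y => fnW g y * x y := by
  have h2 : 2 ≤ m := by have := hm.out; omega
  have := coeFn_mulW (inclW h2 g) x
  rwa [fnW_inclW] at this

theorem coeFn_opT (g : W (m + 1)) (x : L2) : opT g x =ᵐ[volume] fun y => fnW g y * x y := by
  have := coeFn_opM (inclW (Nat.le_succ m) g) x
  rwa [fnW_inclW] at this

theorem norm_opM_le (g : W m) (x : L2) : ‖opM g x‖ ≤ embConst * ‖g‖ * ‖x‖ := by
  refine (norm_mulW_apply_le _ _).trans ?_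
  have := embConst_nonneg
  gcongr
  exact norm_inclW_le _ g

theorem inner_opT (g : W (m + 1)) (x y : L2) : ⟪opT g x, y⟫_ℝ = ⟪x, opT g y⟫_ℝ := inner_mulW _ _ _

theorem opT_mulT (f g : W (m + 1)) (x : L2) : opT (mulT f g) x = opT f (opT g x) := by
  apply Lp.ext
  filter_upwards [coeFn_opT (mulT f g) x, coeFn_opT f (opT g x), coeFn_opT g x,
    coeFn_mulX _ f g] with y h1 h2 h3 h4
  rw [h1, h2, h3]
  rw [mulT, h4, mul_assoc]

theorem mulT_comm (f g : W (m + 1)) : mulT f g = mulT g f := by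
  apply ext_fnW
  apply Lp.ext
  rw [mulT]
  filter_upwards [coeFn_mulX (n := m + 1) _ f g, coeFn_mulX (n := m + 1) _ g f] with y h1 h2
  rw [h1, h2, mul_comm]

theorem inclW_mulT (f g : W (m + 1)) : inclW (Nat.le_succ m) (mulT f g)
    = mulMM (inclW (Nat.le_succ m) f) (inclW (Nat.le_succ m) g) := by
  apply ext_fnW
  apply Lp.ext
  rw [mulT, mulMM, fnW_inclW]
  have h := coeFn_mulX (n := m) (a := m) (b := m) ⟨le_rfl, le_rfl, by have := hm.out; omega⟩
    (inclW (Nat.le_succ m) f) (inclW (Nat.le_succ m) g)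
  rw [fnW_inclW, fnW_inclW] at h
  filter_upwards [coeFn_mulX (n := m + 1) _ f g, h] with y h1 h2
  rw [h1, h2]

theorem RegPath.mul {f g : ℝ → W (m + 1)} {f' g' : ℝ → W m} (hf : RegPath I f f')
    (hg : RegPath I g g') : RegPath I (fun t => mulT (f t) (g t))
      (fun t => mulMM (inclW (Nat.le_succ m) (f t)) (g' t)
        + mulMM (f' t) (inclW (Nat.le_succ m) (g t))) where
  cont := (mulT.continuous.comp_continuousOn hf.cont).clm_apply hg.cont
  deriv t ht := by
    simp only [inclW_mulT]
    exact mulMM.hasDerivWithinAt_of_bilinear (hf.deriv t ht) (hg.deriv t ht)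
  cont' := ((mulMM.continuous.comp_continuousOn ((inclW _).continuous.comp_continuousOn
      hf.cont)).clm_apply hg.cont').add ((mulMM.continuous.comp_continuousOn
      hf.cont').clm_apply ((inclW _).continuous.comp_continuousOn hg.cont))

/-- The weight `f ∘ g` with `1 + f ∘ g = (1 + f)(1 + g)`. -/
def circ (f g : W (m + 1)) : W (m + 1) := f + g + mulT f g

/-- Multiplication by `1 + g`. -/
def op (g : W (m + 1)) : L2 →L[ℝ] L2 := ContinuousLinearMap.id ℝ L2 + opT g

theorem op_apply (g : W (m + 1)) (x : L2) : op g x = x + opT g x := rfl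

theorem op_circ (f g : W (m + 1)) (x : L2) : op (circ f g) x = op f (op g x) := by
  simp only [op_apply, circ, map_add, _root_.add_apply, opT_mulT]
  abel

theorem circ_comm (f g : W (m + 1)) : circ f g = circ g f := by
  rw [circ, circ, mulT_comm, add_comm f]

theorem op_comm (f g : W (m + 1)) (x : L2) : op f (op g x) = op g (op f x) := by
  rw [← op_circ, circ_comm, op_circ]

theorem inner_op (g : W (m + 1)) (x y : L2) : ⟪op g x, y⟫_ℝ = ⟪x, op g y⟫_ℝ := by
  rw [op_apply, op_apply, inner_add_left, inner_add_right, inner_opT]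

/-! ### Integration by parts with weights -/

theorem wd_opT (g : W (m + 1)) (j : Fin 3) (v : W 1) :
    WD j (opT g (fnW v)) (opM (pdW j le_rfl g) (fnW v) + opT g (dW (unitIndex j) v)) := by
  have h3 : 3 ≤ m + 1 := by have := hm.out; omega
  have h := wd_mulW h3 (by omega) j g (wd_fnW j (le_refl (0 + 1)) v) ⟨v, rfl⟩
  rw [fnW_pdW] at h
  have e1 : opT g = mulW (inclW (by omega) g) := by
    rw [opT_apply, opM, ContinuousLinearMap.comp_apply]
    congr 1
    exact ext_fnW (by rw [fnW_inclW, fnW_inclW, fnW_inclW])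
  have e2 : opM (pdW j (le_refl (m + 1)) g) = mulW (pdW j h3 g) := by
    rw [opM, ContinuousLinearMap.comp_apply]
    congr 1
    exact ext_fnW (by rw [fnW_inclW, fnW_pdW, fnW_pdW])
  rw [e1, e2]
  exact h

theorem wd_W1 (j : Fin 3) (v : W 1) : WD j (fnW v) (dW (unitIndex j) v) := by
  have := wd_fnW j (le_refl (0 + 1)) v
  rwa [fnW_pdW] at this

theorem ibp (v w : W 1) (j : Fin 3) :
    ⟪dW (unitIndex j) v, fnW w⟫_ℝ = - ⟪fnW v, dW (unitIndex j) w⟫_ℝ :=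
  (wd_W1 j v).inner_left (wd_W1 j w)

theorem ibp_opT (g : W (m + 1)) (v w : W 1) (j : Fin 3) :
    ⟪opT g (fnW v), dW (unitIndex j) w⟫_ℝ + ⟪opT g (dW (unitIndex j) v), fnW w⟫_ℝ
      = - ⟪opM (pdW j le_rfl g) (fnW v), fnW w⟫_ℝ := by
  have h := (wd_opT g j v).inner_left (wd_W1 j w)
  rw [inner_add_left] at h
  linarith

theorem ibp_op (g : W (m + 1)) (v w : W 1) (j : Fin 3) :
    ⟪op g (fnW v), dW (unitIndex j) w⟫_ℝ + ⟪op g (dW (unitIndex j) v), fnW w⟫_ℝ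
      = - ⟪opM (pdW j le_rfl g) (fnW v), fnW w⟫_ℝ := by
  have h1 := ibp_opT g v w j
  have h2 := ibp v w j
  simp only [op_apply, inner_add_left]
  linarith

theorem ibp_opT_self (g : W (m + 1)) (v : W 1) (j : Fin 3) :
    ⟪opT g (fnW v), dW (unitIndex j) v⟫_ℝ
      = - (1 / 2) * ⟪opM (pdW j le_rfl g) (fnW v), fnW v⟫_ℝ := by
  have h1 := ibp_opT g v v j
  rw [inner_opT g (dW (unitIndex j) v), real_inner_comm] at h1
  rw [real_inner_comm] at h1
  have h2 : ⟪opT g (fnW v), dW (unitIndex j) v⟫_ℝ = ⟪dW (unitIndex j) v, opT g (fnW v)⟫_ℝ :=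
    real_inner_comm _ _
  have h3 : ⟪opM (pdW j le_rfl g) (fnW v), fnW v⟫_ℝ = ⟪fnW v, opM (pdW j le_rfl g) (fnW v)⟫_ℝ :=
    real_inner_comm _ _
  linarith

end Mul

/-! ### Energy identities for the linearised system -/

/-- The `j`-th component of the curl of a field with components in `H¹`. -/
def curl1 (f : Fin 3 → W 1) (j : Fin 3) : L2 :=
  dW (unitIndex (j + 1)) (f (j + 2)) - dW (unitIndex (j + 2)) (f (j + 1))

/-- The linearised system in `L²`, with forcing terms `Fr`, `Fv`, `Fθ`, `Fe`. -/
structure LinSys (r θ : W 1) (v e b : Fin 3 → W 1) (r' θ' : L2) (v' e' b' : Fin 3 → L2)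
    (Fr Fθ : L2) (Fv Fe : Fin 3 → L2) : Prop where
  mass : r' = -∑ j, dW (unitIndex j) (v j) + Fr
  momentum : ∀ j, v' j = -dW (unitIndex j) θ - dW (unitIndex j) r - fnW (e j) - fnW (v j) + Fv j
  temperature : θ' = -((2 / 3 : ℝ) • ∑ j, dW (unitIndex j) (v j)) - fnW θ + Fθ
  ampere : ∀ j, e' j = curl1 b j + fnW (v j) + Fe j
  faraday : ∀ j, b' j = -curl1 e j
  gauss : ∑ j, dW (unitIndex j) (e j) = -fnW r

/-- `curl` is symmetric. -/
theorem inner_curl1 (f g : Fin 3 → W 1) :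
    ∑ j, ⟪fnW (f j), curl1 g j⟫_ℝ = ∑ j, ⟪curl1 f j, fnW (g j)⟫_ℝ := by
  simp only [Fin.sum_univ_three, curl1, Fin.isValue, Fin.reduceAdd, inner_sub_left,
    inner_sub_right]
  linarith [ibp (f 0) (g 1) 2, ibp (f 0) (g 2) 1, ibp (f 1) (g 0) 2, ibp (f 1) (g 2) 0,
    ibp (f 2) (g 0) 1, ibp (f 2) (g 1) 0]

section
variable {r θ : W 1} {v e b : Fin 3 → W 1} {r' θ' : L2} {v' e' b' : Fin 3 → L2}
  {Fr Fθ : L2} {Fv Fe : Fin 3 → L2}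

/-- The gradient and divergence terms cancel by parts, the weight `3/2` compensating the factor
`2/3` in the temperature equation; the curls cancel by symmetry; the work of `E` on `u` cancels the
current. What is left is the damping of `u` and `Θ`. -/
theorem LinSys.energy (H : LinSys r θ v e b r' θ' v' e' b' Fr Fθ Fv Fe) :
    ⟪fnW r, r'⟫_ℝ + ∑ j, ⟪fnW (v j), v' j⟫_ℝ + 3 / 2 * ⟪fnW θ, θ'⟫_ℝ
        + ∑ j, ⟪fnW (e j), e' j⟫_ℝ + ∑ j, ⟪fnW (b j), b' j⟫_ℝ
      = -∑ j, ‖fnW (v j)‖ ^ 2 - 3 / 2 * ‖fnW θ‖ ^ 2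
        + (⟪fnW r, Fr⟫_ℝ + ∑ j, ⟪fnW (v j), Fv j⟫_ℝ + 3 / 2 * ⟪fnW θ, Fθ⟫_ℝ
          + ∑ j, ⟪fnW (e j), Fe j⟫_ℝ) := by
  have hc := inner_curl1 b e
  simp only [H.mass, H.momentum, H.temperature, H.ampere, H.faraday, inner_add_right,
    inner_sub_right, inner_neg_right, real_inner_smul_right, ← real_inner_self_eq_norm_sq,
    inner_sum, Finset.sum_add_distrib, Finset.sum_sub_distrib, Finset.sum_neg_distrib, hc]
  have h1 : ∀ j, ⟪fnW (v j), dW (unitIndex j) r⟫_ℝ = -⟪fnW r, dW (unitIndex j) (v j)⟫_ℝ :=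
    fun j => by rw [real_inner_comm, ibp]
  have h2 : ∀ j, ⟪fnW (v j), dW (unitIndex j) θ⟫_ℝ = -⟪fnW θ, dW (unitIndex j) (v j)⟫_ℝ :=
    fun j => by rw [real_inner_comm, ibp]
  have h3 : ∀ j, ⟪curl1 b j, fnW (e j)⟫_ℝ = ⟪fnW (e j), curl1 b j⟫_ℝ :=
    fun j => real_inner_comm _ _
  have h4 : ∀ j, ⟪fnW (v j), fnW (e j)⟫_ℝ = ⟪fnW (e j), fnW (v j)⟫_ℝ :=
    fun j => real_inner_comm _ _
  simp only [h1, h2, h3, h4, Finset.sum_neg_distrib]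
  ring

/-- The left side is the rate of `∑ⱼ ⟪vⱼ, ∂ⱼ r⟫` with the time derivative of `∂ⱼ r` integrated by
parts. The pairing of `e` with `∇r` equals `‖r‖²` by Gauss's law, so `r` is dissipated together with
its gradient. -/
theorem LinSys.density (H : LinSys r θ v e b r' θ' v' e' b' Fr Fθ Fv Fe) :
    ∑ j, (⟪v' j, dW (unitIndex j) r⟫_ℝ - ⟪dW (unitIndex j) (v j), r'⟫_ℝ)
      = -∑ j, ⟪dW (unitIndex j) θ, dW (unitIndex j) r⟫_ℝ - ∑ j, ‖dW (unitIndex j) r‖ ^ 2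
        - ‖fnW r‖ ^ 2 - ∑ j, ⟪fnW (v j), dW (unitIndex j) r⟫_ℝ
        + ‖∑ j, dW (unitIndex j) (v j)‖ ^ 2
        + (∑ j, ⟪Fv j, dW (unitIndex j) r⟫_ℝ - ∑ j, ⟪dW (unitIndex j) (v j), Fr⟫_ℝ) := by
  have h1 : ∑ j, ⟪fnW (e j), dW (unitIndex j) r⟫_ℝ = ⟪fnW r, fnW r⟫_ℝ := by
    have : ∀ j, ⟪fnW (e j), dW (unitIndex j) r⟫_ℝ = -⟪dW (unitIndex j) (e j), fnW r⟫_ℝ :=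
      fun j => by rw [ibp]; ring
    simp only [this, Finset.sum_neg_distrib]
    rw [← sum_inner, H.gauss, inner_neg_left, neg_neg]
  have h2 : ∑ j, ⟪dW (unitIndex j) (v j), ∑ k, dW (unitIndex k) (v k)⟫_ℝ
      = ‖∑ j, dW (unitIndex j) (v j)‖ ^ 2 := by
    rw [← sum_inner, real_inner_self_eq_norm_sq]
  simp only [H.mass, H.momentum, inner_add_right, inner_add_left, inner_sub_left,
    inner_neg_left, inner_neg_right, ← real_inner_self_eq_norm_sq (dW (unitIndex _) r),
    ← real_inner_self_eq_norm_sq (fnW r), Finset.sum_add_distrib, Finset.sum_sub_distrib,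
    Finset.sum_neg_distrib, h1, h2]
  ring

/-- The force `-e` in the momentum equation, paired with `e`, produces the dissipation. The only
term that is not quadratic in already controlled quantities is the pairing of `v` with the curl of
`b`, which is kept for later. -/
theorem LinSys.electric (H : LinSys r θ v e b r' θ' v' e' b' Fr Fθ Fv Fe) :
    ∑ j, (⟪v' j, fnW (e j)⟫_ℝ + ⟪fnW (v j), e' j⟫_ℝ)
      = -∑ j, ⟪dW (unitIndex j) θ + dW (unitIndex j) r, fnW (e j)⟫_ℝ - ∑ j, ‖fnW (e j)‖ ^ 2
        - ∑ j, ⟪fnW (v j), fnW (e j)⟫_ℝ + ∑ j, ⟪fnW (v j), curl1 b j⟫_ℝ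
        + ∑ j, ‖fnW (v j)‖ ^ 2
        + (∑ j, ⟪Fv j, fnW (e j)⟫_ℝ + ∑ j, ⟪fnW (v j), Fe j⟫_ℝ) := by
  simp only [H.ampere, H.momentum, inner_add_right, inner_add_left, inner_sub_left,
    inner_neg_left, ← real_inner_self_eq_norm_sq, Finset.sum_add_distrib,
    Finset.sum_sub_distrib, Finset.sum_neg_distrib]
  ring

/-- Ampère's law turns the pairing of `e'` with the curl of `b` into the square of that curl, and
Faraday's law costs the square of the curl of `e`. The sign is reversed in the functional that is
used. -/
theorem LinSys.magnetic (H : LinSys r θ v e b r' θ' v' e' b' Fr Fθ Fv Fe) :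
    ∑ j, (⟪curl1 e j, b' j⟫_ℝ + ⟪e' j, curl1 b j⟫_ℝ)
      = -∑ j, ‖curl1 e j‖ ^ 2 + ∑ j, ‖curl1 b j‖ ^ 2 + ∑ j, ⟪fnW (v j), curl1 b j⟫_ℝ
        + ∑ j, ⟪Fe j, curl1 b j⟫_ℝ := by
  simp only [H.ampere, H.faraday, inner_neg_right, inner_add_left, ← real_inner_self_eq_norm_sq,
    Finset.sum_add_distrib, Finset.sum_neg_distrib]
  ring

end

/-! ### Estimates of the identities for the linearised system. -/

/-- The bounds under which the forcing terms are estimated. -/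
structure ForceBd (M η : ℝ) (r θ : W 1) (v e : Fin 3 → W 1) (Fr Fθ : L2) (Fv Fe : Fin 3 → L2) :
    Prop where
  r_le : ‖fnW r‖ ≤ M
  θ_le : ‖fnW θ‖ ≤ M
  v_le : ∀ j, ‖fnW (v j)‖ ≤ M
  e_le : ∀ j, ‖fnW (e j)‖ ≤ M
  dr_le : ∀ j, ‖dW (unitIndex j) r‖ ≤ M
  dv_le : ∀ j, ‖dW (unitIndex j) (v j)‖ ≤ M
  Fr_le : ‖Fr‖ ≤ η
  Fθ_le : ‖Fθ‖ ≤ η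
  Fv_le : ∀ j, ‖Fv j‖ ≤ η
  Fe_le : ∀ j, ‖Fe j‖ ≤ η

theorem abs_inner_le_of_le {x y : L2} {a b : ℝ} (hx : ‖x‖ ≤ a) (hy : ‖y‖ ≤ b) :
    |⟪x, y⟫_ℝ| ≤ a * b :=
  (abs_real_inner_le_norm x y).trans (mul_le_mul hx hy (norm_nonneg _) ((norm_nonneg _).trans hx))

theorem inner_le_of_le {x y : L2} {a b : ℝ} (hx : ‖x‖ ≤ a) (hy : ‖y‖ ≤ b) :
    ⟪x, y⟫_ℝ ≤ a * b := (le_abs_self _).trans (abs_inner_le_of_le hx hy)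

theorem neg_inner_le_of_le {x y : L2} {a b : ℝ} (hx : ‖x‖ ≤ a) (hy : ‖y‖ ≤ b) :
    -⟪x, y⟫_ℝ ≤ a * b := (neg_le_abs _).trans (abs_inner_le_of_le hx hy)

/-- Young's inequality with `1/4` on the dissipated factor: the density and electric identities each
contain two such products, and together these consume exactly half of the good term. -/
theorem neg_inner_le_sq (x y : L2) : -⟪x, y⟫_ℝ ≤ ‖x‖ ^ 2 + 1 / 4 * ‖y‖ ^ 2 := by
  have := neg_inner_le_of_le (le_refl ‖x‖) (le_refl ‖y‖)
  nlinarith [sq_nonneg (‖x‖ - 1 / 2 * ‖y‖)]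

theorem norm_add_sq_le (x y : L2) : ‖x + y‖ ^ 2 ≤ 2 * ‖x‖ ^ 2 + 2 * ‖y‖ ^ 2 := by
  have := norm_add_le x y
  nlinarith [sq_nonneg (‖x‖ - ‖y‖), norm_nonneg (x + y), norm_nonneg x, norm_nonneg y]

theorem norm_sum_sq_le (x : Fin 3 → L2) : ‖∑ j, x j‖ ^ 2 ≤ 3 * ∑ j, ‖x j‖ ^ 2 := by
  have h1 := norm_sum_le Finset.univ x
  have h2 := sq_sum_le_card_mul_sum_sq (s := (Finset.univ : Finset (Fin 3))) (f := fun j => ‖x j‖)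
  simp only [Finset.card_univ, Fintype.card_fin] at h2
  refine le_trans ?_ (h2.trans (by norm_num))
  gcongr

section
variable {r θ : W 1} {v e b : Fin 3 → W 1} {r' θ' : L2} {v' e' b' : Fin 3 → L2}
  {Fr Fθ : L2} {Fv Fe : Fin 3 → L2} {M η : ℝ}

theorem sum_fin_le {f : Fin 3 → ℝ} {a : ℝ} (h : ∀ j, f j ≤ a) : ∑ j, f j ≤ 3 * a := by
  rw [Fin.sum_univ_three]
  linarith [h 0, h 1, h 2]

theorem LinSys.energy_le (H : LinSys r θ v e b r' θ' v' e' b' Fr Fθ Fv Fe)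
    (B : ForceBd M η r θ v e Fr Fθ Fv Fe) :
    ⟪fnW r, r'⟫_ℝ + ∑ j, ⟪fnW (v j), v' j⟫_ℝ + 3 / 2 * ⟪fnW θ, θ'⟫_ℝ
        + ∑ j, ⟪fnW (e j), e' j⟫_ℝ + ∑ j, ⟪fnW (b j), b' j⟫_ℝ
      ≤ -∑ j, ‖fnW (v j)‖ ^ 2 - 3 / 2 * ‖fnW θ‖ ^ 2 + 9 * (M * η) := by
  rw [H.energy]
  have h0 : 0 ≤ M * η := mul_nonneg ((norm_nonneg _).trans B.r_le) ((norm_nonneg _).trans B.Fr_le)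
  linarith [inner_le_of_le B.r_le B.Fr_le, inner_le_of_le B.θ_le B.Fθ_le,
    sum_fin_le fun j => inner_le_of_le (B.v_le j) (B.Fv_le j),
    sum_fin_le fun j => inner_le_of_le (B.e_le j) (B.Fe_le j)]

theorem LinSys.density_le (H : LinSys r θ v e b r' θ' v' e' b' Fr Fθ Fv Fe)
    (B : ForceBd M η r θ v e Fr Fθ Fv Fe) :
    ∑ j, (⟪v' j, dW (unitIndex j) r⟫_ℝ - ⟪dW (unitIndex j) (v j), r'⟫_ℝ)
      ≤ -(1 / 2) * (‖fnW r‖ ^ 2 + ∑ j, ‖dW (unitIndex j) r‖ ^ 2)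
        + (∑ j, ‖dW (unitIndex j) θ‖ ^ 2 + ∑ j, ‖fnW (v j)‖ ^ 2
          + 3 * ∑ j, ‖dW (unitIndex j) (v j)‖ ^ 2) + 6 * (M * η) := by
  rw [H.density]
  have h1 := Finset.sum_le_sum fun j (_ : j ∈ Finset.univ) =>
    neg_inner_le_sq (dW (unitIndex j) θ) (dW (unitIndex j) r)
  have h2 := Finset.sum_le_sum fun j (_ : j ∈ Finset.univ) =>
    neg_inner_le_sq (fnW (v j)) (dW (unitIndex j) r)
  have h3 := norm_sum_sq_le fun j => dW (unitIndex j) (v j)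
  have h4 := sum_fin_le fun j => inner_le_of_le (B.Fv_le j) (B.dr_le j)
  have h5 := sum_fin_le fun j => neg_inner_le_of_le (B.dv_le j) B.Fr_le
  simp only [Finset.sum_add_distrib, Finset.sum_neg_distrib, ← Finset.mul_sum] at h1 h2 h5
  linarith [sq_nonneg ‖fnW r‖]

theorem LinSys.electric_le (H : LinSys r θ v e b r' θ' v' e' b' Fr Fθ Fv Fe)
    (B : ForceBd M η r θ v e Fr Fθ Fv Fe) :
    ∑ j, (⟪v' j, fnW (e j)⟫_ℝ + ⟪fnW (v j), e' j⟫_ℝ)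
      ≤ -(1 / 2) * ∑ j, ‖fnW (e j)‖ ^ 2
        + 2 * (∑ j, ‖dW (unitIndex j) θ‖ ^ 2 + ∑ j, ‖dW (unitIndex j) r‖ ^ 2
          + ∑ j, ‖fnW (v j)‖ ^ 2) + ∑ j, ⟪fnW (v j), curl1 b j⟫_ℝ + 6 * (M * η) := by
  rw [H.electric]
  have h1 := Finset.sum_le_sum fun j (_ : j ∈ Finset.univ) =>
    neg_inner_le_sq (dW (unitIndex j) θ + dW (unitIndex j) r) (fnW (e j))
  have h2 := Finset.sum_le_sum fun j (_ : j ∈ Finset.univ) =>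
    neg_inner_le_sq (fnW (v j)) (fnW (e j))
  have h3 := Finset.sum_le_sum fun j (_ : j ∈ Finset.univ) =>
    norm_add_sq_le (dW (unitIndex j) θ) (dW (unitIndex j) r)
  have h4 := sum_fin_le fun j => inner_le_of_le (B.Fv_le j) (B.e_le j)
  have h5 := sum_fin_le fun j => inner_le_of_le (B.v_le j) (B.Fe_le j)
  simp only [Finset.sum_add_distrib, Finset.sum_neg_distrib, ← Finset.mul_sum] at h1 h2 h3
  linarith

theorem LinSys.magnetic_le (H : LinSys r θ v e b r' θ' v' e' b' Fr Fθ Fv Fe)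
    (hF : ∀ j, ‖Fe j‖ ≤ η) (hb : ∀ j, ‖curl1 b j‖ ≤ M) :
    -∑ j, (⟪curl1 e j, b' j⟫_ℝ + ⟪e' j, curl1 b j⟫_ℝ)
      ≤ -(1 / 2) * ∑ j, ‖curl1 b j‖ ^ 2 + ∑ j, ‖curl1 e j‖ ^ 2 + ∑ j, ‖fnW (v j)‖ ^ 2
        + 3 * (M * η) := by
  rw [H.magnetic]
  have h2 := Finset.sum_le_sum fun j (_ : j ∈ Finset.univ) =>
    neg_inner_le_sq (fnW (v j)) (curl1 b j)
  have h4 := sum_fin_le fun j => neg_inner_le_of_le (hF j) (hb j)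
  have h5 : 0 ≤ ∑ j, ‖curl1 b j‖ ^ 2 := Finset.sum_nonneg fun j _ => sq_nonneg _
  simp only [Finset.sum_add_distrib, Finset.sum_neg_distrib, ← Finset.mul_sum] at h2 h4
  linarith

end

/-- `‖∇b‖² = ‖curl b‖² + ‖div b‖²`. -/
theorem sum_norm_sq_eq_curl_div {b : Fin 3 → W 1}
    (h : ∀ i j k l, ⟪dW (unitIndex i) (b k), dW (unitIndex j) (b l)⟫_ℝ
      = ⟪dW (unitIndex j) (b k), dW (unitIndex i) (b l)⟫_ℝ) :
    ∑ i, ∑ j, ‖dW (unitIndex i) (b j)‖ ^ 2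
      = ∑ j, ‖curl1 b j‖ ^ 2 + ‖∑ j, dW (unitIndex j) (b j)‖ ^ 2 := by
  simp only [← real_inner_self_eq_norm_sq, Fin.sum_univ_three, curl1, Fin.isValue, Fin.reduceAdd,
    inner_sub_left, inner_sub_right, inner_add_left, inner_add_right]
  have hs : ∀ i j k l, ⟪dW (unitIndex i) (b k), dW (unitIndex j) (b l)⟫_ℝ
      = ⟪dW (unitIndex j) (b l), dW (unitIndex i) (b k)⟫_ℝ := fun i j k l => real_inner_comm _ _
  linarith [h 0 1 0 1, h 0 2 0 2, h 1 2 1 2, hs 0 1 0 1, hs 0 2 0 2, hs 1 2 1 2,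
    hs 0 1 1 0, hs 0 2 2 0, hs 1 2 2 1]

/-- Two integrations by parts exchange `∂ᵢ` and `∂ⱼ`. These exchanges are the ones behind the
identity between gradient, curl and divergence. -/
theorem inner_dW_comm {k : ℕ} {α : MultiIndex} (h : α.order + 2 ≤ k) (f g : W k) (i j : Fin 3) :
    ⟪dW (unitIndex i + α) f, dW (unitIndex j + α) g⟫_ℝ
      = ⟪dW (unitIndex j + α) f, dW (unitIndex i + α) g⟫_ℝ := by
  have wf := fun l : Fin 3 => wd_dW f l (α := α) (by omega)
  have a1 := wd_dW g i (α := unitIndex j + α) (by rw [order_add, order_unitIndex]; omega)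
  have a2 := wd_dW g j (α := unitIndex i + α) (by rw [order_add, order_unitIndex]; omega)
  rw [(wf i).inner_left a1, (wf j).inner_left a2, add_left_comm]

/-! ### The weighted energy identity at top order -/

section Top
variable {m : ℕ} [hm : Fact (3 ≤ m)]

/-- The weight `(1 + Θ)²`, minus one. -/
def wtρ (Θ : W (m + 1)) : W (m + 1) := circ Θ Θ

/-- The weight `(1 + ρ)²`, minus one. -/
def wtΘ (ρ : W (m + 1)) : W (m + 1) := circ ρ ρ

/-- The weight `(1 + ρ)²(1 + Θ)`, minus one. -/
def wtu (ρ Θ : W (m + 1)) : W (m + 1) := circ (circ ρ ρ) Θ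

/-- The system satisfied by a derivative of highest order. -/
structure TopSys (ρ Θ : W (m + 1)) (u : Fin 3 → W (m + 1)) (r θ : W 1) (v e b : Fin 3 → W 1)
    (p : Fin 3 → L2) (r' θ' : L2) (v' e' b' : Fin 3 → L2)
    (Fr Fθ : L2) (G Fv Fe : Fin 3 → L2) : Prop where
  mass : r' = -∑ j, (op ρ (dW (unitIndex j) (v j)) + opT (u j) (dW (unitIndex j) r)) + Fr
  momentum : ∀ j, v' j = -dW (unitIndex j) θ - p j - ∑ k, opT (u k) (dW (unitIndex k) (v j))
    - fnW (e j) - fnW (v j) + Fv j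
  pressure : ∀ j, op ρ (p j) = op Θ (dW (unitIndex j) r) + G j
  temperature : θ' = -∑ j, ((2 / 3 : ℝ) • op Θ (dW (unitIndex j) (v j))
    + opT (u j) (dW (unitIndex j) θ)) - fnW θ + Fθ
  ampere : ∀ j, e' j = curl1 b j + fnW (v j) + Fe j
  faraday : ∀ j, b' j = -curl1 e j

/-- The rate of change of the weighted energy of highest order. -/
def topRate (ρ Θ : W (m + 1)) (u : Fin 3 → W (m + 1)) (a₁ a₂ a₃ : W m) (r θ : L2)
    (v e : Fin 3 → L2) (Fr Fθ : L2) (G Fv Fe : Fin 3 → L2) : ℝ :=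
  (⟪opM a₁ r, r⟫_ℝ + ∑ j, ⟪opM a₂ (v j), v j⟫_ℝ + 3 / 2 * ⟪opM a₃ θ, θ⟫_ℝ)
  + 2 * (∑ j, ⟪opM (pdW j le_rfl (circ ρ (wtρ Θ))) r, v j⟫_ℝ
    + ∑ j, ⟪opM (pdW j le_rfl (wtu ρ Θ)) θ, v j⟫_ℝ
    + 1 / 2 * ∑ j, (⟪opM (pdW j le_rfl (u j + mulT (wtρ Θ) (u j))) r, r⟫_ℝ
      + ∑ k, ⟪opM (pdW j le_rfl (u j + mulT (wtu ρ Θ) (u j))) (v k), v k⟫_ℝ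
      + 3 / 2 * ⟪opM (pdW j le_rfl (u j + mulT (wtΘ ρ) (u j))) θ, θ⟫_ℝ)
    - ∑ j, ⟪v j, op (circ ρ Θ) (G j)⟫_ℝ
    + (⟪op (wtρ Θ) r, Fr⟫_ℝ + ∑ j, ⟪op (wtu ρ Θ) (v j), Fv j⟫_ℝ
      + 3 / 2 * ⟪op (wtΘ ρ) θ, Fθ⟫_ℝ + ∑ j, ⟪e j, Fe j⟫_ℝ)
    - ∑ j, ⟪op (wtu ρ Θ) (v j), v j⟫_ℝ - ∑ j, ⟪opT (wtu ρ Θ) (v j), e j⟫_ℝ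
    - 3 / 2 * ⟪op (wtΘ ρ) θ, θ⟫_ℝ)

/-- `(1 + g) u v ∂ⱼv = (u + gu) ∂ⱼ(v²)/2`, so the transport term loses its derivative to the
coefficient. -/
theorem inner_op_opT_self (g u : W (m + 1)) (v : W 1) (j : Fin 3) :
    ⟪op g (fnW v), opT u (dW (unitIndex j) v)⟫_ℝ
      = -(1 / 2) * ⟪opM (pdW j le_rfl (u + mulT g u)) (fnW v), fnW v⟫_ℝ := by
  rw [← ibp_opT_self, map_add, _root_.add_apply, mulT_comm, opT_mulT, ← inner_opT, op_apply,
    map_add]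

section
variable {ρ Θ : W (m + 1)} {u : Fin 3 → W (m + 1)} {r θ : W 1} {v e b : Fin 3 → W 1}
  {p : Fin 3 → L2} {r' θ' : L2} {v' e' b' : Fin 3 → L2} {Fr Fθ : L2} {G Fv Fe : Fin 3 → L2}

/-- The symmetrizer at work. Both `(1+ρ)` times the weight of `ρ` and `(1+Θ)/(1+ρ)` times the weight
of `u` equal `(1+ρ)(1+Θ)²`; likewise `(1+Θ)` times `(1+ρ)²` is the weight of `u`. After integration
by parts, derivatives fall only on these common coefficients. Transport terms are treated by
`inner_op_opT_self` and the curls cancel. As `E` carries weight one, the work of `E` on `u` cancels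
only up to a cubic term. -/
theorem TopSys.rate (H : TopSys ρ Θ u r θ v e b p r' θ' v' e' b' Fr Fθ G Fv Fe) (a₁ a₂ a₃ : W m) :
    (⟪opM a₁ (fnW r), fnW r⟫_ℝ + ∑ j, ⟪opM a₂ (fnW (v j)), fnW (v j)⟫_ℝ
        + 3 / 2 * ⟪opM a₃ (fnW θ), fnW θ⟫_ℝ)
      + 2 * (⟪op (wtρ Θ) (fnW r), r'⟫_ℝ + ∑ j, ⟪op (wtu ρ Θ) (fnW (v j)), v' j⟫_ℝ
        + 3 / 2 * ⟪op (wtΘ ρ) (fnW θ), θ'⟫_ℝ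
        + ∑ j, ⟪fnW (e j), e' j⟫_ℝ + ∑ j, ⟪fnW (b j), b' j⟫_ℝ)
      = topRate ρ Θ u a₁ a₂ a₃ (fnW r) (fnW θ) (fun j => fnW (v j)) (fun j => fnW (e j))
          Fr Fθ G Fv Fe := by
  have hc := inner_curl1 b e
  have h1 : ∀ j, ⟪op (wtρ Θ) (fnW r), op ρ (dW (unitIndex j) (v j))⟫_ℝ
      = -⟪op (wtu ρ Θ) (fnW (v j)), p j⟫_ℝ + ⟪fnW (v j), op (circ ρ Θ) (G j)⟫_ℝ
        - ⟪opM (pdW j le_rfl (circ ρ (wtρ Θ))) (fnW r), fnW (v j)⟫_ℝ := by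
    intro j
    have e1 : ⟪op (wtu ρ Θ) (fnW (v j)), p j⟫_ℝ
        = ⟪op (circ ρ (wtρ Θ)) (dW (unitIndex j) r), fnW (v j)⟫_ℝ
          + ⟪fnW (v j), op (circ ρ Θ) (G j)⟫_ℝ := by
      rw [inner_op, real_inner_comm _ (fnW (v j)), real_inner_comm (op (circ ρ Θ) (G j)),
        ← inner_add_left]
      congr 1
      rw [wtu, wtρ, op_circ, op_circ, op_comm ρ Θ, H.pressure, op_circ, op_circ, op_circ, map_add,
        map_add]
    have e2 := ibp_op (circ ρ (wtρ Θ)) r (v j) j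
    rw [← inner_op, ← op_circ]
    linarith
  have h2 : ∀ j, ⟪op (wtu ρ Θ) (fnW (v j)), dW (unitIndex j) θ⟫_ℝ
      = -⟪op (wtΘ ρ) (fnW θ), op Θ (dW (unitIndex j) (v j))⟫_ℝ
        - ⟪opM (pdW j le_rfl (wtu ρ Θ)) (fnW θ), fnW (v j)⟫_ℝ := by
    intro j
    have e2 := ibp_op (wtu ρ Θ) θ (v j) j
    have e3 : ⟪op (wtΘ ρ) (fnW θ), op Θ (dW (unitIndex j) (v j))⟫_ℝ
        = ⟪op (wtu ρ Θ) (fnW θ), dW (unitIndex j) (v j)⟫_ℝ := by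
      rw [← inner_op, op_comm, wtu, op_circ, wtΘ]
    have e4 : ⟪op (wtu ρ Θ) (fnW (v j)), dW (unitIndex j) θ⟫_ℝ
        = ⟪op (wtu ρ Θ) (dW (unitIndex j) θ), fnW (v j)⟫_ℝ := by
      rw [inner_op, real_inner_comm]
    linarith
  have h3 : ∀ j, ⟪curl1 b j, fnW (e j)⟫_ℝ = ⟪fnW (e j), curl1 b j⟫_ℝ :=
    fun j => real_inner_comm _ _
  have h4 : ∀ j, ⟪op (wtu ρ Θ) (fnW (v j)), fnW (e j)⟫_ℝ
      = ⟪fnW (e j), fnW (v j)⟫_ℝ + ⟪opT (wtu ρ Θ) (fnW (v j)), fnW (e j)⟫_ℝ := fun j => by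
    rw [op_apply, inner_add_left, real_inner_comm (fnW (v j))]
  simp only [topRate, H.mass, H.momentum, H.temperature, H.ampere, H.faraday, inner_add_right,
    inner_sub_right, inner_neg_right, real_inner_smul_right, 
    inner_sum, Finset.sum_add_distrib, Finset.sum_sub_distrib, Finset.sum_neg_distrib, hc, h1, h2,
    h3, h4, inner_op_opT_self, ← Finset.mul_sum]
  rw [Finset.sum_comm (f := fun j k => ⟪opM (pdW k le_rfl (u k + mulT (wtu ρ Θ) (u k))) (fnW (v j)), fnW (v j)⟫_ℝ)]
  ring

end

/-- The sizes of the quantities in `topRate`. -/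
structure TopBd (c K M : ℝ) (ρ Θ : W (m + 1)) (u : Fin 3 → W (m + 1)) (a₁ a₂ a₃ : W m)
    (r θ : L2) (v e : Fin 3 → L2) (Fr Fθ : L2) (G Fv Fe : Fin 3 → L2) : Prop where
  opM_le : ∀ (g : W m) (x : L2), ‖opM g x‖ ≤ c * ‖g‖ * ‖x‖
  opρ_le : ∀ x : L2, ‖op (wtρ Θ) x‖ ≤ c * ‖x‖
  opΘ_le : ∀ x : L2, ‖op (wtΘ ρ) x‖ ≤ c * ‖x‖
  opu_le : ∀ x : L2, ‖op (wtu ρ Θ) x‖ ≤ c * ‖x‖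
  op_le : ∀ x : L2, ‖op (circ ρ Θ) x‖ ≤ c * ‖x‖
  circ_le : ‖circ ρ (wtρ Θ)‖ ≤ c * M
  wtu_le : ‖wtu ρ Θ‖ ≤ c * K
  wtΘ_le : ‖wtΘ ρ‖ ≤ c * K
  ur_le : ∀ j, ‖u j + mulT (wtρ Θ) (u j)‖ ≤ c * M
  uu_le : ∀ j, ‖u j + mulT (wtu ρ Θ) (u j)‖ ≤ c * M
  uθ_le : ∀ j, ‖u j + mulT (wtΘ ρ) (u j)‖ ≤ c * M
  a₁_le : ‖a₁‖ ≤ c * M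
  a₂_le : ‖a₂‖ ≤ c * M
  a₃_le : ‖a₃‖ ≤ c * M
  r_le : ‖r‖ ≤ K
  θ_le : ‖θ‖ ≤ K
  v_le : ∀ j, ‖v j‖ ≤ K
  e_le : ∀ j, ‖e j‖ ≤ M
  Fr_le : ‖Fr‖ ≤ c * (M * K)
  Fθ_le : ‖Fθ‖ ≤ c * (M * K)
  G_le : ∀ j, ‖G j‖ ≤ c * (M * K)
  Fv_le : ∀ j, ‖Fv j‖ ≤ c * (M * K)
  Fe_le : ∀ j, ‖Fe j‖ ≤ c * (K * K)

/-- Apart from the damping, each term is a product containing two factors of size `K`, the remaining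
one being of size `M`; the count of these terms stays below `80`. -/
theorem TopBd.topRate_le {c K M : ℝ} (hc : 1 ≤ c) (hKM : K ≤ M) {ρ Θ : W (m + 1)}
    {u : Fin 3 → W (m + 1)} {a₁ a₂ a₃ : W m} {r θ : L2} {v e : Fin 3 → L2} {Fr Fθ : L2}
    {G Fv Fe : Fin 3 → L2} (B : TopBd c K M ρ Θ u a₁ a₂ a₃ r θ v e Fr Fθ G Fv Fe) :
    topRate ρ Θ u a₁ a₂ a₃ r θ v e Fr Fθ G Fv Fe
      ≤ -2 * (∑ j, ‖v j‖ ^ 2 + 3 / 2 * ‖θ‖ ^ 2) + 80 * c ^ 2 * (M * K ^ 2) := by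
  have hK : 0 ≤ K := (norm_nonneg _).trans B.r_le
  have hM : 0 ≤ M := hK.trans hKM
  set β := c ^ 2 * (M * K ^ 2) with hβ
  have hβ0 : 0 ≤ β := by positivity
  have i1 : ∀ {g : W m} {x y : L2}, ‖g‖ ≤ c * M → ‖x‖ ≤ K → ‖y‖ ≤ K → |⟪opM g x, y⟫_ℝ| ≤ β := by
    intro g x y hg hx hy
    have h1 : ‖opM g x‖ ≤ c * (c * M) * K := (B.opM_le g x).trans (by gcongr)
    refine (abs_inner_le_of_le h1 hy).trans_eq (by rw [hβ]; ring)
  have i2 : ∀ {g : W (m + 1)} {x y : L2}, ‖g‖ ≤ c * M → ‖x‖ ≤ K → ‖y‖ ≤ K → ∀ j,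
      |⟪opM (pdW j le_rfl g) x, y⟫_ℝ| ≤ β := fun hg hx hy j =>
    i1 ((norm_pdW_le _ _ _).trans hg) hx hy
  have i3 : ∀ {x y F : L2}, ‖x‖ ≤ K → ‖y‖ ≤ c * ‖x‖ → ‖F‖ ≤ c * (M * K) → |⟪y, F⟫_ℝ| ≤ β := by
    intro x y F hx hy hF
    have h1 : ‖y‖ ≤ c * K := hy.trans (by gcongr)
    exact (abs_inner_le_of_le h1 hF).trans_eq (by rw [hβ]; ring)
  -- The field at highest order is bounded only by `M`, so here the weight itself must supply a
  -- factor `K`. For the same reason the forcing in Ampère's law is required to be of size `K²`.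
  have i4 : ∀ {g : W (m + 1)} {x y : L2}, ‖g‖ ≤ c * K → ‖x‖ ≤ K → ‖y‖ ≤ M →
      |⟪opT g x, y⟫_ℝ| ≤ β := by
    intro g x y hg hx hy
    have h1 : ‖opT g x‖ ≤ c * (c * K) * K := (B.opM_le _ x).trans (by
      gcongr
      exact (norm_inclW_le _ _).trans hg)
    refine (abs_inner_le_of_le h1 hy).trans_eq (by rw [hβ]; ring)
  have b1 := i1 B.a₁_le B.r_le B.r_le
  have b2 := fun j => i1 B.a₂_le (B.v_le j) (B.v_le j)
  have b3 := i1 B.a₃_le B.θ_le B.θ_le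
  have b4 := fun j => i2 B.circ_le B.r_le (B.v_le j) j
  have b5 := fun j => i2 (B.wtu_le.trans (by gcongr)) B.θ_le (B.v_le j) j
  have b6 := fun j => i2 (B.ur_le j) B.r_le B.r_le j
  have b7 := fun j k => i2 (B.uu_le j) (B.v_le k) (B.v_le k) j
  have b8 := fun j => i2 (B.uθ_le j) B.θ_le B.θ_le j
  have b9 : ∀ j, |⟪v j, op (circ ρ Θ) (G j)⟫_ℝ| ≤ β := fun j => by
    rw [← inner_op]
    exact i3 (B.v_le j) (B.op_le _) (B.G_le j)
  have b10 := i3 B.r_le (B.opρ_le _) B.Fr_le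
  have b11 := fun j => i3 (B.v_le j) (B.opu_le _) (B.Fv_le j)
  have b12 := i3 B.θ_le (B.opΘ_le _) B.Fθ_le
  have b13 : ∀ j, |⟪e j, Fe j⟫_ℝ| ≤ β := fun j => by
    refine (abs_inner_le_of_le (B.e_le j) (B.Fe_le j)).trans ?_
    rw [hβ]
    have : 0 ≤ (c * (c - 1)) * (M * K ^ 2) := by
      have : 0 ≤ c - 1 := by linarith
      positivity
    nlinarith
  have b14 := fun j => i4 B.wtu_le (B.v_le j) ((B.v_le j).trans hKM)
  have b15 := fun j => i4 B.wtu_le (B.v_le j) (B.e_le j)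
  have b16 := i4 B.wtΘ_le B.θ_le (B.θ_le.trans hKM)
  have s7 : ∀ j, ∑ k, ⟪opM (pdW j le_rfl (u j + mulT (wtu ρ Θ) (u j))) (v k), v k⟫_ℝ ≤ 3 * β :=
    fun j => sum_fin_le fun k => (abs_le.1 (b7 j k)).2
  have s6 := sum_fin_le (f := fun j =>
      ⟪opM (pdW j le_rfl (u j + mulT (wtρ Θ) (u j))) r, r⟫_ℝ
      + ∑ k, ⟪opM (pdW j le_rfl (u j + mulT (wtu ρ Θ) (u j))) (v k), v k⟫_ℝ
      + 3 / 2 * ⟪opM (pdW j le_rfl (u j + mulT (wtΘ ρ) (u j))) θ, θ⟫_ℝ) (a := 6 * β)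
    fun j => by linarith [(abs_le.1 (b6 j)).2, s7 j, (abs_le.1 (b8 j)).2]
  have s9 := sum_fin_le (f := fun j => -⟪v j, op (circ ρ Θ) (G j)⟫_ℝ) (a := β)
    fun j => by linarith [(abs_le.1 (b9 j)).1]
  have s14 := sum_fin_le (f := fun j => -⟪opT (wtu ρ Θ) (v j), v j⟫_ℝ) (a := β)
    fun j => by linarith [(abs_le.1 (b14 j)).1]
  have s15 := sum_fin_le (f := fun j => -⟪opT (wtu ρ Θ) (v j), e j⟫_ℝ) (a := β)
    fun j => by linarith [(abs_le.1 (b15 j)).1]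
  simp only [Finset.sum_neg_distrib] at s9 s14 s15
  have t1 : ∑ j, ⟪op (wtu ρ Θ) (v j), v j⟫_ℝ
      = ∑ j, ‖v j‖ ^ 2 + ∑ j, ⟪opT (wtu ρ Θ) (v j), v j⟫_ℝ := by
    simp only [op_apply, inner_add_left, real_inner_self_eq_norm_sq, Finset.sum_add_distrib]
  have t2 : ⟪op (wtΘ ρ) θ, θ⟫_ℝ = ‖θ‖ ^ 2 + ⟪opT (wtΘ ρ) θ, θ⟫_ℝ := by
    simp only [op_apply, inner_add_left, real_inner_self_eq_norm_sq]
  rw [topRate, t1, t2, mul_assoc, ← hβ]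
  linarith [(abs_le.1 b1).2, sum_fin_le fun j => (abs_le.1 (b2 j)).2, (abs_le.1 b3).2,
    sum_fin_le fun j => (abs_le.1 (b4 j)).2, sum_fin_le fun j => (abs_le.1 (b5 j)).2,
    (abs_le.1 b10).2, sum_fin_le fun j => (abs_le.1 (b11 j)).2, (abs_le.1 b12).2,
    sum_fin_le fun j => (abs_le.1 (b13 j)).2, (abs_le.1 b16).1]

theorem continuousOn_topRate {X : Type*} [TopologicalSpace X] {s : Set X} {ρ Θ : X → W (m + 1)}
    {u : X → Fin 3 → W (m + 1)} {a₁ a₂ a₃ : X → W m} {r θ : X → L2} {v e : X → Fin 3 → L2}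
    {Fr Fθ : X → L2} {G Fv Fe : X → Fin 3 → L2} (hρ : ContinuousOn ρ s) (hΘ : ContinuousOn Θ s)
    (hu : ∀ j, ContinuousOn (fun x => u x j) s) (h₁ : ContinuousOn a₁ s) (h₂ : ContinuousOn a₂ s)
    (h₃ : ContinuousOn a₃ s) (hr : ContinuousOn r s) (hθ : ContinuousOn θ s)
    (hv : ∀ j, ContinuousOn (fun x => v x j) s) (he : ∀ j, ContinuousOn (fun x => e x j) s)
    (hFr : ContinuousOn Fr s) (hFθ : ContinuousOn Fθ s) (hG : ∀ j, ContinuousOn (fun x => G x j) s)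
    (hFv : ∀ j, ContinuousOn (fun x => Fv x j) s) (hFe : ∀ j, ContinuousOn (fun x => Fe x j) s) :
    ContinuousOn (fun x => topRate (ρ x) (Θ x) (u x) (a₁ x) (a₂ x) (a₃ x) (r x) (θ x) (v x) (e x)
      (Fr x) (Fθ x) (G x) (Fv x) (Fe x)) s := by
  simp only [topRate, wtρ, wtΘ, wtu, circ, op_apply, opT_apply]
  fun_prop

end Top

/-! ### The nonlinear system in coordinates -/

section System
variable {m : ℕ}

/-- The `j`-th component of the curl. -/
def curlW (f : Fin 3 → W (m + 1)) (j : Fin 3) : W m :=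
  pdW (j + 1) le_rfl (f (j + 2)) - pdW (j + 2) le_rfl (f (j + 1))

/-- The sizes of the components of a state. -/
structure Size (K M : ℝ) (ρ Θ : W (m + 1)) (u E B : Fin 3 → W (m + 1)) : Prop where
  K_le : K ≤ M
  ρ_le : ‖ρ‖ ≤ K
  Θ_le : ‖Θ‖ ≤ K
  u_le : ∀ j, ‖u j‖ ≤ K
  E_le : ∀ j, ‖E j‖ ≤ M
  B_le : ∀ j, ‖B j‖ ≤ M

theorem norm_pdW_le_of_le {f : W (m + 1)} {a : ℝ} (hf : ‖f‖ ≤ a) (j : Fin 3) :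
    ‖pdW j (le_refl (m + 1)) f‖ ≤ a := (norm_pdW_le j le_rfl f).trans hf

theorem norm_inclW_le_of_le {f : W (m + 1)} {a : ℝ} (hf : ‖f‖ ≤ a) :
    ‖inclW (Nat.le_succ m) f‖ ≤ a := (norm_inclW_le _ f).trans hf

theorem Size.K_nonneg {K M : ℝ} {ρ Θ : W (m + 1)} {u E B : Fin 3 → W (m + 1)}
    (S : Size K M ρ Θ u E B) : 0 ≤ K := (norm_nonneg _).trans S.ρ_le

theorem Size.M_nonneg {K M : ℝ} {ρ Θ : W (m + 1)} {u E B : Fin 3 → W (m + 1)}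
    (S : Size K M ρ Θ u E B) : 0 ≤ M := S.K_nonneg.trans S.K_le

theorem order_shift {α : MultiIndex} (hα : α.order ≤ m) : 1 + α.order ≤ m + 1 := by omega

theorem fnW_shiftW' {α : MultiIndex} (h : 1 + α.order ≤ m + 1) (f : W (m + 1)) :
    fnW (shiftW α h f) = dW α (inclW (Nat.le_succ m) f) := by
  rw [fnW_shiftW, dW_inclW _ (by omega)]

theorem dW_unit_shiftW {α : MultiIndex} (h : 1 + α.order ≤ m + 1) (f : W (m + 1)) (j : Fin 3) :
    dW (unitIndex j) (shiftW α h f) = dW α (pdW j (le_refl (m + 1)) f) := by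
  have e : unitIndex j + α = α + unitIndex j := add_comm _ _
  rw [dW_shiftW _ (by rw [order_unitIndex]), dW_pdW _ _ (by omega), e]

theorem curl1_shiftW {α : MultiIndex} (h : 1 + α.order ≤ m + 1) (f : Fin 3 → W (m + 1))
    (j : Fin 3) : curl1 (fun k => shiftW α h (f k)) j = dW α (curlW f j) := by
  rw [curl1, curlW, map_sub, dW_unit_shiftW, dW_unit_shiftW]

variable [hm : Fact (3 ≤ m)]

/-- The `j`-th component of the cross product. -/
def crossW (f g : Fin 3 → W (m + 1)) (j : Fin 3) : W (m + 1) :=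
  mulT (f (j + 1)) (g (j + 2)) - mulT (f (j + 2)) (g (j + 1))

/-- The Euler–Maxwell system at a fixed time, in coordinates; primes denote time derivatives and
`P` is the vector `(1 + Θ) / (1 + ρ) ∇ρ`. -/
structure Eqs (ρ Θ : W (m + 1)) (u E B : Fin 3 → W (m + 1)) (P : Fin 3 → W m) (ρ' Θ' : W m)
    (u' E' B' : Fin 3 → W m) : Prop where
  mass : ρ' = -∑ j, (pdW j le_rfl (u j) + mulM ρ (pdW j le_rfl (u j))
    + mulM (u j) (pdW j le_rfl ρ))
  momentum : ∀ j, u' j = -pdW j le_rfl Θ - P j - ∑ k, mulM (u k) (pdW k le_rfl (u j))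
    - inclW (Nat.le_succ m) (E j) - inclW (Nat.le_succ m) (u j)
    - inclW (Nat.le_succ m) (crossW u B j)
  pressure : ∀ j, P j + mulM ρ (P j) = pdW j le_rfl ρ + mulM Θ (pdW j le_rfl ρ)
  temperature : Θ' = -∑ j, ((2 / 3 : ℝ) • (pdW j le_rfl (u j) + mulM Θ (pdW j le_rfl (u j)))
      + mulM (u j) (pdW j le_rfl Θ)) - inclW (Nat.le_succ m) Θ
    + inclW (Nat.le_succ m) ((1 / 3 : ℝ) • ∑ j, mulT (u j) (u j))
  ampere : ∀ j, E' j = curlW B j + inclW (Nat.le_succ m) (u j)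
    + inclW (Nat.le_succ m) (mulT ρ (u j))
  faraday : ∀ j, B' j = -curlW E j
  gaussE : ∑ j, pdW j le_rfl (E j) = -inclW (Nat.le_succ m) ρ
  gaussB : ∑ j, pdW j le_rfl (B j) = 0

/-! ### Product bounds and the nonlinear terms of the system. -/

variable (m) in
/-- A constant for the product estimates. -/
def mulConst : ℝ :=
  1 + ‖(mulT : W (m + 1) →L[ℝ] _)‖ + ‖(mulM : W (m + 1) →L[ℝ] W m →L[ℝ] _)‖
    + ‖(mulMM : W m →L[ℝ] _)‖ + embConst

theorem one_le_mulConst : 1 ≤ mulConst m := by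
  have h1 := (mulT : W (m + 1) →L[ℝ] _).opNorm_nonneg
  have h2 := (mulM : W (m + 1) →L[ℝ] W m →L[ℝ] _).opNorm_nonneg
  have h3 := (mulMM : W m →L[ℝ] _).opNorm_nonneg
  have h4 := embConst_nonneg
  rw [mulConst]
  linarith

theorem norm_mulT_le (f g : W (m + 1)) : ‖mulT f g‖ ≤ mulConst m * ‖f‖ * ‖g‖ := by
  have h2 := (mulM : W (m + 1) →L[ℝ] W m →L[ℝ] _).opNorm_nonneg
  have h3 := (mulMM : W m →L[ℝ] _).opNorm_nonneg
  have h4 := embConst_nonneg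
  refine ((mulT : W (m + 1) →L[ℝ] _).le_opNorm₂ f g).trans ?_
  gcongr
  rw [mulConst]
  linarith

theorem norm_mulM_le (f : W (m + 1)) (g : W m) : ‖mulM f g‖ ≤ mulConst m * ‖f‖ * ‖g‖ := by
  have h1 := (mulT : W (m + 1) →L[ℝ] _).opNorm_nonneg
  have h3 := (mulMM : W m →L[ℝ] _).opNorm_nonneg
  have h4 := embConst_nonneg
  refine ((mulM : W (m + 1) →L[ℝ] W m →L[ℝ] _).le_opNorm₂ f g).trans ?_
  gcongr
  rw [mulConst]
  linarith

theorem norm_mulMM_le (f g : W m) : ‖mulMM f g‖ ≤ mulConst m * ‖f‖ * ‖g‖ := by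
  have h1 := (mulT : W (m + 1) →L[ℝ] _).opNorm_nonneg
  have h2 := (mulM : W (m + 1) →L[ℝ] W m →L[ℝ] _).opNorm_nonneg
  have h4 := embConst_nonneg
  refine ((mulMM : W m →L[ℝ] _).le_opNorm₂ f g).trans ?_
  gcongr
  rw [mulConst]
  linarith

theorem embConst_le_mulConst : embConst ≤ mulConst m := by
  have h1 := (mulT : W (m + 1) →L[ℝ] _).opNorm_nonneg
  have h2 := (mulM : W (m + 1) →L[ℝ] W m →L[ℝ] _).opNorm_nonneg
  have h3 := (mulMM : W m →L[ℝ] _).opNorm_nonneg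
  rw [mulConst]
  linarith

theorem norm_opM_le' (g : W m) (x : L2) : ‖opM g x‖ ≤ mulConst m * ‖g‖ * ‖x‖ := by
  refine (norm_opM_le g x).trans ?_
  gcongr
  exact embConst_le_mulConst

theorem norm_mulT_le_of_le {f g : W (m + 1)} {a b : ℝ} (hf : ‖f‖ ≤ a) (hg : ‖g‖ ≤ b) :
    ‖mulT f g‖ ≤ mulConst m * a * b := by
  have := one_le_mulConst (m := m)
  have ha := (norm_nonneg _).trans hf
  exact (norm_mulT_le f g).trans (by gcongr)

theorem norm_mulM_le_of_le {f : W (m + 1)} {g : W m} {a b : ℝ} (hf : ‖f‖ ≤ a) (hg : ‖g‖ ≤ b) :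
    ‖mulM f g‖ ≤ mulConst m * a * b := by
  have := one_le_mulConst (m := m)
  have ha := (norm_nonneg _).trans hf
  exact (norm_mulM_le f g).trans (by gcongr)

theorem norm_mulMM_le_of_le {f : W m} {g : W m} {a b : ℝ} (hf : ‖f‖ ≤ a) (hg : ‖g‖ ≤ b) :
    ‖mulMM f g‖ ≤ mulConst m * a * b := by
  have := one_le_mulConst (m := m)
  have ha := (norm_nonneg _).trans hf
  exact (norm_mulMM_le f g).trans (by gcongr)

theorem norm_sum_le_of_le_fin {E : Type*} [SeminormedAddCommGroup E] {x : Fin 3 → E} {a : ℝ}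
    (h : ∀ j, ‖x j‖ ≤ a) : ‖∑ j, x j‖ ≤ 3 * a :=
  (norm_sum_le _ _).trans (sum_fin_le h)

section
variable {ρ Θ : W (m + 1)} {u E B : Fin 3 → W (m + 1)} {P : Fin 3 → W m} {ρ' Θ' : W m}
  {u' E' B' : Fin 3 → W m} {K M : ℝ}

/-- Solve `P = ∇ρ + Θ∇ρ - ρP` for the norm of `P`; smallness lets the last term be absorbed, which
gives `‖P‖ ≤ K + K/2 + ‖P‖/2`. -/
theorem Eqs.norm_P_le (H : Eqs ρ Θ u E B P ρ' Θ' u' E' B') (S : Size K M ρ Θ u E B)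
    (hc : mulConst m * M ≤ 1 / 2) (j : Fin 3) : ‖P j‖ ≤ 3 * K := by
  have h := H.pressure j
  have h1 : P j = pdW j le_rfl ρ + mulM Θ (pdW j le_rfl ρ) - mulM ρ (P j) := by
    rw [← h]; abel
  have h2 : ‖P j‖ ≤ K + mulConst m * M * K + mulConst m * M * ‖P j‖ := by
    conv_lhs => rw [h1]
    refine (norm_sub_le _ _).trans (add_le_add ((norm_add_le _ _).trans
      (add_le_add (norm_pdW_le_of_le S.ρ_le j) ?_)) ?_)
    · exact norm_mulM_le_of_le (S.Θ_le.trans S.K_le) (norm_pdW_le_of_le S.ρ_le j)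
    · exact norm_mulM_le_of_le (S.ρ_le.trans S.K_le) le_rfl
  have h3 : mulConst m * M * ‖P j‖ ≤ 1 / 2 * ‖P j‖ := by gcongr
  have h4 : mulConst m * M * K ≤ 1 / 2 * K := by
    have := S.K_nonneg
    gcongr
  linarith

/-- Nonlinear terms of the mass equation. -/
def fρ (ρ : W (m + 1)) (u : Fin 3 → W (m + 1)) : W m :=
  -∑ j, (mulM ρ (pdW j le_rfl (u j)) + mulM (u j) (pdW j le_rfl ρ))

/-- Nonlinear terms of the momentum equation. -/
def fu (ρ : W (m + 1)) (u B : Fin 3 → W (m + 1)) (P : Fin 3 → W m) (j : Fin 3) : W m :=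
  (pdW j le_rfl ρ - P j) - ∑ k, mulM (u k) (pdW k le_rfl (u j))
    - inclW (Nat.le_succ m) (crossW u B j)

/-- Nonlinear terms of the temperature equation. -/
def fΘ (Θ : W (m + 1)) (u : Fin 3 → W (m + 1)) : W m :=
  -∑ j, ((2 / 3 : ℝ) • mulM Θ (pdW j le_rfl (u j)) + mulM (u j) (pdW j le_rfl Θ))
    + inclW (Nat.le_succ m) ((1 / 3 : ℝ) • ∑ j, mulT (u j) (u j))

theorem Size.norm_crossW_le (S : Size K M ρ Θ u E B) (j : Fin 3) :
    ‖crossW u B j‖ ≤ 2 * (mulConst m * (M * K)) := by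
  refine (norm_sub_le _ _).trans ?_
  have h1 := norm_mulT_le_of_le (S.u_le (j + 1)) (S.B_le (j + 2))
  have h2 := norm_mulT_le_of_le (S.u_le (j + 2)) (S.B_le (j + 1))
  linarith

theorem Size.norm_sq_le (S : Size K M ρ Θ u E B) :
    ‖(1 / 3 : ℝ) • ∑ j, mulT (u j) (u j)‖ ≤ mulConst m * (M * K) := by
  rw [norm_smul]
  have h := norm_sum_le_of_le_fin fun j =>
    norm_mulT_le_of_le ((S.u_le j).trans S.K_le) (S.u_le j)
  rw [Real.norm_of_nonneg (by norm_num)]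
  linarith

theorem Size.norm_fρ_le (S : Size K M ρ Θ u E B) : ‖fρ ρ u‖ ≤ 9 * (mulConst m * (M * K)) := by
  have := mul_nonneg (zero_le_one.trans (one_le_mulConst (m := m)))
    (mul_nonneg S.M_nonneg S.K_nonneg)
  rw [fρ, norm_neg]
  refine (norm_sum_le_of_le_fin (a := 2 * (mulConst m * (M * K))) fun j => ?_).trans (by linarith)
  refine (norm_add_le _ _).trans ?_
  have h1 := norm_mulM_le_of_le (S.ρ_le.trans S.K_le) (norm_pdW_le_of_le (S.u_le j) j)
  have h2 := norm_mulM_le_of_le ((S.u_le j).trans S.K_le) (norm_pdW_le_of_le S.ρ_le j)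
  linarith

theorem Size.norm_fΘ_le (S : Size K M ρ Θ u E B) : ‖fΘ Θ u‖ ≤ 9 * (mulConst m * (M * K)) := by
  have := mul_nonneg (zero_le_one.trans (one_le_mulConst (m := m)))
    (mul_nonneg S.M_nonneg S.K_nonneg)
  rw [fΘ]
  refine (norm_add_le _ _).trans ?_
  rw [norm_neg]
  have h3 := norm_sum_le_of_le_fin (a := 2 * (mulConst m * (M * K)))
    (x := fun j => (2 / 3 : ℝ) • mulM Θ (pdW j le_rfl (u j)) + mulM (u j) (pdW j le_rfl Θ))
    fun j => by
      refine (norm_add_le _ _).trans ?_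
      have h1 := norm_mulM_le_of_le (S.Θ_le.trans S.K_le) (norm_pdW_le_of_le (S.u_le j) j)
      have h2 := norm_mulM_le_of_le ((S.u_le j).trans S.K_le) (norm_pdW_le_of_le S.Θ_le j)
      rw [norm_smul, Real.norm_of_nonneg (by norm_num)]
      linarith
  have h4 := norm_inclW_le_of_le S.norm_sq_le
  linarith

/-- The pressure relation rewrites `∇ρ - P` as `ρP - Θ∇ρ`, which is quadratic. The count is `3 + 1`
for this, `3` for transport and `2` for the cross product; the resulting `9` is used as common
constant for all nonlinear terms. -/
theorem Eqs.norm_fu_le (H : Eqs ρ Θ u E B P ρ' Θ' u' E' B') (S : Size K M ρ Θ u E B)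
    (hc : mulConst m * M ≤ 1 / 2) (j : Fin 3) : ‖fu ρ u B P j‖ ≤ 9 * (mulConst m * (M * K)) := by
  have h0 : pdW j le_rfl ρ - P j = mulM ρ (P j) - mulM Θ (pdW j le_rfl ρ) := by
    rw [sub_eq_sub_iff_add_eq_add, ← H.pressure j, add_comm]
  rw [fu, h0]
  have h1 := norm_mulM_le_of_le (S.ρ_le.trans S.K_le) (H.norm_P_le S hc j)
  have h2 := norm_mulM_le_of_le (S.Θ_le.trans S.K_le) (norm_pdW_le_of_le S.ρ_le j)
  have h3 := norm_sum_le_of_le_fin fun k =>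
    norm_mulM_le_of_le ((S.u_le k).trans S.K_le) (norm_pdW_le_of_le (S.u_le j) k)
  have h4 := norm_inclW_le_of_le (S.norm_crossW_le j)
  have h5 := norm_sub_le (mulM ρ (P j)) (mulM Θ (pdW j le_rfl ρ))
  have h6 := norm_sub_le (mulM ρ (P j) - mulM Θ (pdW j le_rfl ρ))
    (∑ k, mulM (u k) (pdW k le_rfl (u j)))
  refine (norm_sub_le _ _).trans ?_
  linarith

theorem Size.norm_fE_le (S : Size K M ρ Θ u E B) (j : Fin 3) :
    ‖mulT ρ (u j)‖ ≤ 9 * (mulConst m * (M * K)) := by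
  have := mul_nonneg (zero_le_one.trans (one_le_mulConst (m := m)))
    (mul_nonneg S.M_nonneg S.K_nonneg)
  have h1 := norm_mulT_le_of_le (S.ρ_le.trans S.K_le) (S.u_le j)
  linarith

/-- Every derivative of order at most `m` solves the linearised system. -/
theorem Eqs.linSys (H : Eqs ρ Θ u E B P ρ' Θ' u' E' B') {α : MultiIndex} (hα : α.order ≤ m) :
    LinSys (shiftW α (order_shift hα) ρ) (shiftW α (order_shift hα) Θ)
      (fun j => shiftW α (order_shift hα) (u j)) (fun j => shiftW α (order_shift hα) (E j))
      (fun j => shiftW α (order_shift hα) (B j)) (dW α ρ') (dW α Θ') (fun j => dW α (u' j))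
      (fun j => dW α (E' j)) (fun j => dW α (B' j)) (dW α (fρ ρ u)) (dW α (fΘ Θ u))
      (fun j => dW α (fu ρ u B P j))
      (fun j => dW α (inclW (Nat.le_succ m) (mulT ρ (u j)))) where
  mass := by
    simp only [dW_unit_shiftW]
    rw [← map_sum, ← map_neg, ← map_add, H.mass, fρ]
    simp only [Finset.sum_add_distrib]
    congr 1
    abel
  momentum j := by
    simp only [dW_unit_shiftW, fnW_shiftW']
    rw [← map_neg, ← map_sub, ← map_sub, ← map_sub, ← map_add, H.momentum, fu]
    congr 1
    abel
  temperature := by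
    simp only [dW_unit_shiftW, fnW_shiftW']
    rw [← map_sum, ← map_smul, ← map_neg, ← map_sub, ← map_add, H.temperature, fΘ]
    simp only [Finset.sum_add_distrib, smul_add, Finset.smul_sum]
    congr 1
    abel
  ampere j := by
    rw [curl1_shiftW, fnW_shiftW', ← map_add, ← map_add, H.ampere]
  faraday j := by
    rw [curl1_shiftW, ← map_neg, H.faraday]
  gauss := by
    simp only [dW_unit_shiftW, fnW_shiftW']
    rw [← map_sum, ← map_neg, H.gaussE]

end
end System

/-! ### Difference quotients of the system -/

/-- The difference quotient on `L²` as a continuous linear map. -/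
def dqL (i : Fin 3) (h : ℝ) : L2 →L[ℝ] L2 :=
  h⁻¹ • ((trans (h • unitVec i)).toContinuousLinearMap - ContinuousLinearMap.id ℝ L2)

theorem dqL_apply (i : Fin 3) (h : ℝ) (f : L2) : dqL i h f = dq i h f := rfl

/-- The difference quotient on `H¹`. -/
def dqS (i : Fin 3) (h : ℝ) (f : W 1) : W 1 := h⁻¹ • (transW (h • unitVec i) f - f)

theorem fnW_dqS (i : Fin 3) (h : ℝ) (f : W 1) : fnW (dqS i h f) = dqL i h (fnW f) := by
  rw [dqS, map_smul, map_sub, fnW_transW]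
  rfl

theorem dW_dqS (i : Fin 3) (h : ℝ) (f : W 1) (j : Fin 3) :
    dW (unitIndex j) (dqS i h f) = dqL i h (dW (unitIndex j) f) := by
  rw [dqS, map_smul, map_sub, dW_transW _ (by rw [order_unitIndex])]
  rfl

section
variable {m : ℕ}

/-- The difference quotient of `∂^α f`. -/
def dqD (i : Fin 3) (α : MultiIndex) (h : ℝ) : W m →L[ℝ] L2 := (dqL i h).comp (dW α)

/-- The average of `∂ᵢ∂^α f` over segments of length `h`. -/
def avgD (i : Fin 3) (α : MultiIndex) (h : ℝ) : W (m + 1) →L[ℝ] L2 :=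
  (avg i h).comp (dW (unitIndex i + α))

variable {i : Fin 3} {α : MultiIndex} {h : ℝ}

theorem dqD_inclW (hα : α.order ≤ m) (hh : h ≠ 0) (f : W (m + 1)) :
    dqD i α h (inclW (Nat.le_succ m) f) = avgD i α h f := by
  rw [dqD, ContinuousLinearMap.comp_apply, dW_inclW _ hα, dqL_apply,
    (wd_dW f i (α := α) (by omega)).dq_eq hh]
  rfl

theorem avgD_zero (f : W (m + 1)) : avgD i α 0 f = dW (unitIndex i + α) f := by
  rw [avgD, ContinuousLinearMap.comp_apply, avg_zero]

theorem norm_avgD_le (f : W (m + 1)) : ‖avgD i α h f‖ ≤ ‖f‖ :=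
  (norm_avg_apply_le _ _ _).trans (norm_dW_le _ _)

theorem fnW_dqS_shiftW (hα : 1 + α.order ≤ m + 1) (f : W (m + 1)) :
    fnW (dqS i h (shiftW α hα f)) = dqD i α h (inclW (Nat.le_succ m) f) := by
  rw [fnW_dqS, fnW_shiftW']
  rfl

theorem dW_dqS_shiftW (hα : 1 + α.order ≤ m + 1) (f : W (m + 1)) (j : Fin 3) :
    dW (unitIndex j) (dqS i h (shiftW α hα f)) = dqD i α h (pdW j (le_refl (m + 1)) f) := by
  rw [dW_dqS, dW_unit_shiftW]
  rfl

theorem curl1_dqS_shiftW (hα : 1 + α.order ≤ m + 1) (f : Fin 3 → W (m + 1)) (j : Fin 3) :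
    curl1 (fun k => dqS i h (shiftW α hα (f k))) j = dqD i α h (curlW f j) := by
  rw [curl1, curlW, map_sub, dW_dqS_shiftW, dW_dqS_shiftW]

variable [hm : Fact (3 ≤ m)]

theorem exists_commutator_mulM (i : Fin 3) {α : MultiIndex} (hα : α.order ≤ m) :
    ∃ Q : ℝ → W (m + 1) → W m → L2, ∃ C : ℝ, 0 ≤ C ∧
      Continuous (fun p : ℝ × W (m + 1) × W m => Q p.1 p.2.1 p.2.2) ∧
      (∀ h f g, ‖Q h f g‖ ≤ C * ‖f‖ * ‖g‖) ∧
      ∀ h, h ≠ 0 → ∀ f g, dqD i α h (mulM f g) = opT f (dqD i α h g) + Q h f g := by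
  have h3 := hm.out
  obtain ⟨Q, C, hC, hQ, hb, he⟩ := exists_dq_commutator h3
    ⟨Nat.le_succ m, le_rfl, by omega⟩ (by omega) i α hα
  refine ⟨Q, C, hC, hQ, hb, fun h hh f g => ?_⟩
  have e1 : opT f = mulW (inclW (by omega) f) := by
    rw [opT_apply, opM, ContinuousLinearMap.comp_apply]
    congr 1
    exact ext_fnW (by rw [fnW_inclW, fnW_inclW, fnW_inclW])
  rw [e1]
  exact he h hh f g

/-- The top-order forcing term of the mass equation. -/
def qρ (Q : W (m + 1) → W m → L2) (ρ : W (m + 1)) (u : Fin 3 → W (m + 1)) : L2 :=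
  -∑ j, (Q ρ (pdW j le_rfl (u j)) + Q (u j) (pdW j le_rfl ρ))

/-- The top-order forcing term of the momentum equation. -/
def qu (Q : W (m + 1) → W m → L2) (A : W (m + 1) → L2) (u B : Fin 3 → W (m + 1)) (j : Fin 3) :
    L2 := -∑ k, Q (u k) (pdW k le_rfl (u j)) - A (crossW u B j)

/-- The top-order forcing term of the equation for the pressure. -/
def qP (Q : W (m + 1) → W m → L2) (ρ Θ : W (m + 1)) (P : Fin 3 → W m) (j : Fin 3) : L2 :=
  Q Θ (pdW j le_rfl ρ) - Q ρ (P j)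

/-- The top-order forcing term of the temperature equation. -/
def qΘ (Q : W (m + 1) → W m → L2) (A : W (m + 1) → L2) (Θ : W (m + 1))
    (u : Fin 3 → W (m + 1)) : L2 :=
  -∑ j, ((2 / 3 : ℝ) • Q Θ (pdW j le_rfl (u j)) + Q (u j) (pdW j le_rfl Θ))
    + A ((1 / 3 : ℝ) • ∑ j, mulT (u j) (u j))

variable {ρ Θ : W (m + 1)} {u E B : Fin 3 → W (m + 1)} {P : Fin 3 → W m} {ρ' Θ' : W m}
  {u' E' B' : Fin 3 → W m}

/-- The difference quotient of `∂^α` is a bounded operator from `H^m` to `L²`, so it may be applied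
to the equations as they stand. Each product leaves its coefficient outside, and the commutator
joins the forcing. -/
theorem Eqs.topSys (H : Eqs ρ Θ u E B P ρ' Θ' u' E' B') (hα : α.order ≤ m) (hh : h ≠ 0)
    {Q : W (m + 1) → W m → L2}
    (hQ : ∀ f g, dqD i α h (mulM f g) = opT f (dqD i α h g) + Q f g) :
    TopSys ρ Θ u (dqS i h (shiftW α (order_shift hα) ρ)) (dqS i h (shiftW α (order_shift hα) Θ))
      (fun j => dqS i h (shiftW α (order_shift hα) (u j)))
      (fun j => dqS i h (shiftW α (order_shift hα) (E j)))
      (fun j => dqS i h (shiftW α (order_shift hα) (B j)))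
      (fun j => dqD i α h (P j)) (dqD i α h ρ') (dqD i α h Θ') (fun j => dqD i α h (u' j))
      (fun j => dqD i α h (E' j)) (fun j => dqD i α h (B' j))
      (qρ Q ρ u) (qΘ Q (avgD i α h) Θ u) (qP Q ρ Θ P) (qu Q (avgD i α h) u B)
      (fun j => avgD i α h (mulT ρ (u j))) where
  mass := by
    simp only [dW_dqS_shiftW, H.mass, map_neg, map_sum, map_add, hQ, qρ, op_apply,
      Finset.sum_add_distrib]
    abel
  momentum j := by
    simp only [dW_dqS_shiftW, fnW_dqS_shiftW, H.momentum, map_neg, map_sum, map_sub, hQ,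
      qu, Finset.sum_add_distrib, dqD_inclW hα hh]
    abel
  pressure j := by
    have := congrArg (dqD i α h) (H.pressure j)
    simp only [map_add, hQ] at this
    simp only [dW_dqS_shiftW, op_apply, qP]
    linear_combination (norm := module) this
  temperature := by
    simp only [dW_dqS_shiftW, fnW_dqS_shiftW, H.temperature, map_neg, map_sum, map_add, map_sub,
      map_smul, hQ, qΘ, Finset.sum_add_distrib, dqD_inclW hα hh, smul_add, op_apply]
    abel
  ampere j := by
    simp only [curl1_dqS_shiftW, fnW_dqS_shiftW, H.ampere, map_add]
    rw [dqD_inclW hα hh (mulT ρ (u j))]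
  faraday j := by
    simp only [curl1_dqS_shiftW, H.faraday, map_neg]

/-! ### Bounds at top order -/

/-- The derivative of `circ f g`. -/
def dcirc (f g : W (m + 1)) (f' g' : W m) : W m :=
  f' + g' + (mulMM (inclW (Nat.le_succ m) f) g' + mulMM f' (inclW (Nat.le_succ m) g))

theorem RegPath.circ {I : Set ℝ} {f g : ℝ → W (m + 1)} {f' g' : ℝ → W m} (hf : RegPath I f f')
    (hg : RegPath I g g') : RegPath I (fun t => EulerMaxwell.circ (f t) (g t))
      (fun t => dcirc (f t) (g t) (f' t) (g' t)) :=
  (hf.add hg).add (hf.mul hg)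

theorem norm_circ_le {f g : W (m + 1)} {a b M : ℝ} (hf : ‖f‖ ≤ a) (hg : ‖g‖ ≤ b) (hbM : b ≤ M)
    (hc : mulConst m * M ≤ 1 / 2) : ‖circ f g‖ ≤ a + b + 1 / 2 * a := by
  have h1 := norm_mulT_le_of_le hf (hg.trans hbM)
  have ha := (norm_nonneg _).trans hf
  have h2 : mulConst m * a * M ≤ 1 / 2 * a := by
    calc mulConst m * a * M = mulConst m * M * a := by ring
      _ ≤ 1 / 2 * a := by gcongr
  exact (norm_add_le _ _).trans (add_le_add ((norm_add_le _ _).trans (add_le_add hf hg))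
    (h1.trans h2))

theorem norm_dcirc_le {f g : W (m + 1)} {f' g' : W m} {a b a' b' M : ℝ} (hf : ‖f‖ ≤ a)
    (hg : ‖g‖ ≤ b) (hf' : ‖f'‖ ≤ a') (hg' : ‖g'‖ ≤ b') (haM : a ≤ 4 * M) (hbM : b ≤ M)
    (hc : mulConst m * M ≤ 1 / 2) : ‖dcirc f g f' g'‖ ≤ 2 * a' + 3 * b' := by
  have h1 := norm_mulMM_le_of_le (norm_inclW_le_of_le (hf.trans haM)) hg'
  have h2 := norm_mulMM_le_of_le hf' (norm_inclW_le_of_le (hg.trans hbM))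
  have ha := (norm_nonneg _).trans hf'
  have hb := (norm_nonneg _).trans hg'
  have h3 : mulConst m * (4 * M) * b' ≤ 2 * b' := by
    calc mulConst m * (4 * M) * b' = 4 * (mulConst m * M) * b' := by ring
      _ ≤ 4 * (1 / 2) * b' := by gcongr
      _ = 2 * b' := by ring
  have h4 : mulConst m * a' * M ≤ 1 / 2 * a' := by
    calc mulConst m * a' * M = mulConst m * M * a' := by ring
      _ ≤ 1 / 2 * a' := by gcongr
  rw [dcirc]
  have := norm_add_le (f' + g') (mulMM (inclW (Nat.le_succ m) f) g'
    + mulMM f' (inclW (Nat.le_succ m) g))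
  have := norm_add_le (mulMM (inclW (Nat.le_succ m) f) g') (mulMM f' (inclW (Nat.le_succ m) g))
  have := norm_add_le f' g'
  linarith

theorem norm_op_le {g : W (m + 1)} {M : ℝ} (hg : ‖g‖ ≤ 6 * M) (hc : mulConst m * M ≤ 1 / 2)
    (x : L2) : ‖op g x‖ ≤ 4 * ‖x‖ := by
  have h1 : ‖opT g x‖ ≤ mulConst m * (6 * M) * ‖x‖ := by
    refine (norm_opM_le' _ _).trans ?_
    have := one_le_mulConst (m := m)
    gcongr
    exact norm_inclW_le_of_le hg
  have h2 : mulConst m * (6 * M) * ‖x‖ ≤ 3 * ‖x‖ := by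
    calc mulConst m * (6 * M) * ‖x‖ = 6 * (mulConst m * M) * ‖x‖ := by ring
      _ ≤ 6 * (1 / 2) * ‖x‖ := by gcongr
      _ = 3 * ‖x‖ := by ring
  rw [op_apply]
  linarith [norm_add_le x (opT g x)]

section
variable {K M : ℝ}

/-- A bound linear in `M` is enough: the time derivatives of `ρ` and `Θ` enter the highest-order
estimate only through those of the weights, where they multiply two factors of size `K`. -/
theorem Eqs.norm_mass_le (H : Eqs ρ Θ u E B P ρ' Θ' u' E' B') (S : Size K M ρ Θ u E B)
    (hc : mulConst m * M ≤ 1 / 2) : ‖ρ'‖ ≤ 6 * M := by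
  have hM := S.M_nonneg
  have hM2 : mulConst m * M * M ≤ 1 / 2 * M := by gcongr
  rw [H.mass, norm_neg]
  refine (norm_sum_le_of_le_fin (a := 2 * M) fun j => ?_).trans (by linarith)
  have h1 := norm_pdW_le_of_le ((S.u_le j).trans S.K_le) j
  have h2 := norm_pdW_le_of_le (S.ρ_le.trans S.K_le) j
  have h3 := norm_mulM_le_of_le (S.ρ_le.trans S.K_le) h1
  have h4 := norm_mulM_le_of_le ((S.u_le j).trans S.K_le) h2
  refine (norm_add_le _ _).trans ?_
  linarith [norm_add_le (pdW j le_rfl (u j)) (mulM ρ (pdW j le_rfl (u j)))]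

theorem Eqs.norm_temperature_le (H : Eqs ρ Θ u E B P ρ' Θ' u' E' B') (S : Size K M ρ Θ u E B)
    (hc : mulConst m * M ≤ 1 / 2) : ‖Θ'‖ ≤ 6 * M := by
  have hM := S.M_nonneg
  have hM2 : mulConst m * M * M ≤ 1 / 2 * M := by gcongr
  have hKM : mulConst m * (M * K) ≤ 1 / 2 * M := by
    have := one_le_mulConst (m := m)
    refine le_trans ?_ hM2
    rw [mul_assoc]
    gcongr
    exact S.K_le
  rw [H.temperature]
  have h0 := norm_sum_le_of_le_fin (a := 3 / 2 * M) (x := fun j =>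
      (2 / 3 : ℝ) • (pdW j le_rfl (u j) + mulM Θ (pdW j le_rfl (u j)))
        + mulM (u j) (pdW j le_rfl Θ)) fun j => by
    have h1 := norm_pdW_le_of_le ((S.u_le j).trans S.K_le) j
    have h2 := norm_pdW_le_of_le (S.Θ_le.trans S.K_le) j
    have h3 := norm_mulM_le_of_le (S.Θ_le.trans S.K_le) h1
    have h4 := norm_mulM_le_of_le ((S.u_le j).trans S.K_le) h2
    refine (norm_add_le _ _).trans ?_
    rw [norm_smul, Real.norm_of_nonneg (by norm_num)]
    linarith [norm_add_le (pdW j le_rfl (u j)) (mulM Θ (pdW j le_rfl (u j)))]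
  have h1 := norm_inclW_le_of_le S.norm_sq_le
  have h2 := norm_inclW_le_of_le (S.Θ_le.trans S.K_le)
  refine (norm_add_le _ _).trans ?_
  refine (add_le_add_left (norm_sub_le _ _) _).trans ?_
  rw [norm_neg]
  linarith

theorem Eqs.topBd (H : Eqs ρ Θ u E B P ρ' Θ' u' E' B') (S : Size K M ρ Θ u E B)
    (hc : mulConst m * M ≤ 1 / 2) {C : ℝ} (hC : 0 ≤ C) {Q : W (m + 1) → W m → L2}
    (hQ : ∀ f g, ‖Q f g‖ ≤ C * ‖f‖ * ‖g‖) (i : Fin 3) (α : MultiIndex) (h : ℝ) :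
    TopBd (90 + 10 * (C + mulConst m)) K M ρ Θ u (dcirc Θ Θ Θ' Θ')
      (dcirc (circ ρ ρ) Θ (dcirc ρ ρ ρ' ρ') Θ') (dcirc ρ ρ ρ' ρ')
      (avgD i α h ρ) (avgD i α h Θ) (fun j => avgD i α h (u j)) (fun j => avgD i α h (E j))
      (qρ Q ρ u) (qΘ Q (avgD i α h) Θ u) (qP Q ρ Θ P) (qu Q (avgD i α h) u B)
      (fun j => avgD i α h (mulT ρ (u j))) := by
  have hM := S.M_nonneg
  have hK := S.K_nonneg
  have hKM := S.K_le
  have hm1 := one_le_mulConst (m := m)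
  -- The largest numerical coefficient is `78 = 2 · 30 + 3 · 6`, from the time derivative of the
  -- weight of `u`; `10` exceeds the number of commutators and products in any forcing term.
  set c := 90 + 10 * (C + mulConst m) with hcdef
  have hcM : ∀ {a : ℝ}, a ≤ 90 → a * M ≤ c * M := fun {a} ha => by
    gcongr
    linarith
  have hcK : ∀ {a : ℝ}, a ≤ 90 → a * K ≤ c * K := fun {a} ha => by
    gcongr
    linarith
  have hw1 : ‖wtρ Θ‖ ≤ 3 * K := by
    have := norm_circ_le S.Θ_le S.Θ_le hKM hc
    rw [wtρ]
    linarith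
  have hw3 : ‖wtΘ ρ‖ ≤ 3 * K := by
    have := norm_circ_le S.ρ_le S.ρ_le hKM hc
    rw [wtΘ]
    linarith
  have hw2 : ‖wtu ρ Θ‖ ≤ 6 * K := by
    have := norm_circ_le hw3 S.Θ_le hKM hc
    rw [wtu, ← wtΘ]
    linarith
  have hw4 : ‖circ ρ (wtρ Θ)‖ ≤ 6 * K := by
    have := norm_circ_le hw1 S.ρ_le hKM hc
    rw [circ_comm]
    linarith
  have hw5 : ‖circ ρ Θ‖ ≤ 3 * K := by
    have := norm_circ_le S.ρ_le S.Θ_le hKM hc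
    linarith
  have hop : ∀ {g : W (m + 1)}, ‖g‖ ≤ 6 * K → ∀ x, ‖op g x‖ ≤ c * ‖x‖ := fun {g} hg x => by
    refine (norm_op_le (hg.trans (by linarith)) hc x).trans ?_
    gcongr
    linarith
  have hu : ∀ {g : W (m + 1)}, ‖g‖ ≤ 6 * K → ∀ j, ‖u j + mulT g (u j)‖ ≤ c * M := by
    intro g hg j
    have h1 := norm_mulT_le_of_le (hg.trans (by linarith : 6 * K ≤ 6 * M))
      ((S.u_le j).trans S.K_le)
    have h2 : mulConst m * (6 * M) * M ≤ 3 * M := by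
      calc mulConst m * (6 * M) * M = 6 * (mulConst m * M) * M := by ring
        _ ≤ 6 * (1 / 2) * M := by gcongr
        _ = 3 * M := by ring
    refine le_trans ?_ (hcM (a := 4) (by norm_num))
    linarith [norm_add_le (u j) (mulT g (u j)), S.u_le j]
  have hρ' := H.norm_mass_le S hc
  have hΘ' := H.norm_temperature_le S hc
  have ha1 := norm_dcirc_le S.Θ_le S.Θ_le hΘ' hΘ' (by linarith) hKM hc
  have ha3 := norm_dcirc_le S.ρ_le S.ρ_le hρ' hρ' (by linarith) hKM hc
  rw [← wtΘ]
  have ha2 := norm_dcirc_le hw3 S.Θ_le ha3 hΘ' (by linarith) hKM hc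
  have hP := H.norm_P_le S hc
  have hMK : 0 ≤ M * K := mul_nonneg hM hK
  have hmMK : 0 ≤ mulConst m * (M * K) := mul_nonneg (by linarith) hMK
  have hCMK : 0 ≤ C * (M * K) := mul_nonneg hC hMK
  have hcMK : c * (M * K) = 90 * (M * K) + 10 * (C * (M * K)) + 10 * (mulConst m * (M * K)) := by
    rw [hcdef]; ring
  have q : ∀ {f : W (m + 1)} {g : W m} {a : ℝ}, ‖f‖ ≤ K → ‖g‖ ≤ a * K →
      ‖Q f g‖ ≤ a * (C * (M * K)) := fun {f g a} hf hg => by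
    refine (hQ f g).trans ?_
    calc C * ‖f‖ * ‖g‖ ≤ C * M * (a * K) := by
          gcongr
          exact hf.trans hKM
      _ = a * (C * (M * K)) := by ring
  have hpd : ∀ {f : W (m + 1)}, ‖f‖ ≤ K → ∀ j, ‖pdW j (le_refl (m + 1)) f‖ ≤ 1 * K :=
    fun {f} hf j => (norm_pdW_le_of_le hf j).trans_eq (one_mul K).symm
  refine
  { opM_le := fun g x => ?_
    opρ_le := hop (hw1.trans (by linarith))
    opΘ_le := hop (hw3.trans (by linarith))
    opu_le := hop hw2
    op_le := hop (hw5.trans (by linarith))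
    circ_le := (hw4.trans (by linarith : 6 * K ≤ 6 * M)).trans (hcM (by norm_num))
    wtu_le := hw2.trans (hcK (by norm_num))
    wtΘ_le := hw3.trans (hcK (by norm_num))
    ur_le := hu (hw1.trans (by linarith))
    uu_le := hu hw2
    uθ_le := hu (hw3.trans (by linarith))
    a₁_le := (ha1.trans (by linarith : _ ≤ 30 * M)).trans (hcM (by norm_num))
    a₂_le := ?_
    a₃_le := (ha3.trans (by linarith : _ ≤ 30 * M)).trans (hcM (by norm_num))
    r_le := (norm_avgD_le _).trans S.ρ_le
    θ_le := (norm_avgD_le _).trans S.Θ_le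
    v_le := fun j => (norm_avgD_le _).trans (S.u_le j)
    e_le := fun j => (norm_avgD_le _).trans (S.E_le j)
    Fr_le := ?_
    Fθ_le := ?_
    G_le := fun j => ?_
    Fv_le := fun j => ?_
    Fe_le := fun j => (norm_avgD_le _).trans ?_ }
  · refine (norm_opM_le' g x).trans ?_
    gcongr
    linarith
  · exact (ha2.trans (by linarith : _ ≤ 78 * M)).trans (hcM (by norm_num))
  · rw [qρ, norm_neg, hcMK]
    refine (norm_sum_le_of_le_fin (a := 2 * (C * (M * K))) fun j => ?_).trans (by linarith)
    refine (norm_add_le _ _).trans ?_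
    linarith [q S.ρ_le (hpd (S.u_le j) j), q (S.u_le j) (hpd S.ρ_le j)]
  · rw [qΘ, hcMK]
    have h1 := norm_sum_le_of_le_fin (a := 2 * (C * (M * K))) (x := fun j =>
      (2 / 3 : ℝ) • Q Θ (pdW j le_rfl (u j)) + Q (u j) (pdW j le_rfl Θ)) fun j => by
        refine (norm_add_le _ _).trans ?_
        rw [norm_smul, Real.norm_of_nonneg (by norm_num)]
        linarith [q S.Θ_le (hpd (S.u_le j) j), q (S.u_le j) (hpd S.Θ_le j)]
    refine (norm_add_le _ _).trans ?_
    rw [norm_neg]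
    linarith [(norm_avgD_le (i := i) (α := α) (h := h) _).trans S.norm_sq_le]
  · rw [qP, hcMK]
    refine (norm_sub_le _ _).trans ?_
    linarith [q S.Θ_le (hpd S.ρ_le j), q S.ρ_le (hP j)]
  · rw [qu, hcMK]
    refine (norm_sub_le _ _).trans ?_
    rw [norm_neg]
    linarith [norm_sum_le_of_le_fin fun k => q (S.u_le k) (hpd (S.u_le j) k),
      (norm_avgD_le (i := i) (α := α) (h := h) _).trans (S.norm_crossW_le j)]
  · refine (norm_mulT_le_of_le S.ρ_le (S.u_le j)).trans ?_
    rw [mul_assoc]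
    gcongr
    linarith

end

end

/-! ### Time derivatives of the energies -/

section
variable {m : ℕ}

theorem continuous_avgD (i : Fin 3) (α : MultiIndex) :
    Continuous fun p : ℝ × W (m + 1) => avgD i α p.1 p.2 :=
  Continuous.avg_L2 i continuous_fst ((dW _).continuous.comp continuous_snd)

theorem continuousOn_avgD {I : Set ℝ} (i : Fin 3) (α : MultiIndex) {f : ℝ → W (m + 1)}
    (hf : ContinuousOn f I) :
    ContinuousOn (fun p : ℝ × ℝ => avgD i α p.1 (f p.2)) (univ ×ˢ I) :=
  Continuous.comp_continuousOn (g := fun p : ℝ × W (m + 1) => avgD i α p.1 p.2)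
    (f := fun p : ℝ × ℝ => (p.1, f p.2)) (continuous_avgD i α)
    (continuousOn_fst.prodMk (hf.comp continuousOn_snd fun _ hp => hp.2))

variable [hm : Fact (3 ≤ m)]

/-- A solution of the system in coordinates on the time interval `I`. -/
structure Flow (I : Set ℝ) (ρ Θ : ℝ → W (m + 1)) (u E B : ℝ → Fin 3 → W (m + 1))
    (P : ℝ → Fin 3 → W m) (ρ' Θ' : ℝ → W m) (u' E' B' : ℝ → Fin 3 → W m) : Prop where
  reg_ρ : RegPath I ρ ρ'
  reg_Θ : RegPath I Θ Θ'
  reg_u : ∀ j, RegPath I (fun t => u t j) (fun t => u' t j)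
  reg_E : ∀ j, RegPath I (fun t => E t j) (fun t => E' t j)
  reg_B : ∀ j, RegPath I (fun t => B t j) (fun t => B' t j)
  eqs : ∀ t ∈ I, Eqs (ρ t) (Θ t) (u t) (E t) (B t) (P t) (ρ' t) (Θ' t) (u' t) (E' t) (B' t)

/-- The weighted energy of a derivative `A`. -/
def topEnergy (A : W (m + 1) → L2) (ρ Θ : W (m + 1)) (u E B : Fin 3 → W (m + 1)) : ℝ :=
  ⟪op (wtρ Θ) (A ρ), A ρ⟫_ℝ + ∑ j, ⟪op (wtu ρ Θ) (A (u j)), A (u j)⟫_ℝ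
    + 3 / 2 * ⟪op (wtΘ ρ) (A Θ), A Θ⟫_ℝ + ∑ j, ⟪A (E j), A (E j)⟫_ℝ + ∑ j, ⟪A (B j), A (B j)⟫_ℝ

theorem hasDerivWithinAt_inner_op {I : Set ℝ} {g : ℝ → W (m + 1)} {g' : ℝ → W m}
    (hg : RegPath I g g') {x : ℝ → L2} {x' : L2} {t : ℝ} (ht : t ∈ I)
    (hx : HasDerivWithinAt x x' I t) :
    HasDerivWithinAt (fun τ => ⟪op (g τ) (x τ), x τ⟫_ℝ)
      (⟪opM (g' t) (x t), x t⟫_ℝ + 2 * ⟪op (g t) (x t), x'⟫_ℝ) I t := by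
  have h1 : HasDerivWithinAt (fun τ => op (g τ) (x τ))
      (x' + (opM (inclW (Nat.le_succ m) (g t)) x' + opM (g' t) (x t))) I t := by
    simp only [op_apply, opT_apply]
    exact hx.add (opM.hasDerivWithinAt_of_bilinear (hg.deriv t ht) hx)
  have h2 := h1.inner ℝ hx
  refine h2.congr_deriv ?_
  rw [← opT_apply, ← add_assoc, ← op_apply, inner_add_left, inner_op (g t) x',
    real_inner_comm _ x']
  ring

theorem hasDerivWithinAt_inner_self {I : Set ℝ} {x : ℝ → L2} {x' : L2} {t : ℝ}
    (hx : HasDerivWithinAt x x' I t) :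
    HasDerivWithinAt (fun τ => ⟪x τ, x τ⟫_ℝ) (2 * ⟪x t, x'⟫_ℝ) I t := by
  refine (hx.inner ℝ hx).congr_deriv ?_
  rw [real_inner_comm x' (x t)]
  ring

variable {I : Set ℝ} {ρ Θ : ℝ → W (m + 1)} {u E B : ℝ → Fin 3 → W (m + 1)}
  {P : ℝ → Fin 3 → W m} {ρ' Θ' : ℝ → W m} {u' E' B' : ℝ → Fin 3 → W m}

theorem continuousOn_of_momentum (hΘ : ContinuousOn Θ I)
    (hu : ∀ j, ContinuousOn (fun t => u t j) I) (hE : ∀ j, ContinuousOn (fun t => E t j) I)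
    (hB : ∀ j, ContinuousOn (fun t => B t j) I) (hu' : ∀ j, ContinuousOn (fun t => u' t j) I)
    (h : ∀ t ∈ I, ∀ j, u' t j = -pdW j le_rfl (Θ t) - P t j
      - ∑ k, mulM (u t k) (pdW k le_rfl (u t j)) - inclW (Nat.le_succ m) (E t j)
      - inclW (Nat.le_succ m) (u t j) - inclW (Nat.le_succ m) (crossW (u t) (B t) j))
    (j : Fin 3) : ContinuousOn (fun t => P t j) I := by
  have key : ContinuousOn (fun t => -pdW j le_rfl (Θ t)
      - ∑ k, mulM (u t k) (pdW k le_rfl (u t j)) - inclW (Nat.le_succ m) (E t j)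
      - inclW (Nat.le_succ m) (u t j) - inclW (Nat.le_succ m) (crossW (u t) (B t) j) - u' t j) I := by
    simp only [crossW]
    fun_prop
  refine key.congr fun t ht => ?_
  simp only [h t ht j]
  abel

/-- No regularity of `P` is assumed; it is read off from the momentum equation, all of whose other
terms are continuous in `H^m`. -/
theorem Flow.continuousOn_P (H : Flow I ρ Θ u E B P ρ' Θ' u' E' B') (j : Fin 3) :
    ContinuousOn (fun t => P t j) I :=
  continuousOn_of_momentum H.reg_Θ.cont (fun j => (H.reg_u j).cont) (fun j => (H.reg_E j).cont)
    (fun j => (H.reg_B j).cont) (fun j => (H.reg_u j).cont') (fun t ht => (H.eqs t ht).momentum) j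

/-- `topRate` along a solution, with commutator `Q` and derivative `A`. -/
def flowRate (Q : W (m + 1) → W m → L2) (A : W (m + 1) → L2) (ρ Θ : W (m + 1))
    (u E B : Fin 3 → W (m + 1)) (P : Fin 3 → W m) (ρ' Θ' : W m) : ℝ :=
  topRate ρ Θ u (dcirc Θ Θ Θ' Θ') (dcirc (circ ρ ρ) Θ (dcirc ρ ρ ρ' ρ') Θ') (dcirc ρ ρ ρ' ρ')
    (A ρ) (A Θ) (fun j => A (u j)) (fun j => A (E j)) (qρ Q ρ u) (qΘ Q A Θ u) (qP Q ρ Θ P)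
    (qu Q A u B) (fun j => A (mulT ρ (u j)))

theorem continuousOn_comp_snd {Y : Type*} [TopologicalSpace Y] {f : ℝ → Y}
    (hf : ContinuousOn f I) : ContinuousOn (fun p : ℝ × ℝ => f p.2) (univ ×ˢ I) :=
  hf.comp continuousOn_snd fun _ hp => hp.2

theorem Flow.continuousOn_flowRate (H : Flow I ρ Θ u E B P ρ' Θ' u' E' B') (i : Fin 3)
    (α : MultiIndex) {Q : ℝ → W (m + 1) → W m → L2}
    (hQ : Continuous fun p : ℝ × W (m + 1) × W m => Q p.1 p.2.1 p.2.2) :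
    ContinuousOn (fun p : ℝ × ℝ => flowRate (Q p.1) (avgD i α p.1) (ρ p.2) (Θ p.2) (u p.2)
      (E p.2) (B p.2) (P p.2) (ρ' p.2) (Θ' p.2)) (univ ×ˢ I) := by
  have cQ : ∀ {f : ℝ → W (m + 1)} {g : ℝ → W m}, ContinuousOn f I → ContinuousOn g I →
      ContinuousOn (fun p : ℝ × ℝ => Q p.1 (f p.2) (g p.2)) (univ ×ˢ I) :=
    fun {f g} hf hg => Continuous.comp_continuousOn
      (g := fun p : ℝ × W (m + 1) × W m => Q p.1 p.2.1 p.2.2)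
      (f := fun p : ℝ × ℝ => (p.1, f p.2, g p.2)) hQ
      (continuousOn_fst.prodMk ((continuousOn_comp_snd hf).prodMk (continuousOn_comp_snd hg)))
  have cρ := H.reg_ρ.cont
  have cΘ := H.reg_Θ.cont
  have cu := fun j => (H.reg_u j).cont
  have cE := fun j => (H.reg_E j).cont
  have cB := fun j => (H.reg_B j).cont
  have cpd : ∀ {f : ℝ → W (m + 1)}, ContinuousOn f I → ∀ j,
      ContinuousOn (fun t => pdW j (le_refl (m + 1)) (f t)) I :=
    fun hf j => (pdW j _).continuous.comp_continuousOn hf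
  have cmul : ∀ {f g : ℝ → W (m + 1)}, ContinuousOn f I → ContinuousOn g I →
      ContinuousOn (fun t => mulT (f t) (g t)) I :=
    fun hf hg => (mulT.continuous.comp_continuousOn hf).clm_apply hg
  have r3 := H.reg_ρ.circ H.reg_ρ
  have r2 := r3.circ H.reg_Θ
  have r1 := H.reg_Θ.circ H.reg_Θ
  have g1 : ContinuousOn (fun p : ℝ × ℝ => qρ (Q p.1) (ρ p.2) (u p.2)) (univ ×ˢ I) :=
    (continuousOn_finsetSum _ fun j _ =>
      (cQ cρ (cpd (cu j) j)).add (cQ (cu j) (cpd cρ j))).neg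
  have g2 : ContinuousOn (fun p : ℝ × ℝ => avgD i α p.1 ((1 / 3 : ℝ) • ∑ j,
      mulT (u p.2 j) (u p.2 j))) (univ ×ˢ I) :=
    continuousOn_avgD i α
      (f := fun t => (1 / 3 : ℝ) • ∑ j, mulT (u t j) (u t j))
      (ContinuousOn.const_smul (continuousOn_finsetSum _ fun j _ => cmul (cu j) (cu j))
        (1 / 3 : ℝ))
  have g3 : ContinuousOn (fun p : ℝ × ℝ => qΘ (Q p.1) (avgD i α p.1) (Θ p.2) (u p.2))
      (univ ×ˢ I) := by
    refine ContinuousOn.add (ContinuousOn.neg (continuousOn_finsetSum _ fun j _ => ?_)) g2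
    exact ((cQ cΘ (cpd (cu j) j)).const_smul (2 / 3 : ℝ)).add (cQ (cu j) (cpd cΘ j))
  have g4 : ∀ j, ContinuousOn (fun p : ℝ × ℝ => qP (Q p.1) (ρ p.2) (Θ p.2) (P p.2) j)
      (univ ×ˢ I) := fun j => (cQ cΘ (cpd cρ j)).sub (cQ cρ (H.continuousOn_P j))
  have g5 : ∀ j, ContinuousOn (fun p : ℝ × ℝ => avgD i α p.1 (crossW (u p.2) (B p.2) j))
      (univ ×ˢ I) := fun j =>
    continuousOn_avgD i α (f := fun t => crossW (u t) (B t) j)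
      ((cmul (cu _) (cB _)).sub (cmul (cu _) (cB _)))
  have g6 : ∀ j, ContinuousOn (fun p : ℝ × ℝ => qu (Q p.1) (avgD i α p.1) (u p.2) (B p.2) j)
      (univ ×ˢ I) := fun j =>
    ContinuousOn.sub (continuousOn_finsetSum _ fun k _ => cQ (cu k) (cpd (cu j) k)).neg (g5 j)
  exact continuousOn_topRate (continuousOn_comp_snd cρ) (continuousOn_comp_snd cΘ)
    (fun j => continuousOn_comp_snd (cu j)) (continuousOn_comp_snd r1.cont')
    (continuousOn_comp_snd r2.cont') (continuousOn_comp_snd r3.cont') (continuousOn_avgD i α cρ)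
    (continuousOn_avgD i α cΘ) (fun j => continuousOn_avgD i α (cu j))
    (fun j => continuousOn_avgD i α (cE j)) g1 g3 g4 g6
    (fun j => continuousOn_avgD i α (cmul cρ (cu j)))

theorem continuousOn_energy {X : Type*} [TopologicalSpace X] {s : Set X} {ρ Θ : X → W (m + 1)}
    {r θ : X → L2} {v e b : X → Fin 3 → L2} (hρ : ContinuousOn ρ s) (hΘ : ContinuousOn Θ s)
    (hr : ContinuousOn r s) (hθ : ContinuousOn θ s) (hv : ∀ j, ContinuousOn (fun x => v x j) s)
    (he : ∀ j, ContinuousOn (fun x => e x j) s) (hb : ∀ j, ContinuousOn (fun x => b x j) s) :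
    ContinuousOn (fun x => ⟪op (wtρ (Θ x)) (r x), r x⟫_ℝ
      + ∑ j, ⟪op (wtu (ρ x) (Θ x)) (v x j), v x j⟫_ℝ + 3 / 2 * ⟪op (wtΘ (ρ x)) (θ x), θ x⟫_ℝ
      + ∑ j, ⟪e x j, e x j⟫_ℝ + ∑ j, ⟪b x j, b x j⟫_ℝ) s := by
  simp only [wtρ, wtΘ, wtu, circ, op_apply, opT_apply]
  fun_prop

theorem Flow.continuousOn_topEnergy (H : Flow I ρ Θ u E B P ρ' Θ' u' E' B') (i : Fin 3)
    (α : MultiIndex) :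
    ContinuousOn (fun p : ℝ × ℝ => topEnergy (avgD i α p.1) (ρ p.2) (Θ p.2) (u p.2)
      (E p.2) (B p.2)) (univ ×ˢ I) := by
  have c1 := continuousOn_comp_snd H.reg_ρ.cont
  have c2 := continuousOn_comp_snd H.reg_Θ.cont
  have c3 := continuousOn_avgD i α H.reg_ρ.cont
  have c4 := continuousOn_avgD i α H.reg_Θ.cont
  have c5 := fun j => continuousOn_avgD i α (H.reg_u j).cont
  have c6 := fun j => continuousOn_avgD i α (H.reg_E j).cont
  have c7 := fun j => continuousOn_avgD i α (H.reg_B j).cont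
  exact continuousOn_energy c1 c2 c3 c4 c5 c6 c7

/-- For `h ≠ 0` the averaged derivative coincides with a difference quotient, an operator bounded on
`H^m`, where the solution is differentiable in time. The rate is then given by `TopSys.rate`. -/
theorem Flow.hasDerivWithinAt_topEnergy (H : Flow I ρ Θ u E B P ρ' Θ' u' E' B') (i : Fin 3)
    {α : MultiIndex} (hα : α.order ≤ m) {h : ℝ} (hh : h ≠ 0) {Q : W (m + 1) → W m → L2}
    (hQ : ∀ f g, dqD i α h (mulM f g) = opT f (dqD i α h g) + Q f g) {t : ℝ} (ht : t ∈ I) :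
    HasDerivWithinAt (fun τ => topEnergy (avgD i α h) (ρ τ) (Θ τ) (u τ) (E τ) (B τ))
      (flowRate Q (avgD i α h) (ρ t) (Θ t) (u t) (E t) (B t) (P t) (ρ' t) (Θ' t)) I t := by
  have r3 := H.reg_ρ.circ H.reg_ρ
  have r2 := r3.circ H.reg_Θ
  have r1 := H.reg_Θ.circ H.reg_Θ
  have dA : ∀ {f : ℝ → W (m + 1)} {f' : ℝ → W m}, RegPath I f f' →
      HasDerivWithinAt (fun τ => avgD i α h (f τ)) (dqD i α h (f' t)) I t :=
    fun {f f'} hf => by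
      have := (dqD i α h : W m →L[ℝ] L2).hasFDerivAt.comp_hasDerivWithinAt t (hf.deriv t ht)
      refine this.congr_of_mem (fun τ _ => ?_) ht
      exact (dqD_inclW hα hh (f τ)).symm
  have key := ((H.eqs t ht).topSys hα hh hQ).rate
    (dcirc (Θ t) (Θ t) (Θ' t) (Θ' t))
    (dcirc (circ (ρ t) (ρ t)) (Θ t) (dcirc (ρ t) (ρ t) (ρ' t) (ρ' t)) (Θ' t))
    (dcirc (ρ t) (ρ t) (ρ' t) (ρ' t))
  simp only [fnW_dqS_shiftW, dqD_inclW hα hh] at key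
  rw [flowRate, ← key]
  have s1 := hasDerivWithinAt_inner_op r1 ht (dA H.reg_ρ)
  have s2 := HasDerivWithinAt.fun_sum (u := Finset.univ) fun j _ =>
    hasDerivWithinAt_inner_op r2 ht (dA (H.reg_u j))
  have s3 := (hasDerivWithinAt_inner_op r3 ht (dA H.reg_Θ)).const_mul (3 / 2)
  have s4 := HasDerivWithinAt.fun_sum (u := Finset.univ) fun j _ =>
    hasDerivWithinAt_inner_self (dA (H.reg_E j))
  have s5 := HasDerivWithinAt.fun_sum (u := Finset.univ) fun j _ =>
    hasDerivWithinAt_inner_self (dA (H.reg_B j))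
  refine ((((s1.add s2).add s3).add s4).add s5).congr_deriv ?_
  simp only [wtρ, wtΘ, wtu, Finset.sum_add_distrib, ← Finset.mul_sum]
  ring

/-- The growth of the weighted energy of highest order. -/
theorem exists_topEnergy_deriv_le (i : Fin 3) {α : MultiIndex} (hα : α.order ≤ m) :
    ∃ C : ℝ, 0 ≤ C ∧ ∀ {T : ℝ} {ρ Θ : ℝ → W (m + 1)} {u E B : ℝ → Fin 3 → W (m + 1)}
      {P : ℝ → Fin 3 → W m} {ρ' Θ' : ℝ → W m} {u' E' B' : ℝ → Fin 3 → W m},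
      Flow (Ico 0 T) ρ Θ u E B P ρ' Θ' u' E' B' → ∀ {K M t : ℝ}, t ∈ Ico 0 T →
      Size K M (ρ t) (Θ t) (u t) (E t) (B t) → mulConst m * M ≤ 1 / 2 →
      ∃ d, HasDerivWithinAt (fun τ =>
          topEnergy (dW (unitIndex i + α)) (ρ τ) (Θ τ) (u τ) (E τ) (B τ)) d (Ico 0 T) t ∧
        d ≤ -2 * (∑ j, ‖dW (unitIndex i + α) (u t j)‖ ^ 2
          + 3 / 2 * ‖dW (unitIndex i + α) (Θ t)‖ ^ 2) + C * (M * K ^ 2) := by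
  obtain ⟨Q, C, hC, hQc, hQb, hQ⟩ := exists_commutator_mulM (m := m) i hα
  refine ⟨80 * (90 + 10 * (C + mulConst m)) ^ 2, by positivity, ?_⟩
  intro T ρ Θ u E B P ρ' Θ' u' E' B' H K M t ht S hM
  -- At `h = 0` the average is the derivative itself, so the limit is the weighted energy of
  -- `∂ᵢ∂^α`, including the order `m + 1` for which the chain rule is not available.
  have main := hasDerivWithinAt_of_continuousOn_prod
    (E := fun h τ => topEnergy (avgD i α h) (ρ τ) (Θ τ) (u τ) (E τ) (B τ))
    (G := fun h τ => flowRate (Q h) (avgD i α h) (ρ τ) (Θ τ) (u τ) (E τ) (B τ) (P τ) (ρ' τ)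
      (Θ' τ)) (H.continuousOn_topEnergy i α) (H.continuousOn_flowRate i α hQc)
    (fun h hh t ht => H.hasDerivWithinAt_topEnergy i hα hh (hQ h hh) ht) ht
  have e0 : (avgD i α 0 : W (m + 1) →L[ℝ] L2) = dW (unitIndex i + α) :=
    ContinuousLinearMap.ext avgD_zero
  have hb := ((H.eqs t ht).topBd S hM hC (hQb 0) i α 0).topRate_le
    (by linarith [one_le_mulConst (m := m)]) S.K_le
  rw [e0] at main hb
  exact ⟨_, main, hb⟩

end

/-! ### Growth of the energy and of the interaction functionals -/

theorem exists_deriv_le_sum {ι : Type*} {s : Finset ι} {f : ι → ℝ → ℝ} {b : ι → ℝ} {I : Set ℝ}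
    {t : ℝ} (h : ∀ a ∈ s, ∃ d, HasDerivWithinAt (f a) d I t ∧ d ≤ b a) :
    ∃ d, HasDerivWithinAt (fun τ => ∑ a ∈ s, f a τ) d I t ∧ d ≤ ∑ a ∈ s, b a := by
  choose! d hd hb using h
  exact ⟨_, HasDerivWithinAt.fun_sum hd, Finset.sum_le_sum hb⟩

section
variable {m : ℕ}

/-- The energy in `L²`. -/
def baseEnergy (ρ Θ : W (m + 1)) (u E B : Fin 3 → W (m + 1)) : ℝ :=
  ⟪fnW ρ, fnW ρ⟫_ℝ + ∑ j, ⟪fnW (u j), fnW (u j)⟫_ℝ + 3 / 2 * ⟪fnW Θ, fnW Θ⟫_ℝ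
    + ∑ j, ⟪fnW (E j), fnW (E j)⟫_ℝ + ∑ j, ⟪fnW (B j), fnW (B j)⟫_ℝ

/-- The interaction of `u` with `∇ρ`. -/
def densityTerm (α : MultiIndex) (ρ : W (m + 1)) (u : Fin 3 → W (m + 1)) : ℝ :=
  ∑ j, ⟪dW α (u j), dW (unitIndex j + α) ρ⟫_ℝ

/-- The interaction of `u` with `E`. -/
def electricTerm (α : MultiIndex) (u E : Fin 3 → W (m + 1)) : ℝ :=
  ∑ j, ⟪dW α (u j), dW α (E j)⟫_ℝ

/-- The interaction of `E` with `∇ × B`. -/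
def magneticTerm (α : MultiIndex) (E B : Fin 3 → W (m + 1)) : ℝ :=
  -∑ j, (⟪dW α (E j), dW (unitIndex (j + 1) + α) (B (j + 2))⟫_ℝ
    - ⟪dW α (E j), dW (unitIndex (j + 2) + α) (B (j + 1))⟫_ℝ)

theorem RegPath.inner_wd {I : Set ℝ} {f g : ℝ → W (m + 1)} {f' g' : ℝ → W m}
    (hf : RegPath I f f') (hg : RegPath I g g') {α : MultiIndex} (hα : α.order ≤ m) (j : Fin 3)
    {t : ℝ} (ht : t ∈ I) :
    HasDerivWithinAt (fun τ => ⟪EulerMaxwell.dW α (f τ), EulerMaxwell.dW (unitIndex j + α) (g τ)⟫_ℝ)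
      (⟪EulerMaxwell.dW α (f' t), EulerMaxwell.dW (unitIndex j + α) (g t)⟫_ℝ
        - ⟪EulerMaxwell.dW (unitIndex j + α) (f t), EulerMaxwell.dW α (g' t)⟫_ℝ) I t :=
  hasDerivWithinAt_inner_wd (j := j) (df := fun τ => EulerMaxwell.dW (unitIndex j + α) (f τ)) ht
    (hf.dW hα ht) (hg.dW hα ht)
    ((EulerMaxwell.dW _).continuous.comp_continuousOn hg.cont t ht)
    (fun τ _ => wd_dW (f τ) j (by omega)) (fun τ _ => wd_dW (g τ) j (by omega))

theorem dW_unit_shift {α : MultiIndex} (h : 1 + α.order ≤ m + 1) (f : W (m + 1)) (j : Fin 3) :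
    dW (unitIndex j) (shiftW α h f) = dW (unitIndex j + α) f :=
  dW_shiftW _ (by rw [order_unitIndex]) _

variable [hm : Fact (3 ≤ m)]
variable {I : Set ℝ} {ρ Θ : ℝ → W (m + 1)} {u E B : ℝ → Fin 3 → W (m + 1)}
  {P : ℝ → Fin 3 → W m} {ρ' Θ' : ℝ → W m} {u' E' B' : ℝ → Fin 3 → W m}
  {K M N t : ℝ}

/-- Later `N` is the square root of the dissipation. It dominates both the fluid variables and the
derivatives of `E` of order at most `m`, so pairing with the forcing gives at most `M` times the
dissipation. -/
theorem Flow.forceBd (H : Flow I ρ Θ u E B P ρ' Θ' u' E' B') (ht : t ∈ I)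
    (S : Size K M (ρ t) (Θ t) (u t) (E t) (B t)) (hc : mulConst m * M ≤ 1 / 2) (hKN : K ≤ N)
    {α : MultiIndex} (hα : α.order ≤ m) (hE : ∀ j, ‖dW α (E t j)‖ ≤ N) :
    ForceBd N (9 * (mulConst m * (M * K))) (shiftW α (order_shift hα) (ρ t))
      (shiftW α (order_shift hα) (Θ t)) (fun j => shiftW α (order_shift hα) (u t j))
      (fun j => shiftW α (order_shift hα) (E t j)) (dW α (fρ (ρ t) (u t)))
      (dW α (fΘ (Θ t) (u t))) (fun j => dW α (fu (ρ t) (u t) (B t) (P t) j))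
      (fun j => dW α (inclW (Nat.le_succ m) (mulT (ρ t) (u t j)))) where
  r_le := by
    rw [fnW_shiftW]
    exact (norm_dW_le _ _).trans (S.ρ_le.trans hKN)
  θ_le := by
    rw [fnW_shiftW]
    exact (norm_dW_le _ _).trans (S.Θ_le.trans hKN)
  v_le j := by
    rw [fnW_shiftW]
    exact (norm_dW_le _ _).trans ((S.u_le j).trans hKN)
  e_le j := by
    rw [fnW_shiftW]
    exact hE j
  dr_le j := by
    rw [dW_unit_shift]
    exact (norm_dW_le _ _).trans (S.ρ_le.trans hKN)
  dv_le j := by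
    rw [dW_unit_shift]
    exact (norm_dW_le _ _).trans ((S.u_le j).trans hKN)
  Fr_le := (norm_dW_le _ _).trans S.norm_fρ_le
  Fθ_le := (norm_dW_le _ _).trans S.norm_fΘ_le
  Fv_le j := (norm_dW_le _ _).trans ((H.eqs t ht).norm_fu_le S hc j)
  Fe_le j := (norm_dW_le _ _).trans (norm_inclW_le_of_le (S.norm_fE_le j))

theorem Flow.exists_baseEnergy_deriv_le (H : Flow I ρ Θ u E B P ρ' Θ' u' E' B') (ht : t ∈ I)
    (S : Size K M (ρ t) (Θ t) (u t) (E t) (B t)) (hc : mulConst m * M ≤ 1 / 2) (hKN : K ≤ N)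
    (hE : ∀ j, ‖fnW (E t j)‖ ≤ N) :
    ∃ d, HasDerivWithinAt (fun τ => baseEnergy (ρ τ) (Θ τ) (u τ) (E τ) (B τ)) d I t ∧
      d ≤ -2 * (∑ j, ‖fnW (u t j)‖ ^ 2 + 3 / 2 * ‖fnW (Θ t)‖ ^ 2)
        + 18 * (N * (9 * (mulConst m * (M * K)))) := by
  have hα : MultiIndex.order 0 ≤ m := by rw [order_zero]; exact Nat.zero_le m
  have key := ((H.eqs t ht).linSys hα).energy_le (H.forceBd ht S hc hKN hα (by rwa [dW_zero]))
  simp only [fnW_shiftW, dW_zero] at key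
  have s1 := hasDerivWithinAt_inner_self (H.reg_ρ.dW hα ht)
  have s2 := HasDerivWithinAt.fun_sum (u := Finset.univ) fun j _ =>
    hasDerivWithinAt_inner_self ((H.reg_u j).dW hα ht)
  have s3 := (hasDerivWithinAt_inner_self (H.reg_Θ.dW hα ht)).const_mul (3 / 2)
  have s4 := HasDerivWithinAt.fun_sum (u := Finset.univ) fun j _ =>
    hasDerivWithinAt_inner_self ((H.reg_E j).dW hα ht)
  have s5 := HasDerivWithinAt.fun_sum (u := Finset.univ) fun j _ =>
    hasDerivWithinAt_inner_self ((H.reg_B j).dW hα ht)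
  simp only [dW_zero, ← Finset.mul_sum] at s1 s2 s3 s4 s5
  refine ⟨_, (((s1.add s2).add s3).add s4).add s5, ?_⟩
  linarith

theorem Flow.exists_densityTerm_deriv_le (H : Flow I ρ Θ u E B P ρ' Θ' u' E' B') (ht : t ∈ I)
    (S : Size K M (ρ t) (Θ t) (u t) (E t) (B t)) (hc : mulConst m * M ≤ 1 / 2) (hKN : K ≤ N)
    {α : MultiIndex} (hα : α.order ≤ m) (hE : ∀ j, ‖dW α (E t j)‖ ≤ N) :
    ∃ d, HasDerivWithinAt (fun τ => densityTerm α (ρ τ) (u τ)) d I t ∧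
      d ≤ -(1 / 2) * (‖dW α (ρ t)‖ ^ 2 + ∑ j, ‖dW (unitIndex j + α) (ρ t)‖ ^ 2)
        + 7 * (∑ j, ‖u t j‖ ^ 2 + ‖Θ t‖ ^ 2) + 6 * (N * (9 * (mulConst m * (M * K)))) := by
  have key := ((H.eqs t ht).linSys hα).density_le (H.forceBd ht S hc hKN hα hE)
  simp only [fnW_shiftW, dW_unit_shift] at key
  refine ⟨_, HasDerivWithinAt.fun_sum (u := Finset.univ) fun j _ =>
    (H.reg_u j).inner_wd H.reg_ρ hα j ht, key.trans ?_⟩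
  have h1 : ∑ j : Fin 3, ‖dW (unitIndex j + α) (Θ t)‖ ^ 2 ≤ 3 * ‖Θ t‖ ^ 2 :=
    sum_fin_le fun j => by gcongr; exact norm_dW_le _ _
  have h2 : ∑ j, ‖dW α (u t j)‖ ^ 2 ≤ ∑ j, ‖u t j‖ ^ 2 := by gcongr; exact norm_dW_le _ _
  have h3 : ∑ j, ‖dW (unitIndex j + α) (u t j)‖ ^ 2 ≤ ∑ j, ‖u t j‖ ^ 2 := by
    gcongr; exact norm_dW_le _ _
  have h4 : 0 ≤ ∑ j, ‖u t j‖ ^ 2 := by positivity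
  linarith [sq_nonneg ‖Θ t‖]

/-- The two alternatives in `hB` reflect what is dissipated of `B`. For `α = 0` the curl is
dissipated but `B` is not; for `0 < |α| ≤ m` the derivative `∂^α B` is, but its curl may be of order
`s`. In the latter case the curl is moved onto `u`, which is controlled to order `s`. -/
theorem Flow.exists_electricTerm_deriv_le (H : Flow I ρ Θ u E B P ρ' Θ' u' E' B') (ht : t ∈ I)
    (S : Size K M (ρ t) (Θ t) (u t) (E t) (B t)) (hc : mulConst m * M ≤ 1 / 2) (hKN : K ≤ N)
    {α : MultiIndex} (hα : α.order ≤ m) (hE : ∀ j, ‖dW α (E t j)‖ ≤ N) {a b : ℝ}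
    (hu : ∀ j, ‖u t j‖ ≤ a) (hB : (∀ j, ‖dW α (B t j)‖ ≤ b) ∨ ∀ j, ‖dW α (curlW (B t) j)‖ ≤ b) :
    ∃ d, HasDerivWithinAt (fun τ => electricTerm α (u τ) (E τ)) d I t ∧
      d ≤ -(1 / 2) * ∑ j, ‖dW α (E t j)‖ ^ 2
        + 8 * (∑ j, ‖u t j‖ ^ 2 + ‖Θ t‖ ^ 2 + ‖ρ t‖ ^ 2) + 6 * (a * b)
        + 6 * (N * (9 * (mulConst m * (M * K)))) := by
  have key := ((H.eqs t ht).linSys hα).electric_le (H.forceBd ht S hc hKN hα hE)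
  have hcurl : ∑ j, ⟪fnW (shiftW α (order_shift hα) (u t j)),
      curl1 (fun k => shiftW α (order_shift hα) (B t k)) j⟫_ℝ ≤ 6 * (a * b) := by
    rcases hB with hB | hB
    · rw [inner_curl1]
      refine (sum_fin_le (a := (2 * a) * b) fun j => inner_le_of_le ?_ ?_).trans_eq (by ring)
      · rw [curl1, dW_unit_shift, dW_unit_shift]
        refine (norm_sub_le _ _).trans ?_
        linarith [(norm_dW_le (unitIndex (j + 1) + α) (u t (j + 2))).trans (hu (j + 2)),
          (norm_dW_le (unitIndex (j + 2) + α) (u t (j + 1))).trans (hu (j + 1))]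
      · rw [fnW_shiftW]
        exact hB j
    · have h0 : 0 ≤ a * b := mul_nonneg ((norm_nonneg _).trans (hu 0)) ((norm_nonneg _).trans (hB 0))
      refine (sum_fin_le (a := a * b) fun j => inner_le_of_le ?_ ?_).trans (by linarith)
      · rw [fnW_shiftW]
        exact (norm_dW_le _ _).trans (hu j)
      · rw [curl1_shiftW]
        exact hB j
  simp only [fnW_shiftW, dW_unit_shift] at key hcurl
  refine ⟨_, HasDerivWithinAt.fun_sum (u := Finset.univ) fun j _ =>
    ((H.reg_u j).dW hα ht).inner ℝ ((H.reg_E j).dW hα ht), ?_⟩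
  have e : ∀ j, ⟪dW α (u t j), dW α (E' t j)⟫_ℝ + ⟪dW α (u' t j), dW α (E t j)⟫_ℝ
    = ⟪dW α (u' t j), dW α (E t j)⟫_ℝ + ⟪dW α (u t j), dW α (E' t j)⟫_ℝ := fun j => add_comm _ _
  simp only [e]
  refine key.trans ?_
  have h1 : ∑ j : Fin 3, ‖dW (unitIndex j + α) (Θ t)‖ ^ 2 ≤ 3 * ‖Θ t‖ ^ 2 :=
    sum_fin_le fun j => by gcongr; exact norm_dW_le _ _
  have h2 : ∑ j, ‖dW α (u t j)‖ ^ 2 ≤ ∑ j, ‖u t j‖ ^ 2 := by gcongr; exact norm_dW_le _ _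
  have h3 : ∑ j : Fin 3, ‖dW (unitIndex j + α) (ρ t)‖ ^ 2 ≤ 3 * ‖ρ t‖ ^ 2 :=
    sum_fin_le fun j => by gcongr; exact norm_dW_le _ _
  have h4 : 0 ≤ ∑ j, ‖u t j‖ ^ 2 := by positivity
  linarith [sq_nonneg ‖Θ t‖, sq_nonneg ‖ρ t‖]

/-- Besides the velocity and cubic errors, the cost is the curl of `E`. In the application `|α| ≤ m
- 1`, so that only derivatives of `E` of order at most `m`, which the electric functional
dissipates, are involved. -/
theorem Flow.exists_magneticTerm_deriv_le (H : Flow I ρ Θ u E B P ρ' Θ' u' E' B') (ht : t ∈ I)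
    (S : Size K M (ρ t) (Θ t) (u t) (E t) (B t))
    {α : MultiIndex} (hα : α.order ≤ m) (hB : ∀ j, ‖dW α (curlW (B t) j)‖ ≤ N) :
    ∃ d, HasDerivWithinAt (fun τ => magneticTerm α (E τ) (B τ)) d I t ∧
      d ≤ -(1 / 2) * ∑ j, ‖dW α (curlW (B t) j)‖ ^ 2 + ∑ j, ‖dW α (curlW (E t) j)‖ ^ 2
        + ∑ j, ‖u t j‖ ^ 2 + 3 * (N * (9 * (mulConst m * (M * K)))) := by
  have key := ((H.eqs t ht).linSys hα).magnetic_le (M := N)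
    (fun j => (norm_dW_le _ _).trans (norm_inclW_le_of_le (S.norm_fE_le j)))
    (by simpa only [curl1_shiftW] using hB)
  simp only [curl1_shiftW] at key
  refine ⟨_, (HasDerivWithinAt.fun_sum (u := Finset.univ) fun j _ =>
    ((H.reg_E j).inner_wd (H.reg_B (j + 2)) hα (j + 1) ht).sub
      ((H.reg_E j).inner_wd (H.reg_B (j + 1)) hα (j + 2) ht)).neg, ?_⟩
  have h2 : ∑ j, ‖dW α (u t j)‖ ^ 2 ≤ ∑ j, ‖u t j‖ ^ 2 := by gcongr; exact norm_dW_le _ _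
  simp only [← curl1_shiftW (order_shift hα), fnW_shiftW] at key ⊢
  refine le_trans (le_of_eq ?_) (key.trans (by linarith))
  congr 1
  simp only [curl1, dW_unit_shift, inner_sub_left, inner_sub_right, Fin.sum_univ_three,
    Fin.isValue, Fin.reduceAdd]
  ring

end

/-! ### Norms in terms of derivatives -/

section
variable {m : ℕ}

theorem order_le {k : ℕ} {α : MultiIndex} (h : α ∈ multiIndices k) : α.order ≤ k :=
  mem_multiIndices.1 h

/-- The number of multi-indices of order at most `m`. -/
def idxCard (m : ℕ) : ℝ := (multiIndices m).card

theorem one_le_idxCard : 1 ≤ idxCard m := by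
  rw [idxCard, Nat.one_le_cast, Finset.one_le_card]
  exact ⟨0, zero_mem_multiIndices m⟩

theorem sum_idx_le {f : MultiIndex → ℝ} {a : ℝ} (h : ∀ α ∈ multiIndices m, f α ≤ a) :
    ∑ α ∈ multiIndices m, f α ≤ idxCard m * a := by
  refine (Finset.sum_le_card_nsmul _ _ _ h).trans_eq ?_
  rw [nsmul_eq_mul, idxCard]

theorem sum_idx_pred_le {f : MultiIndex → ℝ} {a : ℝ} (ha : 0 ≤ a)
    (h : ∀ α ∈ multiIndices (m - 1), f α ≤ a) :
    ∑ α ∈ multiIndices (m - 1), f α ≤ idxCard m * a := by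
  refine (sum_idx_le h).trans (mul_le_mul_of_nonneg_right ?_ ha)
  rw [idxCard, idxCard, Nat.cast_le]
  exact Finset.card_le_card fun α hα => multiIndices_mono (Nat.sub_le m 1) hα

/-- Every derivative of positive order is a first derivative. -/
theorem exists_eq_unitIndex_add {k : ℕ} {α : MultiIndex} (hα : α.order ≤ k + 1) (h0 : α ≠ 0) :
    ∃ i, ∃ β ∈ multiIndices k, α = unitIndex i + β := by
  obtain ⟨i, β, rfl⟩ := exists_unitIndex_add h0
  rw [order_add, order_unitIndex] at hα
  exact ⟨i, β, mem_multiIndices.2 (by omega), add_comm _ _⟩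

/-- A sum over multi-indices is controlled by the sum over first derivatives. -/
theorem sum_multiIndices_succ_le {k : ℕ} (F : MultiIndex → ℝ) (hF : ∀ α, 0 ≤ F α) :
    ∑ α ∈ multiIndices (k + 1), F α
      ≤ F 0 + ∑ i, ∑ β ∈ multiIndices k, F (unitIndex i + β) := by
  classical
  have h : ∀ α ∈ (multiIndices (k + 1)).erase 0, ∃ p : Fin 3 × MultiIndex,
      p ∈ Finset.univ ×ˢ multiIndices k ∧ α = unitIndex p.1 + p.2 := by
    intro α hα
    obtain ⟨h0, hα⟩ := Finset.mem_erase.1 hα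
    obtain ⟨i, β, hβ, e⟩ := exists_eq_unitIndex_add (order_le hα) h0
    exact ⟨(i, β), Finset.mem_product.2 ⟨Finset.mem_univ _, hβ⟩, e⟩
  choose! g hg he using h
  have hinj : Set.InjOn g ((multiIndices (k + 1)).erase 0 : Finset MultiIndex) := by
    intro α hα β hβ hab
    rw [he α hα, he β hβ, hab]
  rw [← Finset.add_sum_erase _ _ (zero_mem_multiIndices (k + 1)), ← Finset.sum_product']
  refine add_le_add_right ?_ _
  calc ∑ α ∈ (multiIndices (k + 1)).erase 0, F α
      = ∑ α ∈ (multiIndices (k + 1)).erase 0, F (unitIndex (g α).1 + (g α).2) :=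
        Finset.sum_congr rfl fun α hα => by rw [← he α hα]
    _ = ∑ p ∈ ((multiIndices (k + 1)).erase 0).image g, F (unitIndex p.1 + p.2) :=
        (Finset.sum_image (f := fun p : Fin 3 × MultiIndex => F (unitIndex p.1 + p.2)) hinj).symm
    _ ≤ _ := Finset.sum_le_sum_of_subset_of_nonneg
        (Finset.image_subset_iff.2 hg) fun p _ _ => hF _

theorem norm_sq_le_sum (f : W (m + 1)) :
    ‖f‖ ^ 2 ≤ ‖fnW f‖ ^ 2 + ∑ i, ∑ α ∈ multiIndices m, ‖dW (unitIndex i + α) f‖ ^ 2 := by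
  rw [norm_sq_W, ← dW_zero]
  exact sum_multiIndices_succ_le (fun α => ‖dW α f‖ ^ 2) fun α => sq_nonneg _

theorem sum_sq_le_sum (f : Fin 3 → W (m + 1)) : ∑ j, ‖f j‖ ^ 2 ≤ ∑ j, ‖fnW (f j)‖ ^ 2
    + ∑ i, ∑ α ∈ multiIndices m, ∑ j, ‖dW (unitIndex i + α) (f j)‖ ^ 2 := by
  have := Finset.sum_le_sum fun j (_ : j ∈ Finset.univ) => norm_sq_le_sum (f j)
  rw [Finset.sum_add_distrib, Finset.sum_comm] at this
  simpa only [Finset.sum_comm (s := (Finset.univ : Finset (Fin 3)))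
    (t := multiIndices m)] using this

/-! ### Equivalence of the energy with the squared norm. -/

/-- The square of the norm of a state. -/
def stateSq (ρ Θ : W (m + 1)) (u E B : Fin 3 → W (m + 1)) : ℝ :=
  ‖ρ‖ ^ 2 + ∑ j, ‖u j‖ ^ 2 + ‖Θ‖ ^ 2 + ∑ j, ‖E j‖ ^ 2 + ∑ j, ‖B j‖ ^ 2

/-- The interaction parameter. -/
def epsW (m : ℕ) : ℝ := 1 / (8 * (20 * idxCard m) ^ 2)

/-- The sum of the interaction functionals. -/
def interW (ρ : W (m + 1)) (u E B : Fin 3 → W (m + 1)) : ℝ :=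
  epsW m * ∑ α ∈ multiIndices m, densityTerm α ρ u
    + epsW m ^ 2 * ∑ α ∈ multiIndices m, electricTerm α u E
    + epsW m ^ 3 * ∑ α ∈ multiIndices (m - 1), magneticTerm α E B

/-- The quadratic form with unit weights. -/
def quadW (A : W (m + 1) → L2) (ρ Θ : W (m + 1)) (u E B : Fin 3 → W (m + 1)) : ℝ :=
  ‖A ρ‖ ^ 2 + ∑ j, ‖A (u j)‖ ^ 2 + ‖A Θ‖ ^ 2 + ∑ j, ‖A (E j)‖ ^ 2 + ∑ j, ‖A (B j)‖ ^ 2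

section
variable {ρ Θ : W (m + 1)} {u E B : Fin 3 → W (m + 1)}

theorem baseEnergy_bounds : quadW fnW ρ Θ u E B ≤ baseEnergy ρ Θ u E B ∧
    baseEnergy ρ Θ u E B ≤ 3 / 2 * quadW fnW ρ Θ u E B := by
  have n1 : 0 ≤ ∑ j, ‖fnW (u j)‖ ^ 2 := by positivity
  have n2 : 0 ≤ ∑ j, ‖fnW (E j)‖ ^ 2 := by positivity
  have n3 : 0 ≤ ∑ j, ‖fnW (B j)‖ ^ 2 := by positivity
  simp only [baseEnergy, quadW, real_inner_self_eq_norm_sq]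
  constructor <;> linarith [sq_nonneg ‖fnW ρ‖, sq_nonneg ‖fnW Θ‖]

theorem stateSq_le_quadW : stateSq ρ Θ u E B ≤ quadW fnW ρ Θ u E B
    + ∑ i, ∑ α ∈ multiIndices m, quadW (dW (unitIndex i + α)) ρ Θ u E B := by
  simp only [stateSq, quadW, Finset.sum_add_distrib]
  linarith [norm_sq_le_sum ρ, norm_sq_le_sum Θ, sum_sq_le_sum u, sum_sq_le_sum E, sum_sq_le_sum B]

theorem stateSq_nonneg : 0 ≤ stateSq ρ Θ u E B := by
  rw [stateSq]
  positivity

theorem epsW_pos : 0 < epsW m := by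
  have := one_le_idxCard (m := m)
  rw [epsW]
  positivity

theorem epsW_mul_le : epsW m * idxCard m ≤ 1 / 3200 := by
  have h := one_le_idxCard (m := m)
  rw [epsW, div_mul_eq_mul_div, div_le_div_iff₀ (by positivity) (by norm_num)]
  nlinarith

theorem epsW_le : epsW m ≤ 1 / 3200 := by
  have h := one_le_idxCard (m := m)
  have := epsW_mul_le (m := m)
  have := epsW_pos (m := m)
  nlinarith

theorem quadW_le (A : W (m + 1) → L2) (hA : ∀ f, ‖A f‖ ≤ ‖f‖) :
    quadW A ρ Θ u E B ≤ stateSq ρ Θ u E B := by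
  rw [quadW, stateSq]
  gcongr <;> exact hA _

theorem abs_inner_le_stateSq {x y : L2} (hx : ‖x‖ ^ 2 ≤ stateSq ρ Θ u E B)
    (hy : ‖y‖ ^ 2 ≤ stateSq ρ Θ u E B) : |⟪x, y⟫_ℝ| ≤ stateSq ρ Θ u E B := by
  refine (abs_real_inner_le_norm x y).trans ?_
  nlinarith [sq_nonneg (‖x‖ - ‖y‖)]

theorem norm_dW_sq_le_stateSq (α : MultiIndex) : ‖dW α ρ‖ ^ 2 ≤ stateSq ρ Θ u E B ∧
    (∀ j, ‖dW α (u j)‖ ^ 2 ≤ stateSq ρ Θ u E B) ∧ (∀ j, ‖dW α (E j)‖ ^ 2 ≤ stateSq ρ Θ u E B) ∧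
    ∀ j, ‖dW α (B j)‖ ^ 2 ≤ stateSq ρ Θ u E B := by
  have n1 : ∀ f : Fin 3 → W (m + 1), 0 ≤ ∑ j, ‖f j‖ ^ 2 := fun f => by positivity
  have h : ∀ f : W (m + 1), ‖dW α f‖ ^ 2 ≤ ‖f‖ ^ 2 := fun f => by gcongr; exact norm_dW_le _ _
  have h' : ∀ (f : Fin 3 → W (m + 1)) (j), ‖f j‖ ^ 2 ≤ ∑ j, ‖f j‖ ^ 2 := fun f j =>
    Finset.single_le_sum (f := fun j => ‖f j‖ ^ 2) (fun k _ => sq_nonneg _) (Finset.mem_univ j)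
  rw [stateSq]
  refine ⟨?_, fun j => ?_, fun j => ?_, fun j => ?_⟩
  · linarith [n1 u, n1 E, n1 B, h ρ, sq_nonneg ‖Θ‖]
  · linarith [n1 E, n1 B, h (u j), h' u j, sq_nonneg ‖Θ‖, sq_nonneg ‖ρ‖]
  · linarith [n1 u, n1 B, h (E j), h' E j, sq_nonneg ‖Θ‖, sq_nonneg ‖ρ‖]
  · linarith [n1 u, n1 E, h (B j), h' B j, sq_nonneg ‖Θ‖, sq_nonneg ‖ρ‖]

theorem abs_densityTerm_le (α : MultiIndex) :
    |densityTerm α ρ u| ≤ 3 * stateSq ρ Θ u E B := by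
  refine (Finset.abs_sum_le_sum_abs _ _).trans (sum_fin_le fun j => ?_)
  exact abs_inner_le_stateSq ((norm_dW_sq_le_stateSq α).2.1 j) (norm_dW_sq_le_stateSq _).1

theorem abs_electricTerm_le (α : MultiIndex) :
    |electricTerm α u E| ≤ 3 * stateSq ρ Θ u E B := by
  refine (Finset.abs_sum_le_sum_abs _ _).trans (sum_fin_le fun j => ?_)
  exact abs_inner_le_stateSq ((norm_dW_sq_le_stateSq α).2.1 j) ((norm_dW_sq_le_stateSq α).2.2.1 j)

theorem abs_magneticTerm_le (α : MultiIndex) :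
    |magneticTerm α E B| ≤ 6 * stateSq ρ Θ u E B := by
  rw [magneticTerm, abs_neg]
  refine (Finset.abs_sum_le_sum_abs _ _).trans ((sum_fin_le fun j => (abs_sub _ _).trans
    (add_le_add (abs_inner_le_stateSq (ρ := ρ) (Θ := Θ) (u := u) (E := E) (B := B)
      ((norm_dW_sq_le_stateSq α).2.2.1 j) ((norm_dW_sq_le_stateSq _).2.2.2 _))
      (abs_inner_le_stateSq (ρ := ρ) (Θ := Θ) (u := u) (E := E) (B := B)
        ((norm_dW_sq_le_stateSq α).2.2.1 j) ((norm_dW_sq_le_stateSq _).2.2.2 _)))).trans_eq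
          (by ring))

/-- Each family has at most `idxCard m` terms bounded by `3`, `3` or `6` times the squared norm, and
`epsW m * idxCard m ≤ 1/3200`; so the interaction cannot spoil coercivity. -/
theorem abs_interW_le : |interW ρ u E B| ≤ 1 / 4 * stateSq ρ Θ u E B := by
  set S := stateSq ρ Θ u E B with hS
  have hS0 : 0 ≤ S := stateSq_nonneg
  have hn := one_le_idxCard (m := m)
  have h1 : |∑ α ∈ multiIndices m, densityTerm α ρ u| ≤ idxCard m * (3 * S) :=
    (Finset.abs_sum_le_sum_abs _ _).trans (sum_idx_le fun α _ => abs_densityTerm_le α)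
  have h2 : |∑ α ∈ multiIndices m, electricTerm α u E| ≤ idxCard m * (3 * S) :=
    (Finset.abs_sum_le_sum_abs _ _).trans (sum_idx_le fun α _ => abs_electricTerm_le α)
  have h3 : |∑ α ∈ multiIndices (m - 1), magneticTerm α E B| ≤ idxCard m * (6 * S) :=
    (Finset.abs_sum_le_sum_abs _ _).trans (sum_idx_pred_le (by positivity)
      fun α _ => abs_magneticTerm_le α)
  have e0 := epsW_pos (m := m)
  have e1 := epsW_le (m := m)
  have e2 : epsW m * idxCard m * S ≤ 1 / 3200 * S := by gcongr; exact epsW_mul_le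
  have e3 : epsW m ^ 2 ≤ epsW m := by nlinarith
  have e4 : epsW m ^ 3 ≤ epsW m := by nlinarith
  rw [interW]
  refine (abs_add_three _ _ _).trans ?_
  rw [abs_mul, abs_mul, abs_mul, abs_of_pos e0, abs_of_pos (pow_pos e0 2),
    abs_of_pos (pow_pos e0 3)]
  calc _ ≤ epsW m * (idxCard m * (3 * S)) + epsW m * (idxCard m * (3 * S))
      + epsW m * (idxCard m * (6 * S)) := by gcongr
    _ ≤ 1 / 4 * S := by nlinarith


end

variable [hm : Fact (3 ≤ m)]

/-- The energy functional, in coordinates. -/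
def energyW (ρ Θ : W (m + 1)) (u E B : Fin 3 → W (m + 1)) : ℝ :=
  baseEnergy ρ Θ u E B
    + ∑ i, ∑ α ∈ multiIndices m, topEnergy (dW (unitIndex i + α)) ρ Θ u E B
    + interW ρ u E B

section
variable {ρ Θ : W (m + 1)} {u E B : Fin 3 → W (m + 1)} {M : ℝ}

theorem inner_op_self_bounds {g : W (m + 1)} (hg : mulConst m * ‖g‖ ≤ 1 / 2) (x : L2) :
    1 / 2 * ‖x‖ ^ 2 ≤ ⟪op g x, x⟫_ℝ ∧ ⟪op g x, x⟫_ℝ ≤ 3 / 2 * ‖x‖ ^ 2 := by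
  have h1 : ‖opT g x‖ ≤ 1 / 2 * ‖x‖ := by
    refine (norm_opM_le' _ _).trans ?_
    have := one_le_mulConst (m := m)
    gcongr
    refine le_trans ?_ hg
    gcongr
    exact norm_inclW_le _ _
  have h2 := abs_le.1 (abs_inner_le_of_le h1 (le_refl ‖x‖))
  rw [op_apply, inner_add_left, real_inner_self_eq_norm_sq]
  constructor <;> nlinarith

/-- Each weight differs from one by a function of norm at most `6M`. With `mulConst m * M ≤ 1/12`
multiplication by it has norm at most `1/2`; the upper constant is `9/4 = 3/2 · 3/2`. -/
theorem topEnergy_bounds (hρ : ‖ρ‖ ≤ M) (hΘ : ‖Θ‖ ≤ M) (hM : mulConst m * M ≤ 1 / 12)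
    (A : W (m + 1) → L2) :
    1 / 2 * quadW A ρ Θ u E B ≤ topEnergy A ρ Θ u E B ∧
      topEnergy A ρ Θ u E B ≤ 9 / 4 * quadW A ρ Θ u E B := by
  have h1m := one_le_mulConst (m := m)
  have hM' : mulConst m * M ≤ 1 / 2 := by linarith
  have hw : ∀ {g : W (m + 1)}, ‖g‖ ≤ 6 * M → mulConst m * ‖g‖ ≤ 1 / 2 := fun {g} hg => by
    calc mulConst m * ‖g‖ ≤ mulConst m * (6 * M) := by gcongr
      _ = 6 * (mulConst m * M) := by ring
      _ ≤ 1 / 2 := by linarith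
  have hM0 : 0 ≤ M := (norm_nonneg _).trans hρ
  have c1 := norm_circ_le hΘ hΘ le_rfl hM'
  have c3 := norm_circ_le hρ hρ le_rfl hM'
  have c2 := norm_circ_le c3 hΘ le_rfl hM'
  have w1 : mulConst m * ‖wtρ Θ‖ ≤ 1 / 2 := hw (c1.trans (by linarith))
  have w3 : mulConst m * ‖wtΘ ρ‖ ≤ 1 / 2 := hw (c3.trans (by linarith))
  have w2 : mulConst m * ‖wtu ρ Θ‖ ≤ 1 / 2 := hw (c2.trans (by linarith))
  have b1 := inner_op_self_bounds w1 (A ρ)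
  have b3 := inner_op_self_bounds w3 (A Θ)
  have b2 := fun j => inner_op_self_bounds w2 (A (u j))
  have s1 := Finset.sum_le_sum fun j (_ : j ∈ Finset.univ) => (b2 j).1
  have s2 := Finset.sum_le_sum fun j (_ : j ∈ Finset.univ) => (b2 j).2
  simp only [← Finset.mul_sum] at s1 s2
  have n1 : 0 ≤ ∑ j, ‖A (u j)‖ ^ 2 := by positivity
  have n2 : 0 ≤ ∑ j, ‖A (E j)‖ ^ 2 := by positivity
  have n3 : 0 ≤ ∑ j, ‖A (B j)‖ ^ 2 := by positivity
  simp only [topEnergy, quadW, real_inner_self_eq_norm_sq]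
  constructor <;> linarith [sq_nonneg ‖A ρ‖, sq_nonneg ‖A Θ‖]

/-- Base and weighted energies give at least half the squared norm, and the interaction removes at
most a quarter. The upper bound grows with `idxCard m` because lower-order derivatives are counted
repeatedly. -/
theorem energyW_bounds (hρ : ‖ρ‖ ≤ M) (hΘ : ‖Θ‖ ≤ M) (hM : mulConst m * M ≤ 1 / 12) :
    1 / 4 * stateSq ρ Θ u E B ≤ energyW ρ Θ u E B ∧
      energyW ρ Θ u E B ≤ 16 * idxCard m * stateSq ρ Θ u E B := by
  set S := stateSq ρ Θ u E B with hS
  have hS0 : 0 ≤ S := stateSq_nonneg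
  have hn := one_le_idxCard (m := m)
  have h1 := abs_le.1 (abs_interW_le (ρ := ρ) (Θ := Θ) (u := u) (E := E) (B := B))
  have h2 := baseEnergy_bounds (ρ := ρ) (Θ := Θ) (u := u) (E := E) (B := B)
  have h3 := stateSq_le_quadW (ρ := ρ) (Θ := Θ) (u := u) (E := E) (B := B)
  have h4 : quadW fnW ρ Θ u E B ≤ S := quadW_le _ norm_fnW_le
  have h5 : ∑ i, ∑ α ∈ multiIndices m, quadW (dW (unitIndex i + α)) ρ Θ u E B
      ≤ 3 * (idxCard m * S) :=
    sum_fin_le fun i => sum_idx_le fun α _ => quadW_le _ (norm_dW_le _)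
  have h6 := Finset.sum_le_sum fun i (_ : i ∈ (Finset.univ : Finset (Fin 3))) =>
    Finset.sum_le_sum fun α (_ : α ∈ multiIndices m) =>
      (topEnergy_bounds (u := u) (E := E) (B := B) hρ hΘ hM (dW (unitIndex i + α))).1
  have h7 := Finset.sum_le_sum fun i (_ : i ∈ (Finset.univ : Finset (Fin 3))) =>
    Finset.sum_le_sum fun α (_ : α ∈ multiIndices m) =>
      (topEnergy_bounds (u := u) (E := E) (B := B) hρ hΘ hM (dW (unitIndex i + α))).2
  simp only [← Finset.mul_sum] at h6 h7
  have h8 : 0 ≤ quadW fnW ρ Θ u E B := by rw [quadW]; positivity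
  have h9 : S ≤ idxCard m * S := by nlinarith
  rw [energyW]
  constructor <;> linarith [h1.1, h1.2, h2.1, h2.2]

end

end

/-! ### The growth of the energy functional -/

/-- `A` stands for `u` and `Θ`, `R` for `ρ`, `Ne` for `E`, `Nb` for the curl of `B`. Every cost of a
level occurs with a good term of an earlier level carrying one power of `ε` less, and `εL ≤ 1/8`
absorbs it. The product of `A` and `Nb` needs the stronger relation `εL² = 1/8`. -/
theorem combine_dissipation {L ε A R Ne Nb a b d₀ d₁ d₂ d₃ e₀ e₁ e₂ e₃ : ℝ} (hL : 1 ≤ L)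
    (hε : ε = 1 / (8 * L ^ 2)) (hA : 0 ≤ A) (hR : 0 ≤ R) (hNe : 0 ≤ Ne)
    (ha : a ^ 2 = A) (hb : b ^ 2 = Nb)
    (he₁ : 0 ≤ e₁) (he₂ : 0 ≤ e₂) (he₃ : 0 ≤ e₃) (h₀ : d₀ ≤ -2 * A + e₀)
    (h₁ : d₁ ≤ -(1 / 2) * R + L * A + e₁)
    (h₂ : d₂ ≤ -(1 / 2) * Ne + L * (A + R) + L * (a * b) + e₂)
    (h₃ : d₃ ≤ -(1 / 2) * Nb + L * (A + Ne) + e₃) :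
    d₀ + (ε * d₁ + ε ^ 2 * d₂ + ε ^ 3 * d₃)
      ≤ -(ε ^ 3 / 4) * (A + R + Ne + Nb) + (e₀ + e₁ + e₂ + e₃) := by
  have hε0 : 0 < ε := by rw [hε]; positivity
  have hεL2 : ε * L ^ 2 = 1 / 8 := by rw [hε]; field_simp
  have hεL : ε * L ≤ 1 / 8 := by
    rw [← hεL2, sq, ← mul_assoc]
    exact le_mul_of_one_le_right (by positivity) hL
  have hε1 : ε ≤ 1 / 8 := (le_mul_of_one_le_right hε0.le hL).trans hεL
  have hε2 : ε ^ 2 ≤ 1 / 8 * ε := by nlinarith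
  have hε3 : ε ^ 3 ≤ 1 / 8 * ε ^ 2 := by nlinarith [sq_nonneg ε]
  have g1 := mul_le_mul_of_nonneg_left h₁ hε0.le
  have g2 := mul_le_mul_of_nonneg_left h₂ (sq_nonneg ε)
  have g3 := mul_le_mul_of_nonneg_left h₃ (pow_pos hε0 3).le
  have k1 : ε * L * A ≤ 1 / 8 * A := by gcongr
  have k2 : ε * L * (ε * A) ≤ 1 / 8 * (ε * A) := by gcongr
  have k3 : ε * L * (ε ^ 2 * A) ≤ 1 / 8 * (ε ^ 2 * A) := by gcongr
  have k4 : ε * L * (ε * R) ≤ 1 / 8 * (ε * R) := by gcongr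
  have k5 : ε * L * (ε ^ 2 * Ne) ≤ 1 / 8 * (ε ^ 2 * Ne) := by gcongr
  have k6 : ε * L ^ 2 * A = 1 / 8 * A := by rw [hεL2]
  -- The completed square splits `ε² L a b` into `ε³ b²/4`, half of the magnetic gain, and `ε L² a²
  -- = A/8`, covered by the damping.
  have y : 0 ≤ ε * (ε * b / 2 - L * a) ^ 2 := by positivity
  have y' : ε ^ 2 * (L * (a * b)) ≤ ε ^ 3 * Nb / 4 + ε * L ^ 2 * A := by
    rw [← ha, ← hb]
    linarith
  have z1 : ε * A ≤ 1 / 8 * A := by gcongr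
  have z2 : ε ^ 2 * A ≤ 1 / 8 * ε * A := by gcongr
  have z3 : ε ^ 3 * A ≤ 1 / 8 * ε ^ 2 * A := by gcongr
  have z4 : ε ^ 2 * R ≤ 1 / 8 * ε * R := by gcongr
  have z5 : ε ^ 3 * R ≤ 1 / 8 * ε ^ 2 * R := by gcongr
  have z6 : ε ^ 3 * Ne ≤ 1 / 8 * ε ^ 2 * Ne := by gcongr
  have w1 : ε * e₁ ≤ 1 * e₁ := by gcongr; linarith
  have w2 : ε ^ 2 * e₂ ≤ 1 * e₂ := by gcongr; linarith
  have w3 : ε ^ 3 * e₃ ≤ 1 * e₃ := by gcongr; linarith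
  have p1 : 0 ≤ ε * R := by positivity
  have p2 : 0 ≤ ε ^ 2 * Ne := by positivity
  linarith

section
variable {m : ℕ}

/-- The dissipation, in coordinates. -/
def dissW (ρ Θ : W (m + 1)) (u E B : Fin 3 → W (m + 1)) : ℝ :=
  (∑ j, ‖u j‖ ^ 2 + ‖Θ‖ ^ 2) + ‖ρ‖ ^ 2 + ∑ α ∈ multiIndices m, ∑ j, ‖dW α (E j)‖ ^ 2
    + ∑ α ∈ multiIndices (m - 1), ∑ j, ‖dW α (curlW B j)‖ ^ 2

theorem norm_sub_sq_le (x y : L2) : ‖x - y‖ ^ 2 ≤ 2 * ‖x‖ ^ 2 + 2 * ‖y‖ ^ 2 := by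
  rw [sub_eq_add_neg, ← norm_neg y]
  exact norm_add_sq_le x (-y)

theorem dW_curlW {α : MultiIndex} (hα : α.order ≤ m) (f : Fin 3 → W (m + 1)) (j : Fin 3) :
    dW α (curlW f j)
      = dW (unitIndex (j + 1) + α) (f (j + 2)) - dW (unitIndex (j + 2) + α) (f (j + 1)) := by
  rw [← curl1_shiftW (by omega), curl1, dW_unit_shift, dW_unit_shift]

theorem sum_norm_sq_curlW_le (E : Fin 3 → W (m + 1)) {α : MultiIndex}
    (hα : α.order + 1 ≤ m) : ∑ j, ‖dW α (curlW E j)‖ ^ 2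
      ≤ 12 * ∑ α ∈ multiIndices m, ∑ j, ‖dW α (E j)‖ ^ 2 := by
  have h1 : ∀ i j, ‖dW (unitIndex i + α) (E j)‖ ^ 2
      ≤ ∑ α ∈ multiIndices m, ∑ j, ‖dW α (E j)‖ ^ 2 := fun i j =>
    (Finset.single_le_sum (f := fun j => ‖dW (unitIndex i + α) (E j)‖ ^ 2)
      (fun k _ => sq_nonneg _) (Finset.mem_univ j)).trans
    (Finset.single_le_sum (f := fun α => ∑ j, ‖dW α (E j)‖ ^ 2)
      (fun k _ => Finset.sum_nonneg fun _ _ => sq_nonneg _)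
      (mem_multiIndices.2 (by rw [order_add, order_unitIndex]; omega)))
  refine (sum_fin_le fun j => ?_).trans_eq
    (by ring : 3 * (4 * ∑ α ∈ multiIndices m, ∑ j, ‖dW α (E j)‖ ^ 2) = _)
  rw [dW_curlW (by omega)]
  linarith [norm_sub_sq_le (dW (unitIndex (j + 1) + α) (E (j + 2)))
    (dW (unitIndex (j + 2) + α) (E (j + 1))), h1 (j + 1) (j + 2), h1 (j + 2) (j + 1)]

/-- For a divergence-free field the curl controls the full gradient, by integration by parts; this
turns the output of the magnetic functional into the dissipation of `∇B`. -/
theorem sum_norm_sq_eq_curlW {B : Fin 3 → W (m + 1)} (hB : ∑ j, pdW j (le_refl (m + 1)) (B j) = 0)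
    {β : MultiIndex} (hβ : β.order + 1 ≤ m) :
    ∑ i, ∑ j, ‖dW (unitIndex i + β) (B j)‖ ^ 2 = ∑ j, ‖dW β (curlW B j)‖ ^ 2 := by
  have hβ' : 1 + β.order ≤ m + 1 := by omega
  have h := sum_norm_sq_eq_curl_div (b := fun j => shiftW β hβ' (B j)) (by
    intro i j k l
    simp only [dW_unit_shift]
    exact inner_dW_comm (by omega) _ _ _ _)
  simp only [curl1_shiftW] at h
  have h0 : ∑ j, dW (unitIndex j) (shiftW β hβ' (B j)) = 0 := by
    simp only [dW_unit_shiftW]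
    rw [← map_sum, hB, map_zero]
  rw [h0, norm_zero] at h
  simp only [dW_unit_shift] at h
  linarith

variable [hm : Fact (3 ≤ m)]

-- All growth estimates are added with weights `1`, `ε`, `ε²`, `ε³`. The error is proportional to
-- `M` times the dissipation at the same time, where `M` is any bound of the state at that time; the
-- smallness needed is only that of `mulConst m * M`.
set_option maxHeartbeats 1000000 in
theorem exists_energyW_deriv_le : ∃ C : ℝ, 0 ≤ C ∧ ∀ {T : ℝ} {ρ Θ : ℝ → W (m + 1)}
    {u E B : ℝ → Fin 3 → W (m + 1)} {P : ℝ → Fin 3 → W m} {ρ' Θ' : ℝ → W m}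
    {u' E' B' : ℝ → Fin 3 → W m}, Flow (Ico 0 T) ρ Θ u E B P ρ' Θ' u' E' B' →
    ∀ {M t : ℝ}, t ∈ Ico 0 T → 0 ≤ M → stateSq (ρ t) (Θ t) (u t) (E t) (B t) ≤ M ^ 2 →
      mulConst m * M ≤ 1 / 2 →
      ∃ d, HasDerivWithinAt (fun τ => energyW (ρ τ) (Θ τ) (u τ) (E τ) (B τ)) d (Ico 0 T) t ∧
        d ≤ -(epsW m ^ 3 / 4) * dissW (ρ t) (Θ t) (u t) (E t) (B t)
          + C * (M * dissW (ρ t) (Θ t) (u t) (E t) (B t)) := by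
  have hex : ∀ (i : Fin 3) (α : MultiIndex), α ∈ multiIndices m → _ := fun i α hα =>
    exists_topEnergy_deriv_le (m := m) i (order_le hα)
  choose! C hC hex using hex
  have hn := one_le_idxCard (m := m)
  have hc1 := one_le_mulConst (m := m)
  refine ⟨(18 + 15 * idxCard m) * (9 * mulConst m) + ∑ i, ∑ α ∈ multiIndices m, C i α,
    add_nonneg (by positivity) (Finset.sum_nonneg fun i _ => Finset.sum_nonneg fun α hα =>
      hC i α hα), ?_⟩
  intro T ρ Θ u E B P ρ' Θ' u' E' B' H M t ht hM0 hSM hcM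
  have n1 : ∀ f : Fin 3 → W (m + 1), 0 ≤ ∑ j, ‖f j‖ ^ 2 := fun f => by positivity
  have hs : ∀ (f : Fin 3 → W (m + 1)) (j), ‖f j‖ ^ 2 ≤ ∑ j, ‖f j‖ ^ 2 := fun f j =>
    Finset.single_le_sum (f := fun j => ‖f j‖ ^ 2) (fun k _ => sq_nonneg _) (Finset.mem_univ j)
  set A := ∑ j, ‖u t j‖ ^ 2 + ‖Θ t‖ ^ 2 with hA
  set R := ‖ρ t‖ ^ 2 with hR
  set Ne := ∑ α ∈ multiIndices m, ∑ j, ‖dW α (E t j)‖ ^ 2 with hNe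
  set Nb := ∑ α ∈ multiIndices (m - 1), ∑ j, ‖dW α (curlW (B t) j)‖ ^ 2 with hNb
  have hD : dissW (ρ t) (Θ t) (u t) (E t) (B t) = A + R + Ne + Nb := rfl
  set D := dissW (ρ t) (Θ t) (u t) (E t) (B t)
  have hA0 : 0 ≤ A := add_nonneg (n1 _) (sq_nonneg _)
  have hR0 : 0 ≤ R := sq_nonneg _
  have hNe0 : 0 ≤ Ne := Finset.sum_nonneg fun _ _ => Finset.sum_nonneg fun _ _ => sq_nonneg _
  have hNb0 : 0 ≤ Nb := Finset.sum_nonneg fun _ _ => Finset.sum_nonneg fun _ _ => sq_nonneg _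
  have hD0 : 0 ≤ D := by linarith
  have hAR : A + R ≤ M ^ 2 := by
    rw [stateSq] at hSM
    linarith [n1 (E t), n1 (B t)]
  -- `K² = A + R` is the part of the dissipation formed by the fluid variables, while `M` bounds the
  -- whole state.
  have S : Size √(A + R) M (ρ t) (Θ t) (u t) (E t) (B t) :=
    { K_le := Real.sqrt_le_iff.2 ⟨hM0, hAR⟩
      ρ_le := Real.le_sqrt_of_sq_le (by linarith)
      Θ_le := Real.le_sqrt_of_sq_le (by linarith [n1 (u t)])
      u_le := fun j => Real.le_sqrt_of_sq_le (by linarith [hs (u t) j, sq_nonneg ‖Θ t‖])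
      E_le := fun j => abs_le_of_sq_le_sq' (by
        rw [stateSq] at hSM
        linarith [hs (E t) j, n1 (B t), n1 (u t), sq_nonneg ‖Θ t‖]) hM0 |>.2
      B_le := fun j => abs_le_of_sq_le_sq' (by
        rw [stateSq] at hSM
        linarith [hs (B t) j, n1 (E t), n1 (u t), sq_nonneg ‖Θ t‖]) hM0 |>.2 }
  set K := √(A + R) with hK
  have hK2 : K ^ 2 = A + R := Real.sq_sqrt (by linarith)
  have hKD : K ≤ √D := Real.sqrt_le_sqrt (by linarith)
  have hEα : ∀ α ∈ multiIndices m, ∀ j, ‖dW α (E t j)‖ ≤ √D := fun α hα j => by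
    refine Real.le_sqrt_of_sq_le ?_
    have h1 := Finset.single_le_sum (f := fun j => ‖dW α (E t j)‖ ^ 2)
      (fun k _ => sq_nonneg _) (Finset.mem_univ j)
    have h2 := Finset.single_le_sum (f := fun α => ∑ j, ‖dW α (E t j)‖ ^ 2)
      (fun k _ => Finset.sum_nonneg fun _ _ => sq_nonneg _) hα
    exact (h1.trans h2).trans (by linarith)
  have hBs : ∀ α ∈ multiIndices (m - 1), ∑ j, ‖dW α (curlW (B t) j)‖ ^ 2 ≤ Nb := fun α hα =>
    Finset.single_le_sum (f := fun α => ∑ j, ‖dW α (curlW (B t) j)‖ ^ 2)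
      (fun k _ => Finset.sum_nonneg fun _ _ => sq_nonneg _) hα
  have hBα : ∀ α ∈ multiIndices (m - 1), ∀ j, ‖dW α (curlW (B t) j)‖ ≤ √Nb := fun α hα j =>
    Real.le_sqrt_of_sq_le ((Finset.single_le_sum (f := fun j => ‖dW α (curlW (B t) j)‖ ^ 2)
      (fun k _ => sq_nonneg _) (Finset.mem_univ j)).trans (hBs α hα))
  have hpred : ∀ {α}, α ∈ multiIndices (m - 1) → α.order + 1 ≤ m := fun hα => by
    have := order_le hα
    have := hm.out
    omega
  -- For `α ≠ 0` one derivative is split off: `∂^α B` is then part of `∇∂^β B` with `|β| ≤ m - 1`,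
  -- which equals the dissipated curl in norm.
  have hBor : ∀ α ∈ multiIndices m, (∀ j, ‖dW α (B t j)‖ ≤ √Nb) ∨
      ∀ j, ‖dW α (curlW (B t) j)‖ ≤ √Nb := fun α hα => by
    by_cases h0 : α = 0
    · subst h0
      exact Or.inr (hBα 0 (zero_mem_multiIndices _))
    · left
      intro j
      have h3 : m - 1 + 1 = m := by have := hm.out; omega
      obtain ⟨i, β, hβ, rfl⟩ := exists_eq_unitIndex_add (k := m - 1)
        (by rw [h3]; exact order_le hα) h0
      refine Real.le_sqrt_of_sq_le (le_trans ?_ (hBs β hβ))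
      rw [← sum_norm_sq_eq_curlW (H.eqs t ht).gaussB (hpred hβ)]
      exact (Finset.single_le_sum (f := fun j => ‖dW (unitIndex i + β) (B t j)‖ ^ 2)
        (fun k _ => sq_nonneg _) (Finset.mem_univ j)).trans
        (Finset.single_le_sum (f := fun i => ∑ j, ‖dW (unitIndex i + β) (B t j)‖ ^ 2)
          (fun k _ => Finset.sum_nonneg fun _ _ => sq_nonneg _) (Finset.mem_univ i))
  -- The common size of the cubic errors in the base energy and the interactions: a dissipated
  -- factor times a nonlinear term. Since `K ≤ √D`, it is at most a constant times `M D`.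
  set δ := √D * (9 * (mulConst m * (M * K))) with hδ
  have hK0 : 0 ≤ K := Real.sqrt_nonneg _
  have hc0 : 0 ≤ mulConst m := by linarith
  have hδ0 : 0 ≤ δ := mul_nonneg (Real.sqrt_nonneg _)
    (mul_nonneg (by norm_num) (mul_nonneg hc0 (mul_nonneg hM0 hK0)))
  have hδD : δ ≤ 9 * mulConst m * (M * D) := by
    calc δ = 9 * mulConst m * (M * (√D * K)) := by rw [hδ]; ring
      _ ≤ 9 * mulConst m * (M * (√D * √D)) := by gcongr
      _ = _ := by rw [Real.mul_self_sqrt hD0]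
  obtain ⟨d0, hd0, hb0⟩ := H.exists_baseEnergy_deriv_le ht S hcM hKD
    (by simpa only [dW_zero] using hEα 0 (zero_mem_multiIndices m))
  obtain ⟨dt, hdt, hbt⟩ := exists_deriv_le_sum fun i (_ : i ∈ (Finset.univ : Finset (Fin 3))) =>
    exists_deriv_le_sum fun α (hα : α ∈ multiIndices m) => hex i α hα H ht S hcM
  obtain ⟨d1, hd1, hb1⟩ := exists_deriv_le_sum fun α (hα : α ∈ multiIndices m) =>
    H.exists_densityTerm_deriv_le ht S hcM hKD (order_le hα) (hEα α hα)
  obtain ⟨d2, hd2, hb2⟩ := exists_deriv_le_sum fun α (hα : α ∈ multiIndices m) =>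
    H.exists_electricTerm_deriv_le ht S hcM hKD (order_le hα) (hEα α hα) (a := √A) (b := √Nb)
      (fun j => Real.le_sqrt_of_sq_le (by linarith [hs (u t) j, sq_nonneg ‖Θ t‖])) (hBor α hα)
  obtain ⟨d3, hd3, hb3⟩ := exists_deriv_le_sum fun α (hα : α ∈ multiIndices (m - 1)) =>
    H.exists_magneticTerm_deriv_le ht S (order_le (multiIndices_mono (Nat.sub_le m 1) hα))
      (fun j => (hBα α hα j).trans (Real.sqrt_le_sqrt (by linarith : Nb ≤ D)))
  have hE12 : ∀ α ∈ multiIndices (m - 1), ∑ j, ‖dW α (curlW (E t) j)‖ ^ 2 ≤ 12 * Ne :=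
    fun α hα => sum_norm_sq_curlW_le (E t) (hpred hα)
  refine ⟨_, (hd0.add hdt).add (((hd1.const_mul _).add (hd2.const_mul _)).add
    (hd3.const_mul _)), ?_⟩
  simp only [Finset.sum_add_distrib, ← Finset.mul_sum] at hbt
  -- The damping in `L²` and of all `∂ᵢ∂^α` with `|α| ≤ m` together covers the full `H^s` norms of
  -- `u` and `Θ`.
  have hcov : A ≤ (∑ j, ‖fnW (u t j)‖ ^ 2 + 3 / 2 * ‖fnW (Θ t)‖ ^ 2)
      + (∑ i, ∑ α ∈ multiIndices m, ∑ j, ‖dW (unitIndex i + α) (u t j)‖ ^ 2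
        + 3 / 2 * ∑ i, ∑ α ∈ multiIndices m, ‖dW (unitIndex i + α) (Θ t)‖ ^ 2) := by
    have h1 := sum_sq_le_sum (u t)
    have h2 := norm_sq_le_sum (Θ t)
    have h3 : 0 ≤ ∑ i, ∑ α ∈ multiIndices m, ‖dW (unitIndex i + α) (Θ t)‖ ^ 2 :=
      Finset.sum_nonneg fun _ _ => Finset.sum_nonneg fun _ _ => sq_nonneg _
    rw [hA]
    linarith [sq_nonneg ‖fnW (Θ t)‖]
  have hCt : ∑ i, ∑ α ∈ multiIndices m, C i α * (M * K ^ 2)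
      ≤ (∑ i, ∑ α ∈ multiIndices m, C i α) * (M * D) := by
    simp only [← Finset.sum_mul]
    refine mul_le_mul_of_nonneg_left ?_ (Finset.sum_nonneg fun i _ =>
      Finset.sum_nonneg fun α hα => hC i α hα)
    gcongr
    rw [hK2]
    linarith
  have h0 : d0 + dt ≤ -2 * A + (18 * δ + (∑ i, ∑ α ∈ multiIndices m, C i α) * (M * D)) := by
    linarith
  have hnA : idxCard m * A ≤ idxCard m * (A + R) := by gcongr; linarith
  have hnn : ∀ {x : ℝ}, 0 ≤ x → 0 ≤ idxCard m * x := fun hx => mul_nonneg (by linarith) hx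
  have h1 : d1 ≤ -(1 / 2) * R + 20 * idxCard m * A + 6 * (idxCard m * δ) := by
    refine hb1.trans ?_
    rw [Finset.sum_add_distrib, Finset.sum_add_distrib, ← Finset.mul_sum, Finset.sum_const,
      Finset.sum_const, nsmul_eq_mul, nsmul_eq_mul, ← idxCard, Finset.sum_add_distrib]
    have h2 := norm_sq_le_sum (ρ t)
    have h3 : ‖fnW (ρ t)‖ ^ 2 ≤ ∑ α ∈ multiIndices m, ‖dW α (ρ t)‖ ^ 2 := by
      rw [← dW_zero]
      exact Finset.single_le_sum (f := fun α => ‖dW α (ρ t)‖ ^ 2) (fun _ _ => sq_nonneg _)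
        (zero_mem_multiIndices m)
    rw [Finset.sum_comm] at h2
    linarith [hnn hA0]
  have h2 : d2 ≤ -(1 / 2) * Ne + 20 * idxCard m * (A + R) + 20 * idxCard m * (√A * √Nb)
      + 6 * (idxCard m * δ) := by
    refine hb2.trans ?_
    rw [Finset.sum_add_distrib, Finset.sum_add_distrib, Finset.sum_add_distrib, ← Finset.mul_sum,
      Finset.sum_const, Finset.sum_const, Finset.sum_const, nsmul_eq_mul, nsmul_eq_mul,
      nsmul_eq_mul, ← idxCard]
    have : 0 ≤ √A * √Nb := mul_nonneg (Real.sqrt_nonneg _) (Real.sqrt_nonneg _)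
    linarith [hnn (add_nonneg hA0 hR0), hnn this]
  have h3 : d3 ≤ -(1 / 2) * Nb + 20 * idxCard m * (A + Ne) + 3 * (idxCard m * δ) := by
    have h4 : ∑ α ∈ multiIndices (m - 1), (∑ j, ‖dW α (curlW (E t) j)‖ ^ 2 + ∑ j, ‖u t j‖ ^ 2
        + 3 * δ) ≤ idxCard m * (12 * Ne + A + 3 * δ) :=
      sum_idx_pred_le (by linarith) fun α hα => by
        linarith [hE12 α hα, sq_nonneg ‖Θ t‖]
    simp only [add_assoc] at hb3 h4
    rw [Finset.sum_add_distrib, ← Finset.mul_sum] at hb3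
    linarith [hnn hA0, hnn hNe0]
  -- `L = 20 · idxCard m` exceeds all coefficients that arise by summing the interaction estimates
  -- over the multi-indices, and `epsW` is defined from this `L`.
  have key := combine_dissipation (ε := epsW m) (L := 20 * idxCard m) (by linarith) rfl hA0 hR0
    hNe0 (Real.sq_sqrt hA0) (Real.sq_sqrt hNb0) (by linarith [hnn hδ0]) (by linarith [hnn hδ0])
    (by linarith [hnn hδ0]) h0 h1 h2 h3
  rw [hD]
  refine key.trans ?_
  rw [← hD]
  have h5 : (18 + 15 * idxCard m) * δ ≤ (18 + 15 * idxCard m) * (9 * mulConst m * (M * D)) := by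
    gcongr
  linarith

end

/-! ### Components of vector fields -/

section
variable {V : Type} [NormedAddCommGroup V] [InnerProductSpace ℝ V]

theorem IsWeakDeriv.compLp {α : MultiIndex} {f g : Lp V 2 (volume : Measure Vec)}
    [CompleteSpace V] (h : IsWeakDeriv α f g) (L : V →L[ℝ] ℝ) :
    IsWeakDeriv α (L.compLp f) (L.compLp g) := by
  have key : ∀ (ψ : Vec → ℝ) (hψ : IsTest ψ) (k : Lp V 2 (volume : Measure Vec)),
      ∫ x, ψ x • L.compLp k x = L (∫ x, ψ x • k x) := by
    intro ψ hψ k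
    rw [← ContinuousLinearMap.integral_comp_comm _ (hψ.integrable_smul k)]
    refine integral_congr_ae ?_
    filter_upwards [L.coeFn_compLp k] with x hx
    rw [hx, map_smul]
  intro φ hφ
  rw [key _ (hφ.iterPartial α), key _ hφ, h φ hφ, map_smul]

variable {k : ℕ} [CompleteSpace V]

/-- The composition of a linear functional with a vector-valued function in `H^k`. -/
def Sobolev.compLp (L : V →L[ℝ] ℝ) (F : Sobolev k V) : X k :=
  Sobolev.mk (fun α => L.compLp (F.D α)) fun _ hα => (F.isWeakDeriv hα).compLp L

theorem Sobolev.compLp_D (L : V →L[ℝ] ℝ) (F : Sobolev k V) {α : MultiIndex} (hα : α.order ≤ k) :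
    (F.compLp L).D α = L.compLp (F.D α) := Sobolev.mk_D hα

theorem Sobolev.norm_compLp_le (L : V →L[ℝ] ℝ) (F : Sobolev k V) :
    ‖F.compLp L‖ ≤ ‖L‖ * ‖F‖ := by
  refine abs_le_of_sq_le_sq' ?_ (by positivity) |>.2
  rw [mul_pow, Sobolev.norm_sq, Sobolev.norm_sq, Finset.mul_sum]
  refine Finset.sum_le_sum fun α hα => ?_
  rw [Sobolev.compLp_D L F (order_le hα), ← mul_pow]
  gcongr
  exact L.norm_compLp_le _

/-- The composition with a linear functional, as a continuous linear map. -/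
def Sobolev.compLpL (L : V →L[ℝ] ℝ) : Sobolev k V →L[ℝ] W k :=
  LinearMap.mkContinuous
    { toFun := fun F => ofX (F.compLp L)
      map_add' := fun F G => by
        rw [← map_add]
        congr 1
        refine Sobolev.ext_D fun α hα => ?_
        rw [Sobolev.D_add, Sobolev.compLp_D _ _ hα, Sobolev.compLp_D _ _ hα,
          Sobolev.compLp_D _ _ hα, Sobolev.D_add]
        exact map_add (L.compLpL 2 volume) _ _
      map_smul' := fun c F => by
        rw [RingHom.id_apply, ← map_smul]
        congr 1
        refine Sobolev.ext_D fun α hα => ?_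
        rw [Sobolev.D_smul, Sobolev.compLp_D _ _ hα, Sobolev.compLp_D _ _ hα,
          Sobolev.D_smul]
        exact map_smul (L.compLpL 2 volume) _ _ } ‖L‖
    fun F => (ofX.norm_map _).trans_le (F.norm_compLp_le L)

theorem Sobolev.compLpL_apply (L : V →L[ℝ] ℝ) (F : Sobolev k V) :
    Sobolev.compLpL L F = ofX (F.compLp L) := rfl

end

/-- The `i`-th component of a square-integrable vector field. -/
def coordL (i : Fin 3) : Lp Vec 2 (volume : Measure Vec) →L[ℝ] L2 :=
  (EuclideanSpace.proj i : Vec →L[ℝ] ℝ).compLpL 2 volume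

theorem coeFn_coordL (i : Fin 3) (f : Lp Vec 2 (volume : Measure Vec)) :
    coordL i f =ᵐ[volume] fun x => f x i :=
  (EuclideanSpace.proj i : Vec →L[ℝ] ℝ).coeFn_compLp f

theorem norm_sq_eq_sum_coordL (f : Lp Vec 2 (volume : Measure Vec)) :
    ‖f‖ ^ 2 = ∑ i, ‖coordL i f‖ ^ 2 := by
  have h : ∀ i, ‖coordL i f‖ ^ 2 = ∫ x, coordL i f x * coordL i f x := fun i => by
    rw [← real_inner_self_eq_norm_sq, inner_L2]
  simp only [h]
  rw [← integral_finsetSum _ fun i _ =>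
    (L2.integrable_inner (𝕜 := ℝ) (coordL i f) (coordL i f)).congr (by
      filter_upwards with x
      simp [sq]), ← real_inner_self_eq_norm_sq, L2.inner_def]
  refine integral_congr_ae ?_
  filter_upwards [coeFn_coordL 0 f, coeFn_coordL 1 f, coeFn_coordL 2 f] with x h0 h1 h2
  rw [Fin.sum_univ_three, h0, h1, h2, PiLp.inner_apply, Fin.sum_univ_three]
  simp [sq]

section
variable {k l : ℕ}

/-- The `i`-th component of a vector field in `H^k`. -/
def compW (i : Fin 3) : Sobolev k Vec →L[ℝ] W k :=
  Sobolev.compLpL (EuclideanSpace.proj i : Vec →L[ℝ] ℝ)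

theorem dW_compW (i : Fin 3) (F : Sobolev k Vec) {α : MultiIndex} (hα : α.order ≤ k) :
    dW α (compW i F) = coordL i (F.D α) := by
  rw [dW_toX, compW, Sobolev.compLpL_apply, toX_ofX, Sobolev.compLp_D _ _ hα]
  rfl

theorem fnW_compW (i : Fin 3) (F : Sobolev k Vec) : fnW (compW i F) = coordL i F.fn := by
  rw [← dW_zero, dW_compW _ _ (by simp), Sobolev.fn]

theorem norm_sq_eq_sum_compW (F : Sobolev k Vec) : ‖F‖ ^ 2 = ∑ i, ‖compW i F‖ ^ 2 := by
  rw [Sobolev.norm_sq]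
  simp only [norm_sq_W]
  rw [Finset.sum_comm]
  refine Finset.sum_congr rfl fun α hα => ?_
  rw [norm_sq_eq_sum_coordL]
  exact Finset.sum_congr rfl fun i _ => by rw [dW_compW i F (order_le hα)]

theorem compW_incl (i : Fin 3) (h : l ≤ k) (F : Sobolev k Vec) :
    compW i (F.incl h) = inclW h (compW i F) := by
  apply ext_fnW
  rw [fnW_inclW, fnW_compW, fnW_compW, Sobolev.fn, Sobolev.incl_D _ _ (by simp), Sobolev.fn]

theorem ofX_incl (h : l ≤ k) (f : X k) : ofX (f.incl h) = inclW h (ofX f) := by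
  apply ext_fnW
  rw [fnW_inclW, fnW_toX, fnW_toX, toX_ofX, toX_ofX, Sobolev.fn, Sobolev.incl_D _ _ (by simp),
    Sobolev.fn]

theorem coeFn_compW (i : Fin 3) (F : Sobolev k Vec) :
    fnW (compW i F) =ᵐ[volume] fun x => F.fn x i := by
  rw [fnW_compW]
  exact coeFn_coordL i F.fn

theorem coeFn_pdW_compW (i j : Fin 3) (h : l + 1 ≤ k) (F : Sobolev k Vec) :
    fnW (pdW i h (compW j F)) =ᵐ[volume] fun x => F.pd i x j := by
  rw [fnW_pdW, dW_compW _ _ (by rw [order_unitIndex]; omega)]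
  exact coeFn_coordL j _

theorem fnW_pdW_ofX (i : Fin 3) (h : l + 1 ≤ k) (f : X k) : fnW (pdW i h (ofX f)) = f.pd i := by
  rw [fnW_pdW, dW_toX, toX_ofX]
  rfl

theorem fnW_ofX (f : X k) : fnW (ofX f) = f.fn := by rw [fnW_toX, toX_ofX]

theorem gradNormSq_eq (F : Sobolev k Vec) (h : l + 1 ≤ k) : F.gradNormSq l
    = ∑ i, ∑ β ∈ multiIndices l, ∑ j, ‖dW (unitIndex i + β) (compW j F)‖ ^ 2 := by
  refine Finset.sum_congr rfl fun i _ => Finset.sum_congr rfl fun β hβ => ?_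
  have e : β + Pi.single i 1 = unitIndex i + β := add_comm _ _
  rw [e, norm_sq_eq_sum_coordL]
  refine Finset.sum_congr rfl fun j _ => ?_
  rw [dW_compW]
  rw [order_add, order_unitIndex]
  have := order_le hβ
  omega

theorem norm_sq_fn_eq (F : Sobolev k Vec) : ‖F.fn‖ ^ 2 = ∑ j, ‖fnW (compW j F)‖ ^ 2 := by
  rw [norm_sq_eq_sum_coordL]
  exact Finset.sum_congr rfl fun j _ => by rw [fnW_compW]

end

/-! ### Time regularity -/

section
variable {m : ℕ} {V : Type} [NormedAddCommGroup V] [InnerProductSpace ℝ V] {T : ℝ}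

/-- The time derivative of a path on `[0, T)`, one-sided at `0`. -/
def pathDeriv (T : ℝ) (f : ℝ → Sobolev (m + 1) V) (t : ℝ) : Sobolev m V :=
  derivWithin (fun τ => (f τ).incl (Nat.le_succ m)) (Ico 0 T) t

theorem IsRegularPath.regPath {f : ℝ → Sobolev (m + 1) V} (h : IsRegularPath T f)
    (L : Sobolev (m + 1) V →L[ℝ] W (m + 1)) (L' : Sobolev m V →L[ℝ] W m)
    (hL : ∀ f, L' (f.incl (Nat.le_succ m)) = inclW (Nat.le_succ m) (L f)) :
    RegPath (Ico 0 T) (fun t => L (f t)) (fun t => L' (pathDeriv T f t)) where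
  cont := L.continuous.comp_continuousOn h.1
  deriv t ht := by
    have h2 : ContDiffOn ℝ 1 (fun t => (f t).incl (Nat.le_succ m)) (Ico 0 T) := h.2
    have h3 := (h2.differentiableOn one_ne_zero t ht).hasDerivWithinAt
    simp only [← hL]
    exact L'.hasFDerivAt.comp_hasDerivWithinAt t h3
  cont' := by
    have h2 : ContDiffOn ℝ 1 (fun t => (f t).incl (Nat.le_succ m)) (Ico 0 T) := h.2
    exact L'.continuous.comp_continuousOn
      (h2.continuousOn_derivWithin (uniqueDiffOn_Ico 0 T) le_rfl)

/-- The equations use the two-sided derivative, which at interior times agrees with the one-sided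
derivative of the path on `[0, T)`. -/
theorem timeDeriv_eq (f : ℝ → Sobolev (m + 1) V) {t : ℝ} (ht : t ∈ Ioo 0 T) :
    timeDeriv f t = (pathDeriv T f t).fn := by
  rw [pathDeriv, derivWithin_of_mem_nhds (Ico_mem_nhds ht.1 ht.2)]
  rfl

/-- The system is assumed for positive times only; continuity carries each equation to `t = 0`,
where the energy inequality is also claimed. -/
theorem eqOn_Ico_of_eqOn_Ioo {Y : Type*} [TopologicalSpace Y] [T2Space Y] {f g : ℝ → Y}
    (hf : ContinuousOn f (Ico 0 T)) (hg : ContinuousOn g (Ico 0 T)) (h : EqOn f g (Ioo 0 T)) :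
    EqOn f g (Ico 0 T) := by
  rcases le_or_gt T 0 with hT | hT
  · rw [Ico_eq_empty (not_lt.2 hT)]
    exact eqOn_empty _ _
  · refine h.of_subset_closure hf hg Ioo_subset_Ico_self ?_
    rw [closure_Ioo hT.ne]
    exact Ico_subset_Icc_self

end

/-! ### Pointwise representatives -/

section Rep
variable {k l : ℕ}

/-- The function `φ` represents `f`. -/
def Rep (f : W k) (φ : Vec → ℝ) : Prop := fnW f =ᵐ[volume] φ

theorem Rep.add {f g : W k} {φ ψ : Vec → ℝ} (hf : Rep f φ) (hg : Rep g ψ) :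
    Rep (f + g) (fun x => φ x + ψ x) := by
  rw [Rep, map_add]
  filter_upwards [Lp.coeFn_add (fnW f) (fnW g), hf, hg] with x h1 h2 h3
  rw [h1, Pi.add_apply, h2, h3]

theorem Rep.neg {f : W k} {φ : Vec → ℝ} (hf : Rep f φ) : Rep (-f) (fun x => -φ x) := by
  rw [Rep, map_neg]
  filter_upwards [Lp.coeFn_neg (fnW f), hf] with x h1 h2
  rw [h1, Pi.neg_apply, h2]

theorem Rep.sub {f g : W k} {φ ψ : Vec → ℝ} (hf : Rep f φ) (hg : Rep g ψ) :
    Rep (f - g) (fun x => φ x - ψ x) := by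
  simpa only [sub_eq_add_neg] using hf.add hg.neg

theorem Rep.smul (c : ℝ) {f : W k} {φ : Vec → ℝ} (hf : Rep f φ) :
    Rep (c • f) (fun x => c * φ x) := by
  rw [Rep, map_smul]
  filter_upwards [Lp.coeFn_smul c (fnW f), hf] with x h1 h2
  rw [h1, Pi.smul_apply, h2, smul_eq_mul]

theorem Rep.sum {f : Fin 3 → W k} {φ : Fin 3 → Vec → ℝ} (h : ∀ j, Rep (f j) (φ j)) :
    Rep (∑ j, f j) (fun x => ∑ j, φ j x) := by
  simpa only [Fin.sum_univ_three] using ((h 0).add (h 1)).add (h 2)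

theorem Rep.inclW {f : W k} {φ : Vec → ℝ} (hf : Rep f φ) (h : l ≤ k) :
    Rep (EulerMaxwell.inclW h f) φ := by
  rw [Rep, fnW_inclW]
  exact hf

theorem Rep.zero : Rep (0 : W k) (fun _ => 0) := by
  rw [Rep, map_zero]
  exact Lp.coeFn_zero ℝ 2 volume

theorem Rep.eq {f g : W k} {φ ψ : Vec → ℝ} (hf : Rep f φ) (hg : Rep g ψ)
    (h : φ =ᵐ[volume] ψ) : f = g :=
  ext_fnW (Lp.ext ((hf.trans h).trans hg.symm))

theorem rep_compW (j : Fin 3) (F : Sobolev k Vec) : Rep (compW j F) (fun x => F.fn x j) :=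
  coeFn_compW j F

theorem rep_pdW_compW (i j : Fin 3) (h : l + 1 ≤ k) (F : Sobolev k Vec) :
    Rep (pdW i h (compW j F)) (fun x => F.pd i x j) :=
  coeFn_pdW_compW i j h F

/-- The identification of the two copies of `H^k`, as a continuous linear map. -/
def scalW : X k →L[ℝ] W k := (ofX : X k ≃ₗᵢ[ℝ] W k).toContinuousLinearEquiv.toContinuousLinearMap

theorem scalW_apply (f : X k) : scalW f = ofX f := rfl

theorem norm_scalW (f : X k) : ‖scalW f‖ = ‖f‖ := ofX.norm_map f

theorem rep_scalW (f : X k) : Rep (scalW f) (fun x => f.fn x) := by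
  rw [Rep, scalW_apply, fnW_ofX]

theorem rep_pdW_scalW (i : Fin 3) (h : l + 1 ≤ k) (f : X k) :
    Rep (pdW i h (scalW f)) (fun x => f.pd i x) := by
  rw [Rep, scalW_apply, fnW_pdW_ofX]

theorem rep_curlW {m : ℕ} (F : Sobolev (m + 1) Vec) (j : Fin 3) :
    Rep (curlW (fun j => compW j F) j) (fun x => curl F x j) := by
  have h := (rep_pdW_compW (j + 1) (j + 2) le_rfl F).sub (rep_pdW_compW (j + 2) (j + 1) le_rfl F)
  refine Filter.EventuallyEq.trans h (Eventually.of_forall fun x => ?_)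
  fin_cases j <;> simp [curl]

variable {m : ℕ} [hm : Fact (3 ≤ m)]

theorem Rep.mulM {f : W (m + 1)} {g : W m} {φ ψ : Vec → ℝ} (hf : Rep f φ) (hg : Rep g ψ) :
    Rep (EulerMaxwell.mulM f g) (fun x => φ x * ψ x) := by
  have h : Rep (EulerMaxwell.mulM f g) (fun x => fnW f x * fnW g x) := coeFn_mulX _ f g
  refine h.trans ?_
  filter_upwards [hf, hg] with x h1 h2
  rw [h1, h2]

theorem Rep.mulT {f g : W (m + 1)} {φ ψ : Vec → ℝ} (hf : Rep f φ) (hg : Rep g ψ) :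
    Rep (EulerMaxwell.mulT f g) (fun x => φ x * ψ x) := by
  have h : Rep (EulerMaxwell.mulT f g) (fun x => fnW f x * fnW g x) := coeFn_mulX _ f g
  refine h.trans ?_
  filter_upwards [hf, hg] with x h1 h2
  rw [h1, h2]

end Rep

/-! ### From solutions to coordinates -/

section Solution
variable {m : ℕ} [hm : Fact (3 ≤ m)] {T : ℝ} {U : ℝ → State (m + 1)} {t : ℝ}

/-- The vector `(1 + Θ) / (1 + ρ) ∇ρ`, expressed through the momentum equation. -/
def pressW (T : ℝ) (U : ℝ → State (m + 1)) (t : ℝ) (j : Fin 3) : W m :=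
  -pdW j le_rfl (scalW (U t).Θ)
    - ∑ k, mulM (compW k (U t).u) (pdW k le_rfl (compW j (U t).u))
    - inclW (Nat.le_succ m) (compW j (U t).E) - inclW (Nat.le_succ m) (compW j (U t).u)
    - inclW (Nat.le_succ m) (crossW (fun j => compW j (U t).u) (fun j => compW j (U t).B) j)
    - compW j (pathDeriv T (fun τ => (U τ).u) t)

theorem rep_crossW (a b : Sobolev (m + 1) Vec) (j : Fin 3) :
    Rep (crossW (fun j => compW j a) (fun j => compW j b) j)
      (fun x => cross (a.fn x) (b.fn x) j) := by
  have h := ((rep_compW (j + 1) a).mulT (rep_compW (j + 2) b)).sub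
    ((rep_compW (j + 2) a).mulT (rep_compW (j + 1) b))
  refine Filter.EventuallyEq.trans h (Eventually.of_forall fun x => ?_)
  fin_cases j <;> simp [cross, crossProduct]

theorem IsSolution.rep_pressW (hU : IsSolution T U) (ht : t ∈ Ioo 0 T) (j : Fin 3) :
    Rep (pressW T U t j)
      (fun x => (1 + (U t).Θ.fn x) / (1 + (U t).ρ.fn x) * (U t).ρ.pd j x) := by
  have h := (((((rep_pdW_scalW j (le_refl (m + 1)) (U t).Θ).neg.sub
    (Rep.sum fun k => (rep_compW k (U t).u).mulM (rep_pdW_compW k j le_rfl (U t).u))).sub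
    ((rep_compW j (U t).E).inclW (Nat.le_succ m))).sub
    ((rep_compW j (U t).u).inclW (Nat.le_succ m))).sub
    ((rep_crossW (U t).u (U t).B j).inclW (Nat.le_succ m))).sub
    (rep_compW j (pathDeriv T (fun τ => (U τ).u) t))
  refine Filter.EventuallyEq.trans h ?_
  filter_upwards [hU.momentum t ht] with x hx
  rw [timeDeriv_eq _ ht] at hx
  have := congrArg (fun v : Vec => v j) hx
  simp [advect, grad, Fin.sum_univ_three] at this
  simp only [Fin.sum_univ_three]
  linarith

/-- By the embedding `|ρ| ≤ 1/2` almost everywhere. So the quotient in the momentum equation is a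
genuine one and may be multiplied by `1 + ρ`. -/
theorem IsSolution.one_add_ne_zero (hρ : mulConst m * ‖(U t).ρ‖ ≤ 1 / 2) :
    ∀ᵐ x : Vec, 1 + (U t).ρ.fn x ≠ 0 := by
  have h2 : 2 ≤ m + 1 := by have := hm.out; omega
  have h := ae_abs_le ((U t).ρ.incl h2)
  have e : ((U t).ρ.incl h2).fn = (U t).ρ.fn := Sobolev.incl_D h2 _ (by simp)
  rw [e] at h
  filter_upwards [h] with x hx
  have h3 : ‖(U t).ρ.incl h2‖ ≤ ‖(U t).ρ‖ := by
    rw [← inclL_eq_incl]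
    exact norm_inclL_le h2 _
  have h4 : embConst * ‖(U t).ρ.incl h2‖ ≤ mulConst m * ‖(U t).ρ‖ :=
    mul_le_mul embConst_le_mulConst h3 (norm_nonneg _) (zero_le_one.trans one_le_mulConst)
  have := (abs_le.1 (hx.trans (h4.trans hρ))).1
  intro h0
  linarith

theorem opM_fnW (g : W m) (f : W (m + 1)) : opM g (fnW f) = fnW (mulM f g) := by
  refine Lp.ext ((coeFn_opM g (fnW f)).trans ?_)
  have h : Rep (mulM f g) (fun x => fnW f x * fnW g x) := coeFn_mulX _ f g
  exact (h.trans (Eventually.of_forall fun x => mul_comm _ _)).symm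

theorem opT_fnW (f : W (m + 1)) (g : W m) : opT f (fnW g) = fnW (mulM f g) := by
  have h : Rep (mulM f g) (fun x => fnW f x * fnW g x) := coeFn_mulX _ f g
  exact Lp.ext ((coeFn_opT f (fnW g)).trans h.symm)

theorem wd_op (g f : W (m + 1)) (j : Fin 3) :
    WD j (op g (fnW f)) (fnW (pdW j le_rfl f + mulM g (pdW j le_rfl f)
      + mulM f (pdW j le_rfl g))) := by
  have h1 : (1 : ℕ) ≤ m + 1 := by omega
  have a := wd_opT g j (inclW h1 f)
  have b := wd_W1 j (inclW h1 f)
  have e : dW (unitIndex j) (inclW h1 f) = fnW (pdW j (le_refl (m + 1)) f) := by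
    rw [dW_inclW h1 (by rw [order_unitIndex]), fnW_pdW]
  rw [e, fnW_inclW] at a b
  rw [opM_fnW, opT_fnW] at a
  refine WD_iff.2 fun φ h => ?_
  have a' := WD_iff.1 a φ h
  have b' := WD_iff.1 b φ h
  rw [inner_add_right] at a'
  rw [op_apply, inner_add_right, a', b', map_add, map_add, inner_add_right, inner_add_right]
  ring

/-- The distributional divergence of `(1+ρ)u` is expanded by the product rule of `wd_op`; equality
of all pairings with test functions gives equality in `H^m`. -/
theorem IsSolution.mass_eq (hU : IsSolution T U) (ht : t ∈ Ioo 0 T) :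
    scalW (pathDeriv T (fun τ => (U τ).ρ) t)
      = -∑ j, (pdW j le_rfl (compW j (U t).u)
        + mulM (scalW (U t).ρ) (pdW j le_rfl (compW j (U t).u))
        + mulM (compW j (U t).u) (pdW j le_rfl (scalW (U t).ρ))) := by
  have wd := fun j => wd_op (scalW (U t).ρ) (compW j (U t).u) j
  refine ext_fnW (L2.eq_of_inner_test fun φ h => ?_)
  have hm := hU.mass t ht φ h
  rw [timeDeriv_eq _ ht] at hm
  have l : ∫ x, ∑ i, partialDeriv i φ x * ((1 + (U t).ρ.fn x) • (U t).u.fn x) i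
      = ∑ i, ⟪(h.partialDeriv i).toL2, op (scalW (U t).ρ) (fnW (compW i (U t).u))⟫_ℝ := by
    simp_rw [IsTest.inner_toL2]
    rw [← integral_finsetSum _ fun i _ => (h.partialDeriv i).integrable_smul _]
    have hop : ∀ i, op (scalW (U t).ρ) (fnW (compW i (U t).u)) =ᵐ[volume]
        fun x => (1 + (U t).ρ.fn x) * (U t).u.fn x i := by
      intro i
      rw [op_apply]
      filter_upwards [Lp.coeFn_add (fnW (compW i (U t).u))
        (opT (scalW (U t).ρ) (fnW (compW i (U t).u))), coeFn_opT (scalW (U t).ρ)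
        (fnW (compW i (U t).u)), rep_scalW (U t).ρ, rep_compW i (U t).u] with x h1 h2 h3 h4
      rw [h1, Pi.add_apply, h2, h3, h4]
      ring
    refine integral_congr_ae ?_
    filter_upwards [hop 0, hop 1, hop 2] with x h0 h1 h2
    simp [Fin.sum_univ_three, h0, h1, h2]
  have r : ∫ x, φ x * -(pathDeriv T (fun τ => (U τ).ρ) t).fn x
      = -⟪h.toL2, fnW (scalW (pathDeriv T (fun τ => (U τ).ρ) t))⟫_ℝ := by
    rw [IsTest.inner_toL2, scalW_apply, fnW_ofX, ← integral_neg]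
    exact integral_congr_ae (Eventually.of_forall fun x => by simp)
  rw [l, r, neg_neg] at hm
  rw [← hm, map_neg, inner_neg_right, map_sum, inner_sum, ← Finset.sum_neg_distrib]
  exact Finset.sum_congr rfl fun j _ => WD_iff.1 (wd j) φ h

end Solution

/-! ### The coordinate form of the system -/

section Flow
variable {m : ℕ} {T : ℝ} {U : ℝ → State (m + 1)} {t : ℝ}

theorem IsSolution.faraday_eq (hU : IsSolution T U) (ht : t ∈ Ioo 0 T) (j : Fin 3) :
    compW j (pathDeriv T (fun τ => (U τ).B) t) = -curlW (fun j => compW j (U t).E) j := by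
  refine (rep_compW j _).eq (rep_curlW (U t).E j).neg ?_
  filter_upwards [hU.faraday t ht] with x hx
  rw [timeDeriv_eq _ ht] at hx
  have := congrArg (fun v : Vec => v j) hx
  simp only [PiLp.add_apply, PiLp.zero_apply] at this
  linarith

theorem IsSolution.gaussE_eq (hU : IsSolution T U) (ht : t ∈ Ioo 0 T) :
    ∑ j, pdW j (le_refl (m + 1)) (compW j (U t).E) = -inclW (Nat.le_succ m) (scalW (U t).ρ) :=
  (Rep.sum fun j => rep_pdW_compW j j (le_refl (m + 1)) (U t).E).eq
    ((rep_scalW (U t).ρ).inclW (Nat.le_succ m)).neg (hU.gauss_E t ht)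

theorem IsSolution.gaussB_eq (hU : IsSolution T U) (ht : t ∈ Ioo 0 T) :
    ∑ j, pdW j (le_refl (m + 1)) (compW j (U t).B) = 0 :=
  (Rep.sum fun j => rep_pdW_compW j j (le_refl (m + 1)) (U t).B).eq Rep.zero (hU.gauss_B t ht)

variable [hm : Fact (3 ≤ m)]

theorem IsSolution.pressure_eq (hU : IsSolution T U) (ht : t ∈ Ioo 0 T)
    (hρ : mulConst m * ‖(U t).ρ‖ ≤ 1 / 2) (j : Fin 3) :
    pressW T U t j + mulM (scalW (U t).ρ) (pressW T U t j)
      = pdW j le_rfl (scalW (U t).ρ) + mulM (scalW (U t).Θ) (pdW j le_rfl (scalW (U t).ρ)) := by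
  have hP := hU.rep_pressW ht j
  have hd := rep_pdW_scalW j (le_refl (m + 1)) (U t).ρ
  refine (hP.add ((rep_scalW (U t).ρ).mulM hP)).eq (hd.add ((rep_scalW (U t).Θ).mulM hd)) ?_
  filter_upwards [IsSolution.one_add_ne_zero hρ] with x hx
  field_simp

theorem IsSolution.temperature_eq (hU : IsSolution T U) (ht : t ∈ Ioo 0 T) :
    scalW (pathDeriv T (fun τ => (U τ).Θ) t)
      = -∑ j, ((2 / 3 : ℝ) • (pdW j le_rfl (compW j (U t).u)
          + mulM (scalW (U t).Θ) (pdW j le_rfl (compW j (U t).u)))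
        + mulM (compW j (U t).u) (pdW j le_rfl (scalW (U t).Θ)))
        - inclW (Nat.le_succ m) (scalW (U t).Θ)
        + inclW (Nat.le_succ m)
          ((1 / 3 : ℝ) • ∑ j, mulT (compW j (U t).u) (compW j (U t).u)) := by
  have hu := fun j => rep_compW j (U t).u
  have hd := fun j => rep_pdW_compW j j (le_refl (m + 1)) (U t).u
  have hΘ := rep_scalW (U t).Θ
  refine (rep_scalW _).eq ((((Rep.sum fun j => (((hd j).add (hΘ.mulM (hd j))).smul (2 / 3)).add
    ((hu j).mulM (rep_pdW_scalW j (le_refl (m + 1)) (U t).Θ))).neg.sub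
    (hΘ.inclW (Nat.le_succ m))).add
    (((Rep.sum fun j => (hu j).mulT (hu j)).smul (1 / 3)).inclW (Nat.le_succ m)))) ?_
  filter_upwards [hU.temperature t ht] with x hx
  rw [timeDeriv_eq _ ht, EuclideanSpace.real_norm_sq_eq] at hx
  simp only [advect, div, Fin.sum_univ_three, smul_eq_mul] at hx ⊢
  linarith

theorem IsSolution.ampere_eq (hU : IsSolution T U) (ht : t ∈ Ioo 0 T) (j : Fin 3) :
    compW j (pathDeriv T (fun τ => (U τ).E) t)
      = curlW (fun j => compW j (U t).B) j + inclW (Nat.le_succ m) (compW j (U t).u)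
        + inclW (Nat.le_succ m) (mulT (scalW (U t).ρ) (compW j (U t).u)) := by
  have hu := rep_compW j (U t).u
  refine (rep_compW j _).eq (((rep_curlW (U t).B j).add (hu.inclW (Nat.le_succ m))).add
    (((rep_scalW (U t).ρ).mulT hu).inclW (Nat.le_succ m))) ?_
  filter_upwards [hU.ampere t ht] with x hx
  rw [timeDeriv_eq _ ht] at hx
  have := congrArg (fun v : Vec => v j) hx
  simp only [PiLp.sub_apply, PiLp.smul_apply, smul_eq_mul] at this
  linarith

/-- The momentum equation is assumed at every time because it serves as definition of `P`. This
makes `P` continuous up to `t = 0`, so the pressure relation extends there by continuity like the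
other equations. -/
theorem Flow.of_Ioo {ρ Θ : ℝ → W (m + 1)} {u E B : ℝ → Fin 3 → W (m + 1)}
    {P : ℝ → Fin 3 → W m} {ρ' Θ' : ℝ → W m} {u' E' B' : ℝ → Fin 3 → W m}
    (rρ : RegPath (Ico 0 T) ρ ρ') (rΘ : RegPath (Ico 0 T) Θ Θ')
    (ru : ∀ j, RegPath (Ico 0 T) (fun t => u t j) (fun t => u' t j))
    (rE : ∀ j, RegPath (Ico 0 T) (fun t => E t j) (fun t => E' t j))
    (rB : ∀ j, RegPath (Ico 0 T) (fun t => B t j) (fun t => B' t j))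
    (hP : ∀ t, ∀ j, u' t j = -pdW j le_rfl (Θ t) - P t j
      - ∑ k, mulM (u t k) (pdW k le_rfl (u t j)) - inclW (Nat.le_succ m) (E t j)
      - inclW (Nat.le_succ m) (u t j) - inclW (Nat.le_succ m) (crossW (u t) (B t) j))
    (h : ∀ t ∈ Ioo 0 T,
      Eqs (ρ t) (Θ t) (u t) (E t) (B t) (P t) (ρ' t) (Θ' t) (u' t) (E' t) (B' t)) :
    Flow (Ico 0 T) ρ Θ u E B P ρ' Θ' u' E' B' := by
  have cρ := rρ.cont
  have cΘ := rΘ.cont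
  have cu := fun j => (ru j).cont
  have cE := fun j => (rE j).cont
  have cB := fun j => (rB j).cont
  have cP := continuousOn_of_momentum cΘ cu cE cB (fun j => (ru j).cont') fun t _ => hP t
  refine ⟨rρ, rΘ, ru, rE, rB, fun t ht => ⟨?_, hP t, fun j => ?_, ?_, fun j => ?_, fun j => ?_,
    ?_, ?_⟩⟩
  · refine eqOn_Ico_of_eqOn_Ioo rρ.cont' ?_ (fun t ht => (h t ht).mass) ht
    fun_prop
  · refine eqOn_Ico_of_eqOn_Ioo (f := fun t => P t j + mulM (ρ t) (P t j)) ?_ ?_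
      (fun t ht => (h t ht).pressure j) ht
    · fun_prop
    · fun_prop
  · refine eqOn_Ico_of_eqOn_Ioo rΘ.cont' ?_ (fun t ht => (h t ht).temperature) ht
    fun_prop
  · refine eqOn_Ico_of_eqOn_Ioo (rE j).cont' ?_ (fun t ht => (h t ht).ampere j) ht
    simp only [curlW]
    fun_prop
  · refine eqOn_Ico_of_eqOn_Ioo (rB j).cont' ?_ (fun t ht => (h t ht).faraday j) ht
    simp only [curlW]
    fun_prop
  · refine eqOn_Ico_of_eqOn_Ioo (f := fun t => ∑ j, pdW j le_rfl (E t j)) ?_ ?_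
      (fun t ht => (h t ht).gaussE) ht
    · fun_prop
    · fun_prop
  · refine eqOn_Ico_of_eqOn_Ioo (f := fun t => ∑ j, pdW j le_rfl (B t j)) ?_ continuousOn_const
      (fun t ht => (h t ht).gaussB) ht
    fun_prop

theorem IsSolution.flow (hU : IsSolution T U)
    (hρ : ∀ t ∈ Ico 0 T, mulConst m * ‖(U t).ρ‖ ≤ 1 / 2) :
    Flow (Ico 0 T) (fun t => scalW (U t).ρ) (fun t => scalW (U t).Θ)
      (fun t j => compW j (U t).u) (fun t j => compW j (U t).E) (fun t j => compW j (U t).B)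
      (pressW T U) (fun t => scalW (pathDeriv T (fun τ => (U τ).ρ) t))
      (fun t => scalW (pathDeriv T (fun τ => (U τ).Θ) t))
      (fun t j => compW j (pathDeriv T (fun τ => (U τ).u) t))
      (fun t j => compW j (pathDeriv T (fun τ => (U τ).E) t))
      (fun t j => compW j (pathDeriv T (fun τ => (U τ).B) t)) := by
  have hP : ∀ t j, compW j (pathDeriv T (fun τ => (U τ).u) t)
      = -pdW j le_rfl (scalW (U t).Θ) - pressW T U t j
      - ∑ k, mulM (compW k (U t).u) (pdW k le_rfl (compW j (U t).u))
      - inclW (Nat.le_succ m) (compW j (U t).E) - inclW (Nat.le_succ m) (compW j (U t).u)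
      - inclW (Nat.le_succ m)
        (crossW (fun j => compW j (U t).u) (fun j => compW j (U t).B) j) := by
    intro t j
    unfold pressW
    abel
  exact Flow.of_Ioo (hU.regular_ρ.regPath scalW scalW (ofX_incl _))
    (hU.regular_Θ.regPath scalW scalW (ofX_incl _))
    (fun j => hU.regular_u.regPath (compW j) (compW j) (compW_incl j _))
    (fun j => hU.regular_E.regPath (compW j) (compW j) (compW_incl j _))
    (fun j => hU.regular_B.regPath (compW j) (compW j) (compW_incl j _)) hP
    fun t ht => ⟨hU.mass_eq ht, hP t, hU.pressure_eq ht (hρ t (Ioo_subset_Ico_self ht)),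
      hU.temperature_eq ht, hU.ampere_eq ht, hU.faraday_eq ht, hU.gaussE_eq ht, hU.gaussB_eq ht⟩

end Flow

/-! ### The energy functional -/

section Functional
variable {m : ℕ}

/-- The dissipation of the coordinates of a state. -/
def State.diss (U : State (m + 1)) : ℝ :=
  dissW (scalW U.ρ) (scalW U.Θ) (fun j => compW j U.u) (fun j => compW j U.E)
    (fun j => compW j U.B)

theorem State.diss_eq (U : State (m + 1)) : U.diss = ‖U.ρ‖ ^ 2 + ‖U.u‖ ^ 2 + ‖U.Θ‖ ^ 2
      + (∑ α ∈ multiIndices m, ∑ j, ‖dW α (compW j U.E)‖ ^ 2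
        + ∑ β ∈ multiIndices (m - 1), ∑ j, ‖dW β (curlW (fun j => compW j U.B) j)‖ ^ 2) := by
  rw [State.diss, dissW, norm_scalW, norm_scalW, norm_sq_eq_sum_compW U.u]
  ring

theorem State.diss_nonneg (U : State (m + 1)) : 0 ≤ U.diss := by
  rw [U.diss_eq]
  positivity

theorem State.stateSq_eq (U : State (m + 1)) :
    stateSq (scalW U.ρ) (scalW U.Θ) (fun j => compW j U.u) (fun j => compW j U.E)
      (fun j => compW j U.B) = U.normSq := by
  simp only [stateSq, State.normSq, norm_sq_eq_sum_compW, norm_scalW]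

variable [hm : Fact (3 ≤ m)]

/-- The energy functional. -/
def State.energy (U : State (m + 1)) : ℝ :=
  energyW (scalW U.ρ) (scalW U.Θ) (fun j => compW j U.u) (fun j => compW j U.E)
    (fun j => compW j U.B)

theorem State.normSq_nonneg {k : ℕ} (U : State k) : 0 ≤ U.normSq := by
  unfold State.normSq
  positivity

theorem State.norm_sq {k : ℕ} (U : State k) : U.norm ^ 2 = U.normSq :=
  Real.sq_sqrt U.normSq_nonneg

theorem State.norm_nonneg {k : ℕ} (U : State k) : 0 ≤ U.norm := Real.sqrt_nonneg _

theorem State.norm_ρ_le {k : ℕ} (U : State k) : ‖U.ρ‖ ≤ U.norm := by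
  refine Real.le_sqrt_of_sq_le ?_
  unfold State.normSq
  have := sq_nonneg ‖U.u‖
  have := sq_nonneg ‖U.Θ‖
  have := sq_nonneg ‖U.E‖
  have := sq_nonneg ‖U.B‖
  linarith

theorem State.norm_Θ_le {k : ℕ} (U : State k) : ‖U.Θ‖ ≤ U.norm := by
  refine Real.le_sqrt_of_sq_le ?_
  unfold State.normSq
  have := sq_nonneg ‖U.u‖
  have := sq_nonneg ‖U.ρ‖
  have := sq_nonneg ‖U.E‖
  have := sq_nonneg ‖U.B‖
  linarith

theorem State.energy_bounds (U : State (m + 1)) (hU : mulConst m * U.norm ≤ 1 / 12) :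
    1 / 4 * U.norm ^ 2 ≤ U.energy ∧ U.energy ≤ 16 * idxCard m * U.norm ^ 2 := by
  rw [U.norm_sq, ← U.stateSq_eq]
  refine energyW_bounds ?_ ?_ hU
  · rw [norm_scalW]
    exact U.norm_ρ_le
  · rw [norm_scalW]
    exact U.norm_Θ_le

theorem State.dissipation_nonneg {k : ℕ} (U : State k) : 0 ≤ U.dissipation := by
  unfold State.dissipation Sobolev.gradNormSq
  positivity

/-- Only the magnetic part changes: Gauss's law for `B` replaces `∇B` by the curl. The dissipation
of `E` is counted once as a gradient and once in `L²`, whereas `State.diss` sums over multi-indices;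
this is why the two are merely comparable. -/
theorem State.dissipation_eq (U : State (m + 1))
    (hB : ∑ j, pdW j (le_refl (m + 1)) (compW j U.B) = 0) :
    U.dissipation = ‖U.ρ‖ ^ 2 + ‖U.u‖ ^ 2 + ‖U.Θ‖ ^ 2
      + (∑ i, ∑ β ∈ multiIndices (m - 1), ∑ j, ‖dW (unitIndex i + β) (compW j U.E)‖ ^ 2
        + ∑ β ∈ multiIndices (m - 1), ∑ j, ‖dW β (curlW (fun j => compW j U.B) j)‖ ^ 2)
      + ∑ j, ‖fnW (compW j U.E)‖ ^ 2 := by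
  have hm3 := hm.out
  have h : m - 1 + 1 ≤ m + 1 := by omega
  have e : m + 1 - 2 = m - 1 := by omega
  rw [State.dissipation, e, gradNormSq_eq U.E h, gradNormSq_eq U.B h, norm_sq_fn_eq,
    Finset.sum_comm (s := Finset.univ) (t := multiIndices (m - 1))
      (f := fun i β => ∑ j, ‖dW (unitIndex i + β) (compW j U.B)‖ ^ 2),
    Finset.sum_congr rfl fun β hβ => sum_norm_sq_eq_curlW hB (by have := order_le hβ; omega)]

theorem State.diss_le (U : State (m + 1))
    (hB : ∑ j, pdW j (le_refl (m + 1)) (compW j U.B) = 0) : U.diss ≤ U.dissipation := by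
  have hm3 := hm.out
  have h := sum_multiIndices_succ_le (k := m - 1)
    (fun α => ∑ j, ‖dW α (compW j U.E)‖ ^ 2) fun α => by positivity
  rw [Nat.sub_add_cancel (by omega : 1 ≤ m), dW_zero] at h
  rw [U.diss_eq, U.dissipation_eq hB]
  linarith

theorem State.dissipation_le (U : State (m + 1))
    (hB : ∑ j, pdW j (le_refl (m + 1)) (compW j U.B) = 0) :
    U.dissipation ≤ 5 * idxCard m * U.diss := by
  have hm3 := hm.out
  have hn := one_le_idxCard (m := m)
  set N := ∑ α ∈ multiIndices m, ∑ j, ‖dW α (compW j U.E)‖ ^ 2 with hN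
  have hle : ∀ α ∈ multiIndices m, ∑ j, ‖dW α (compW j U.E)‖ ^ 2 ≤ N := fun α hα =>
    Finset.single_le_sum (f := fun α => ∑ j, ‖dW α (compW j U.E)‖ ^ 2)
      (fun β _ => by positivity) hα
  have hN0 : 0 ≤ N := by positivity
  have h0 := hle 0 (zero_mem_multiIndices m)
  rw [dW_zero] at h0
  have h1 : ∑ i : Fin 3, ∑ β ∈ multiIndices (m - 1), ∑ j,
      ‖dW (unitIndex i + β) (compW j U.E)‖ ^ 2 ≤ 3 * (idxCard m * N) :=
    sum_fin_le fun i => sum_idx_pred_le hN0 fun β hβ => hle _ (mem_multiIndices.2 (by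
      have := order_le hβ
      rw [order_add, order_unitIndex]
      omega))
  have h2 : 0 ≤ ∑ β ∈ multiIndices (m - 1), ∑ j,
      ‖dW β (curlW (fun j => compW j U.B) j)‖ ^ 2 := by positivity
  have h3 : 0 ≤ ‖U.ρ‖ ^ 2 + ‖U.u‖ ^ 2 + ‖U.Θ‖ ^ 2 := by positivity
  rw [U.diss_eq, U.dissipation_eq hB, ← hN]
  nlinarith [mul_nonneg (sub_nonneg.2 hn) hN0, mul_nonneg (sub_nonneg.2 hn) h2,
    mul_nonneg (sub_nonneg.2 hn) h3]

-- The estimate in coordinates, expressed through the energy and the dissipation of the statement.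
variable (m) in
theorem exists_energy_inequality : ∃ C : ℝ, 0 < C ∧ ∀ {T : ℝ} {U : ℝ → State (m + 1)},
    IsSolution T U → (∀ t ∈ Ico 0 T, mulConst m * (U t).norm ≤ 1 / 12) → ∀ t ∈ Ico 0 T,
      DifferentiableWithinAt ℝ (fun τ => (U τ).energy) (Ico 0 T) t ∧
        derivWithin (fun τ => (U τ).energy) (Ico 0 T) t
            + epsW m ^ 3 / (20 * idxCard m) * (U t).dissipation
          ≤ C * (√(U t).energy + (U t).energy) * (U t).dissipation := by
  obtain ⟨C, hC, H⟩ := exists_energyW_deriv_le (m := m)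
  -- The factor `2` comes from `‖U‖ ≤ 2√𝓔`; adding `1` makes the constant positive.
  refine ⟨2 * C + 1, by positivity, fun {T U} hU hsmall t ht => ?_⟩
  have hc := one_le_mulConst (m := m)
  have hn := one_le_idxCard (m := m)
  have hε := epsW_pos (m := m)
  have hρ : ∀ t ∈ Ico 0 T, mulConst m * ‖(U t).ρ‖ ≤ 1 / 2 := fun t ht =>
    (mul_le_mul_of_nonneg_left (U t).norm_ρ_le (by linarith)).trans
      ((hsmall t ht).trans (by norm_num))
  have F := hU.flow hρ
  have hB := (F.eqs t ht).gaussB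
  have hs := hsmall t ht
  have hM0 := (U t).norm_nonneg
  -- `M` is taken as the norm at the time `t` itself, not as a uniform bound, so that it can be
  -- replaced by the energy at that time.
  obtain ⟨d, hd, hle⟩ := H F ht hM0 (by rw [(U t).stateSq_eq, (U t).norm_sq]) (by linarith)
  have hdw : derivWithin (fun τ => (U τ).energy) (Ico 0 T) t = d :=
    hd.derivWithin (uniqueDiffOn_Ico 0 T t ht)
  refine ⟨hd.differentiableWithinAt, ?_⟩
  rw [hdw]
  change d ≤ -(epsW m ^ 3 / 4) * (U t).diss + C * ((U t).norm * (U t).diss) at hle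
  have hE := ((U t).energy_bounds hs).1
  have hE0 : 0 ≤ (U t).energy := le_trans (by positivity) hE
  have hME : (U t).norm ≤ 2 * √(U t).energy := by
    have : (U t).norm / 2 ≤ √(U t).energy := Real.le_sqrt_of_sq_le (by linarith)
    linarith
  have hD := (U t).diss_le hB
  have hD' := (U t).dissipation_le hB
  have hW0 := (U t).diss_nonneg
  have hD0 := hW0.trans hD
  -- The rate combines the factor `ε³/4` in front of `State.diss` with the comparison constant `5 ·
  -- idxCard m`.
  have h1 : epsW m ^ 3 / (20 * idxCard m) * (U t).dissipation ≤ epsW m ^ 3 / 4 * (U t).diss := by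
    calc _ ≤ epsW m ^ 3 / (20 * idxCard m) * (5 * idxCard m * (U t).diss) := by gcongr
      _ = _ := by field_simp; ring
  have h2 : C * ((U t).norm * (U t).diss) ≤ C * (2 * √(U t).energy * (U t).dissipation) := by
    gcongr
  have h3 : 0 ≤ √(U t).energy * (U t).dissipation := by positivity
  have h4 : 0 ≤ (U t).energy * (U t).dissipation := by positivity
  have h5 : 0 ≤ C * ((U t).energy * (U t).dissipation) := by positivity
  nlinarith

end Functional

end EulerMaxwell

end

/-! ### The theorem with its constants. -/

open EulerMaxwell in
theorem theorem3p1 (s : ℕ) (hs : 4 ≤ s) :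
    ∃ (𝓔 𝓓 : State s → ℝ) (δ₀ κ γ C : ℝ),
      0 < δ₀ ∧ 0 < κ ∧ κ < 1 ∧ 0 < γ ∧ 0 < C ∧
      (∀ U : State s, U.norm ≤ δ₀ → κ * U.norm ^ 2 ≤ 𝓔 U ∧ 𝓔 U ≤ κ⁻¹ * U.norm ^ 2) ∧
      (∀ U : State s, κ * U.dissipation ≤ 𝓓 U ∧ 𝓓 U ≤ κ⁻¹ * U.dissipation) ∧
      ∀ δ : ℝ, δ ≤ δ₀ → ∀ T : ℝ, 0 < T → ∀ U : ℝ → State s,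
        IsSolution T U → (∀ t ∈ Set.Ico 0 T, (U t).norm ≤ δ) →
        ∀ t ∈ Set.Ico 0 T,
          DifferentiableWithinAt ℝ (fun τ => 𝓔 (U τ)) (Set.Ico 0 T) t ∧
          derivWithin (fun τ => 𝓔 (U τ)) (Set.Ico 0 T) t + γ * 𝓓 (U t)
            ≤ C * (√(𝓔 (U t)) + 𝓔 (U t)) * 𝓓 (U t) := by
  obtain ⟨m, rfl⟩ : ∃ m, s = m + 1 := ⟨s - 1, by omega⟩
  have : Fact (3 ≤ m) := ⟨by omega⟩
  have hc := one_le_mulConst (m := m)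
  have hn := one_le_idxCard (m := m)
  have hε := epsW_pos (m := m)
  have hc0 : 0 < mulConst m := by linarith
  obtain ⟨C, hC, H⟩ := exists_energy_inequality m
  have small : ∀ {r : ℝ}, r ≤ 1 / (12 * mulConst m) → mulConst m * r ≤ 1 / 12 := by
    intro r hr
    calc mulConst m * r ≤ mulConst m * (1 / (12 * mulConst m)) := by gcongr
      _ = 1 / 12 := by field_simp
  have hκ : (1 / (16 * idxCard m))⁻¹ = 16 * idxCard m := by rw [one_div, inv_inv]
  have hκ1 : 1 / (16 * idxCard m) ≤ 1 / 16 := by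
    gcongr
    linarith
  -- `𝓓` is `𝓝_s` itself, so its bounds only need `κ < 1`. `δ₀` is the threshold `mulConst m * ‖U‖ ≤
  -- 1/12` of `State.energy_bounds`, and `κ⁻¹ = 16 · idxCard m` is the upper constant there, the
  -- lower one `1/4` being larger than `κ`.
  refine ⟨State.energy, State.dissipation, 1 / (12 * mulConst m), 1 / (16 * idxCard m),
    epsW m ^ 3 / (20 * idxCard m), C, by positivity, by positivity, by linarith, by positivity,
    hC, fun U hU => ?_, fun U => ?_, fun δ hδ T _ U hU hsmall =>
      H hU fun t ht => small ((hsmall t ht).trans hδ)⟩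
  · have h := U.energy_bounds (small hU)
    rw [hκ]
    refine ⟨le_trans ?_ h.1, h.2⟩
    gcongr
    linarith
  · have h := U.dissipation_nonneg
    rw [hκ]
    constructor <;> nlinarith
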